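/- **Setting.** Let $N\ge 1$, let $\Omega\subset\mathbb R^N$ be an open bounded Lipschitz set, let $K\ge 1$ be an integer, and let $B_K=\{\xi\in\mathbb R^N:|\xi|<K\}$. Let $\tilde f:\Omega\times B_K\to\mathbb R$ satisfy: a) there is a Borel function $g$ such that for a.e. $x\in\Omega$, $\tilde f(x,\xi)=g(x,\xi)$ for all $\xi\in B_K$; b) there is $a\in L^1(\Omega)$ such that for a.e. $x\in\Omega$, $0\le\tilde f(x,\xi)\le a(x)$ for all $\xi\in B_K$; c) for every $\delta>0$ there is a compact set $T\subset\Omega$ with $|\Omega\setminus T|<\delta$ such that $\tilde f|_{T\times B_K}$ is continuous in $x$ uniformly with respect to $\xi$: for all $x\in T$ and $\varepsilon>0$ there is $\eta>0$ such that $|\tilde f(y,\xi)-\tilde f(x,\xi)|<\varepsilon$ for all $y\in T$ with $|y-x|<\eta$ and all $\xi\in B_K$. (No continuity in $\xi$ is assumed.) Let $\tilde f^{**}(x,\cdot)$ be the bipolar (Fenchel biconjugate) of $\tilde f(x,\cdot)$, the latter being extended by $+\infty$ outside $B_K$; on $B_K$ it is the greatest convex lower semicontinuous function below $\tilde f(x,\cdot)$.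 Let $W_0^{1,\infty}(\Omega)=W^{1,\infty}(\Omega)\cap W_0^{1,1}(\Omega)$, where $W^{1,1}_0(\Omega)$ is the closure of $C_c^\infty(\Omega)$ in $W^{1,1}(\Omega)$. The weak* topology of $W^{1,\infty}(\Omega)$ is the one induced by $u\mapsto(u,\nabla u)\in L^\infty(\Omega)\times L^\infty(\Omega;\mathbb R^N)$, with the weak* topology of the dual of $L^1(\Omega)\times L^1(\Omega;\mathbb R^N)$. **Theorem.** Let $u\in W^{1,\infty}(\Omega)$ with $\|\nabla u\|_{\infty}<K$. Then $\tilde f^{**}(\cdot,\nabla u(\cdot))$ is integrable on $\Omega$, and there is a sequence $v_n\in u+W_0^{1,\infty}(\Omega)$ with $\|\nabla v_n\|_\infty<K$ for all $n$, with every $\tilde f(\cdot,\nabla v_n(\cdot))$ integrable, and such that $$\lim_{n\to\infty}\|v_n-u\|_\infty=0,\qquad \lim_{n\to\infty}\int_\Omega\tilde f(x,\nabla v_n(x))\,dx=\int_\Omega\tilde f^{**}(x,\nabla u(x))\,dx .$$ Furthermore $$\mathrm{sc}^-(F_\infty)(u)=\int_\Omega\tilde f^{**}(x,\nabla u(x))\,dx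 ,$$ where $F_\infty(w)=\int_\Omega\tilde f(x,\nabla w(x))\,dx$ if $w\in D$ and $\nabla w(x)\in B_K$ for a.e. $x\in\Omega$, and $F_\infty(w)=+\infty$ for all other $w\in W^{1,\infty}(\Omega)$. Here $D$ is any class with $u+W_0^{1,\infty}(\Omega)\subset D\subset W^{1,\infty}(\Omega)$ (for instance $D=W^{1,\infty}(\Omega)$, or $D=\varphi+W_0^{1,\infty}(\Omega)$ when $u$ belongs to it), and $\mathrm{sc}^-(F_\infty)$ is the lower semicontinuous envelope of $F_\infty$ for the weak* topology of $W^{1,\infty}(\Omega)$, i.e. the greatest weak* lower semicontinuous functional below $F_\infty$. The same identity holds for the greatest sequentially weak* lower semicontinuous functional below $F_\infty$. -/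

import Mathlib

open MeasureTheory Set Filter Topology
open scoped ENNReal NNReal ContDiff

noncomputable section

/-- `ℝᴺ` with its Euclidean norm. -/
abbrev RN (N : ℕ) : Type := EuclideanSpace ℝ (Fin N)

/-- Lebesgue measure on `Ω ⊆ ℝᴺ`. -/
abbrev lebOn {N : ℕ} (Ω : Set (RN N)) : Measure (RN N) := volume.restrict Ω

/-- Lipschitz sets: near every boundary point `p` there are a direction `e` and a Lipschitz function
`γ` of the coordinates orthogonal to `e` (that is, invariant under translation along `e`) such that
`Ω` is locally the set of points lying strictly above the graph of `γ` in the direction `e`. -/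
def IsLipschitzSet {N : ℕ} (Ω : Set (RN N)) : Prop :=
  ∀ p ∈ frontier Ω, ∃ (r : ℝ) (e : RN N) (L : ℝ≥0) (γ : RN N → ℝ),
    0 < r ∧ ‖e‖ = 1 ∧ LipschitzWith L γ ∧ (∀ y (t : ℝ), γ (y + t • e) = γ y) ∧
    ∀ y ∈ Metric.ball p r, y ∈ Ω ↔ γ y < inner ℝ e y

/-- Test functions: `φ ∈ C_c^∞(Ω)`. -/
def IsTestFunction {N : ℕ} (Ω : Set (RN N)) (φ : RN N → ℝ) : Prop :=
  ContDiff ℝ ∞ φ ∧ HasCompactSupport φ ∧ tsupport φ ⊆ Ω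

/-- `G` is the weak gradient of `u` on `Ω`, for essentially bounded `u` and `G`. -/
def HasWeakGradient {N : ℕ} (Ω : Set (RN N)) (u : RN N → ℝ) (G : RN N → RN N) : Prop :=
  ∀ φ, IsTestFunction Ω φ → ∀ e : RN N,
    ∫ x in Ω, u x * inner ℝ (gradient φ x) e = -∫ x in Ω, inner ℝ (G x) e * φ x

theorem IsTestFunction.integrable {N : ℕ} {Ω : Set (RN N)} {φ : RN N → ℝ}
    (hφ : IsTestFunction Ω φ) : Integrable φ (lebOn Ω) :=
  (hφ.1.continuous.integrable_of_hasCompactSupport hφ.2.1).restrict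

theorem IsTestFunction.integrable_gradient {N : ℕ} {Ω : Set (RN N)} {φ : RN N → ℝ}
    (hφ : IsTestFunction Ω φ) (e : RN N) :
    Integrable (fun x => inner ℝ (gradient φ x) e) (lebOn Ω) := by
  have h1 : (fun x => inner ℝ (gradient φ x) e) = fun x => fderiv ℝ φ x e := by
    funext x
    simp [gradient]
  rw [h1]
  have hc : Continuous (fun x => fderiv ℝ φ x e) :=
    (hφ.1.continuous_fderiv (by simp)).clm_apply continuous_const
  exact (hc.integrable_of_hasCompactSupport (hφ.2.1.fderiv_apply (𝕜 := ℝ) e)).restrict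

/-- The Sobolev space `W^{1,∞}(Ω)`: pairs `(u, ∇u) ∈ L^∞(Ω) × L^∞(Ω; ℝᴺ)` such that `∇u` is the weak
gradient of `u`. -/
def W1Inf {N : ℕ} (Ω : Set (RN N)) : Submodule ℝ (Lp ℝ ∞ (lebOn Ω) × Lp (RN N) ∞ (lebOn Ω)) where
  carrier := {p | HasWeakGradient Ω p.1 p.2}
  zero_mem' := by
    intro φ hφ e
    have h1 : ∫ x in Ω, ((0 : Lp ℝ ∞ (lebOn Ω)) : RN N → ℝ) x * inner ℝ (gradient φ x) e = 0 :=
      integral_eq_zero_of_ae (by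
        filter_upwards [Lp.coeFn_zero ℝ ∞ (lebOn Ω)] with x hx
        rw [hx]; simp)
    have h2 : ∫ x in Ω, inner ℝ (((0 : Lp (RN N) ∞ (lebOn Ω)) : RN N → RN N) x) e * φ x = 0 :=
      integral_eq_zero_of_ae (by
        filter_upwards [Lp.coeFn_zero (RN N) ∞ (lebOn Ω)] with x hx
        rw [hx]; simp)
    simpa using h1.trans (by rw [← neg_zero, ← h2]; rfl)
  add_mem' := by
    intro p q hp hq φ hφ e
    have hi1 : ∀ u : Lp ℝ ∞ (lebOn Ω),
        Integrable (fun x => u x * inner ℝ (gradient φ x) e) (lebOn Ω) := fun u =>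
      (hφ.integrable_gradient e).mul_of_top_right (Lp.memLp u)
    have hi2 : ∀ G : Lp (RN N) ∞ (lebOn Ω),
        Integrable (fun x => inner ℝ (G x) e * φ x) (lebOn Ω) := fun G =>
      hφ.integrable.mul_of_top_right ((Lp.memLp G).inner_const e)
    have h1 : ∫ x in Ω, (p.1 + q.1 : Lp ℝ ∞ (lebOn Ω)) x * inner ℝ (gradient φ x) e =
        (∫ x in Ω, p.1 x * inner ℝ (gradient φ x) e) +
          ∫ x in Ω, q.1 x * inner ℝ (gradient φ x) e := by
      rw [← integral_add (hi1 _) (hi1 _)]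
      refine integral_congr_ae ?_
      filter_upwards [Lp.coeFn_add p.1 q.1] with x hx
      simp only [hx, Pi.add_apply, add_mul]
    have h2 : ∫ x in Ω, inner ℝ ((p.2 + q.2 : Lp (RN N) ∞ (lebOn Ω)) x) e * φ x =
        (∫ x in Ω, inner ℝ (p.2 x) e * φ x) + ∫ x in Ω, inner ℝ (q.2 x) e * φ x := by
      rw [← integral_add (hi2 _) (hi2 _)]
      refine integral_congr_ae ?_
      filter_upwards [Lp.coeFn_add p.2 q.2] with x hx
      simp only [hx, Pi.add_apply, inner_add_left, add_mul]
    have h3 := hp φ hφ e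
    have h4 := hq φ hφ e
    simp only [Prod.fst_add, Prod.snd_add]
    rw [h1, h2, h3, h4]
    ring
  smul_mem' := by
    intro c p hp φ hφ e
    have h1 : ∫ x in Ω, (c • p.1 : Lp ℝ ∞ (lebOn Ω)) x * inner ℝ (gradient φ x) e =
        c * ∫ x in Ω, p.1 x * inner ℝ (gradient φ x) e := by
      rw [← integral_const_mul]
      refine integral_congr_ae ?_
      filter_upwards [Lp.coeFn_smul c p.1] with x hx
      simp only [hx, Pi.smul_apply, smul_eq_mul, mul_assoc]
    have h2 : ∫ x in Ω, inner ℝ ((c • p.2 : Lp (RN N) ∞ (lebOn Ω)) x) e * φ x =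
        c * ∫ x in Ω, inner ℝ (p.2 x) e * φ x := by
      rw [← integral_const_mul]
      refine integral_congr_ae ?_
      filter_upwards [Lp.coeFn_smul c p.2] with x hx
      simp only [hx, Pi.smul_apply, real_inner_smul_left, mul_assoc]
    have h3 := hp φ hφ e
    simp only [Prod.smul_fst, Prod.smul_snd]
    rw [h1, h2, h3]
    ring

/-- The function `u ∈ L^∞(Ω)` underlying an element of `W^{1,∞}(Ω)`. -/
def sobVal {N : ℕ} {Ω : Set (RN N)} (u : W1Inf Ω) : Lp ℝ ∞ (lebOn Ω) := u.1.1

/-- The weak gradient `∇u ∈ L^∞(Ω; ℝᴺ)`; its norm is `‖∇u‖_∞`. -/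
def sobGrad {N : ℕ} {Ω : Set (RN N)} (u : W1Inf Ω) : Lp (RN N) ∞ (lebOn Ω) := u.1.2

/-- `W_0^{1,∞}(Ω) = W^{1,∞}(Ω) ∩ W_0^{1,1}(Ω)`: the elements of `W^{1,∞}(Ω)` that are limits of
functions of `C_c^∞(Ω)` in the norm of `W^{1,1}(Ω)`. -/
def W01Inf {N : ℕ} (Ω : Set (RN N)) : Set (W1Inf Ω) :=
  {w | ∃ φ : ℕ → RN N → ℝ, (∀ k, IsTestFunction Ω (φ k)) ∧
    Tendsto (fun k => eLpNorm (fun x => sobVal w x - φ k x) 1 (lebOn Ω)) atTop (𝓝 0) ∧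
    Tendsto (fun k => eLpNorm (fun x => sobGrad w x - gradient (φ k) x) 1 (lebOn Ω)) atTop (𝓝 0)}

/-- The weak* topology of `W^{1,∞}(Ω)`: the topology induced by the embedding `u ↦ (u, ∇u)` into
`L^∞(Ω) × L^∞(Ω; ℝᴺ)` with its weak* topology as the dual of `L^1(Ω) × L^1(Ω; ℝᴺ)`. -/
@[reducible] def weakStarTopology {N : ℕ} (Ω : Set (RN N)) : TopologicalSpace (W1Inf Ω) :=
  TopologicalSpace.induced
    (fun u => ((fun g : Lp ℝ 1 (lebOn Ω) => ∫ x in Ω, sobVal u x * g x),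
      (fun h : Lp (RN N) 1 (lebOn Ω) => ∫ x in Ω, inner ℝ (sobGrad u x) (h x))))
    (inferInstance : TopologicalSpace
      ((Lp ℝ 1 (lebOn Ω) → ℝ) × (Lp (RN N) 1 (lebOn Ω) → ℝ)))

/-- The conditions on the Lagrangian `f(x, ξ)`; only its values on `Ω × B_K(0)` matter. -/
structure IsAdmissibleLagrangian {N : ℕ} (Ω : Set (RN N)) (K : ℝ) (f : RN N → RN N → ℝ) :
    Prop where
  /-- for almost every `x`, `f(x, ·)` coincides on `B_K(0)` with `g(x, ·)`, for a Borel `g` -/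
  borel : ∃ g : RN N × RN N → ℝ, Measurable g ∧
    ∀ᵐ x ∂(lebOn Ω), ∀ ξ ∈ Metric.ball (0 : RN N) K, f x ξ = g (x, ξ)
  /-- `0 ≤ f(x, ξ) ≤ a(x)` with `a ∈ L^1(Ω)` -/
  bound : ∃ a : RN N → ℝ, IntegrableOn a Ω ∧
    ∀ᵐ x ∂(lebOn Ω), ∀ ξ ∈ Metric.ball (0 : RN N) K, 0 ≤ f x ξ ∧ f x ξ ≤ a x
  /-- off sets of small measure, `f` is continuous in `x` uniformly in `ξ` -/
  lusin : ∀ δ : ℝ, 0 < δ → ∃ T : Set (RN N), T ⊆ Ω ∧ IsCompact T ∧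
    volume (Ω \ T) < ENNReal.ofReal δ ∧
    ∀ x ∈ T, ∀ ε : ℝ, 0 < ε → ∃ η : ℝ, 0 < η ∧ ∀ y ∈ T, dist y x < η →
      ∀ ξ ∈ Metric.ball (0 : RN N) K, |f y ξ - f x ξ| < ε

/-- The polar (Fenchel conjugate) `φ*(p) = sup_{η ∈ B} (⟨p, η⟩ - φ(η))` of a function `φ` on `B`,
understood as `+∞` outside `B`. The supremum is finite when `B` is nonempty and bounded and `φ` is
bounded below on `B`. -/
def polar {N : ℕ} (B : Set (RN N)) (φ : RN N → ℝ) (p : RN N) : ℝ :=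
  sSup ((fun η => inner ℝ p η - φ η) '' B)

/-- The bipolar `φ**(ξ) = sup_p (⟨p, ξ⟩ - φ*(p))`, for `ξ ∈ B` (where it is at most `φ(ξ)`). -/
def bipolar {N : ℕ} (B : Set (RN N)) (φ : RN N → ℝ) (ξ : RN N) : ℝ :=
  ⨆ p : RN N, (inner ℝ p ξ - polar B φ p)

open Classical in
/-- The functional `F_∞(w) = ∫_Ω f(x, ∇w(x)) dx` with values in `[-∞, +∞]`, on the functions `w` of
the class `D` for which the integrand is defined, i.e. `∇w(x) ∈ B_K(0)` for almost every `x ∈ Ω`;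
it is `+∞` elsewhere. -/
def FInf {N : ℕ} (Ω : Set (RN N)) (K : ℝ) (f : RN N → RN N → ℝ) (D : Set (W1Inf Ω))
    (w : W1Inf Ω) : EReal :=
  if w ∈ D ∧ ∀ᵐ x ∂(lebOn Ω), sobGrad w x ∈ Metric.ball (0 : RN N) K then
    ((∫ x in Ω, f x (sobGrad w x) : ℝ) : EReal)
  else ⊤

/-- The lower semicontinuous envelope of `F` for the topology `t`: the greatest `t`-lower
semicontinuous function below `F`. -/
def lscEnvelope {X : Type*} (t : TopologicalSpace X) (F : X → EReal) (x : X) : EReal :=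
  sSup {r | ∃ G : X → EReal, (@LowerSemicontinuous X EReal t _ G) ∧ (∀ y, G y ≤ F y) ∧ G x = r}

/-- Sequential lower semicontinuity for the topology `t`. -/
def SeqLSC {X : Type*} (t : TopologicalSpace X) (G : X → EReal) : Prop :=
  ∀ (s : ℕ → X) (x : X), Tendsto s atTop (@nhds X t x) → G x ≤ liminf (fun n => G (s n)) atTop

/-- The sequentially lower semicontinuous envelope of `F` for the topology `t`: the greatest
sequentially `t`-lower semicontinuous function below `F`. -/
def seqLscEnvelope {X : Type*} (t : TopologicalSpace X) (F : X → EReal) (x : X) : EReal :=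
  sSup {r | ∃ G : X → EReal, SeqLSC t G ∧ (∀ y, G y ≤ F y) ∧ G x = r}

end

/-! ### Gradients of Lipschitz functions; gluing and truncation. -/

section LipschitzGradients

variable {N : ℕ}

/-! The integral of the bipolar along `∇u` is reached from above by oscillating gradients and
supported from below by weak* continuous affine functionals. Continuity of `f` in `ξ` enters
nowhere.

Upper bound, frozen in `x`. Fix a bounded nonnegative Borel function `φ` of the slope. If slopes
`ξ₁`, `ξ₂` can be realised at costs `c₁`, `c₂`, then a fine sawtooth in the direction `ξ₁ - ξ₂`,
truncated near the boundary and perturbed again inside its stripes, realises `a • ξ₁ + b • ξ₂` at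
cost `a * c₁ + b * c₂` (`Laminable.combo`); the proportions are forced because the gradient of a
compactly supported function has mean zero. Hence the infimal cost is a convex function on the open
ball, lying below `φ`. Its affine support at a slope is a competitor in the definition of the
bipolar, so the infimal cost is at most the bipolar (`laminable_bipolar`). No explicit decomposition
of a slope is ever chosen.

Localisation. An element of `W^{1,∞}` is locally Lipschitz with constant `‖∇u‖_∞ < K`, so near
almost every point it can be made affine on most of a small ball while the gradient stays strictly
inside `B_K` (`exists_ball_perturbation`). On a Lusin set, `f(x, ·)` is uniformly close to `f(x₀,
·)`, and at Lebesgue points the frozen bipolar is close to its mean (`eventually_isRelaxationBall`).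
Finitely many disjoint balls cover nearly all of the Lusin set, and the bound `a` controls what
remains (`exists_perturbation`).

Lower bound. A measurable choice of approximate subgradients of the bipolar along `∇u` is
integrable, because `‖∇u‖_∞ < K` leaves room to move in every direction. It defines a weak*
continuous affine functional below `F_∞` whose value at `u` is the relaxed energy up to `ε`
(`exists_affine_minorant`). This yields the lower bound for both envelopes and also the liminf
inequality along the recovery sequence, which converges weak* because uniformly small functions with
bounded gradients have gradients tending weakly to zero. -/

theorem gradient_add' {f g : RN N → ℝ} {x : RN N} (hf : DifferentiableAt ℝ f x)
    (hg : DifferentiableAt ℝ g x) :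
    gradient (fun y => f y + g y) x = gradient f x + gradient g x := by
  simp only [gradient, fderiv_fun_add hf hg, map_add]

theorem gradient_sub' {f g : RN N → ℝ} {x : RN N} (hf : DifferentiableAt ℝ f x)
    (hg : DifferentiableAt ℝ g x) :
    gradient (fun y => f y - g y) x = gradient f x - gradient g x := by
  simp only [gradient, fderiv_fun_sub hf hg, map_sub]

theorem norm_gradient (f : RN N → ℝ) (x : RN N) : ‖gradient f x‖ = ‖fderiv ℝ f x‖ := by
  simp [gradient]

theorem LipschitzWith.norm_gradient_le {f : RN N → ℝ} {C : ℝ≥0} (hf : LipschitzWith C f)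
    (x : RN N) : ‖gradient f x‖ ≤ C :=
  (norm_gradient f x).trans_le (norm_fderiv_le_of_lipschitz ℝ hf)

theorem measurable_gradient (f : RN N → ℝ) : Measurable (gradient f) :=
  (InnerProductSpace.toDual ℝ (RN N)).symm.continuous.measurable.comp (measurable_fderiv ℝ f)

/-- Two functions, one above the other, that touch at `x` have the same gradient there. -/
theorem gradient_eq_of_le {f g : RN N → ℝ} {x : RN N} (hf : DifferentiableAt ℝ f x)
    (hg : DifferentiableAt ℝ g x) (hle : ∀ y, f y ≤ g y) (heq : f x = g x) :
    gradient g x = gradient f x := by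
  have h1 : IsLocalMin (fun y => g y - f y) x :=
    Eventually.of_forall fun y => by simp [heq, hle y]
  have h2 := h1.fderiv_eq_zero
  rw [fderiv_fun_sub hg hf, sub_eq_zero] at h2
  simp only [gradient, h2]

/-- Where a clamped function is differentiable, its gradient is that of the function or of one of
the barriers. -/
theorem gradient_clamp {e h : RN N → ℝ} {x : RN N} (he : DifferentiableAt ℝ e x)
    (hh : DifferentiableAt ℝ h x)
    (hm : DifferentiableAt ℝ (fun y => max (e y) (-h y)) x)
    (hc : DifferentiableAt ℝ (fun y => min (max (e y) (-h y)) (h y)) x) :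
    gradient (fun y => min (max (e y) (-h y)) (h y)) x = gradient e x ∨
      ‖gradient (fun y => min (max (e y) (-h y)) (h y)) x‖ = ‖gradient h x‖ := by
  rcases le_total (max (e x) (-h x)) (h x) with h1 | h1
  · have h2 := gradient_eq_of_le hc hm (fun y => min_le_left _ _) (min_eq_left h1)
    rw [← h2]
    rcases le_total (e x) (-h x) with h3 | h3
    · right
      have h4 : gradient (fun y => -h y) x = -gradient h x := by
        simp only [gradient, fderiv_fun_neg, map_neg]
      rw [gradient_eq_of_le hh.fun_neg hm (fun y => le_max_right _ _) (max_eq_right h3).symm, h4,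
        norm_neg]
    · left
      exact gradient_eq_of_le he hm (fun y => le_max_left _ _) (max_eq_left h3).symm
  · right
    rw [← gradient_eq_of_le hc hh (fun y => min_le_right _ _) (min_eq_right h1)]

/-- Lipschitz functions with compact support in `U`. -/
structure IsLipTest (U : Set (RN N)) (ψ : RN N → ℝ) : Prop where
  lipschitz : ∃ C, LipschitzWith C ψ
  compact : HasCompactSupport ψ
  subset : tsupport ψ ⊆ U

theorem IsLipTest.mono {U V : Set (RN N)} {ψ : RN N → ℝ} (h : IsLipTest U ψ) (hUV : U ⊆ V) :
    IsLipTest V ψ :=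
  ⟨h.lipschitz, h.compact, h.subset.trans hUV⟩

theorem IsLipTest.zero (U : Set (RN N)) : IsLipTest U (fun _ => (0 : ℝ)) := by
  refine ⟨⟨0, LipschitzWith.const 0⟩, HasCompactSupport.zero, ?_⟩
  have h : tsupport (fun _ : RN N => (0 : ℝ)) = ∅ := tsupport_eq_empty_iff.2 rfl
  simp [h]

theorem IsLipTest.add {U : Set (RN N)} {ψ χ : RN N → ℝ} (h : IsLipTest U ψ)
    (h' : IsLipTest U χ) : IsLipTest U (fun x => ψ x + χ x) := by
  obtain ⟨C, hC⟩ := h.lipschitz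
  obtain ⟨D, hD⟩ := h'.lipschitz
  exact ⟨⟨C + D, hC.add hD⟩, h.compact.add h'.compact,
    (tsupport_add ψ χ).trans (union_subset h.subset h'.subset)⟩

theorem IsLipTest.sum {ι : Type*} {U : Set (RN N)} {ψ : ι → RN N → ℝ} (t : Finset ι)
    (h : ∀ i ∈ t, IsLipTest U (ψ i)) : IsLipTest U (fun x => ∑ i ∈ t, ψ i x) := by
  classical
  induction t using Finset.induction_on with
  | empty => simpa using IsLipTest.zero U
  | insert i t hi ih =>
    simp only [Finset.sum_insert hi]
    exact (h i (by simp)).add (ih fun j hj => h j (by simp [hj]))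

theorem IsLipTest.continuous {U : Set (RN N)} {ψ : RN N → ℝ} (h : IsLipTest U ψ) :
    Continuous ψ :=
  h.lipschitz.choose_spec.continuous

theorem IsLipTest.ae_differentiableAt {U : Set (RN N)} {ψ : RN N → ℝ} (h : IsLipTest U ψ) :
    ∀ᵐ x, DifferentiableAt ℝ ψ x :=
  h.lipschitz.choose_spec.ae_differentiableAt

theorem IsLipTest.eventuallyEq_zero {U : Set (RN N)} {ψ : RN N → ℝ} (h : IsLipTest U ψ)
    {x : RN N} (hx : x ∉ U) : ψ =ᶠ[𝓝 x] fun _ => 0 :=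
  notMem_tsupport_iff_eventuallyEq.1 fun hx' => hx (h.subset hx')

theorem IsLipTest.eq_zero {U : Set (RN N)} {ψ : RN N → ℝ} (h : IsLipTest U ψ)
    {x : RN N} (hx : x ∉ U) : ψ x = 0 :=
  (h.eventuallyEq_zero hx).eq_of_nhds

theorem IsLipTest.gradient_eq_zero {U : Set (RN N)} {ψ : RN N → ℝ} (h : IsLipTest U ψ)
    {x : RN N} (hx : x ∉ U) : gradient ψ x = 0 := by
  rw [(h.eventuallyEq_zero hx).gradient_eq, gradient_fun_const]

/-- Supports in disjoint sets leave at most one nonzero term at each point. Finitely many local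
perturbations can thus be added without their bounds accumulating. -/
theorem sum_eq_of_mem {ι : Type*} {V : ι → Set (RN N)} {ψ : ι → RN N → ℝ} {t : Finset ι}
    (h : ∀ i ∈ t, IsLipTest (V i) (ψ i)) (hd : (t : Set ι).PairwiseDisjoint V) {j : ι}
    (hj : j ∈ t) {x : RN N} (hx : x ∈ V j) : ∑ i ∈ t, ψ i x = ψ j x :=
  Finset.sum_eq_single_of_mem j hj fun i hi hij =>
    (h i hi).eq_zero fun hx' => (hd hi hj hij).le_bot ⟨hx', hx⟩

theorem gradient_sum_eq_of_mem {ι : Type*} {V : ι → Set (RN N)} {ψ : ι → RN N → ℝ} {t : Finset ι}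
    (h : ∀ i ∈ t, IsLipTest (V i) (ψ i)) (hd : (t : Set ι).PairwiseDisjoint V)
    (ho : ∀ i ∈ t, IsOpen (V i)) {j : ι}
    (hj : j ∈ t) {x : RN N} (hx : x ∈ V j) :
    gradient (fun y => ∑ i ∈ t, ψ i y) x = gradient (ψ j) x := by
  refine Filter.EventuallyEq.gradient_eq ?_
  filter_upwards [(ho j hj).mem_nhds hx] with y hy
  exact sum_eq_of_mem h hd hj hy

theorem abs_sum_le_of_pairwiseDisjoint {ι : Type*} {V : ι → Set (RN N)} {ψ : ι → RN N → ℝ}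
    {t : Finset ι} (h : ∀ i ∈ t, IsLipTest (V i) (ψ i)) (hd : (t : Set ι).PairwiseDisjoint V)
    {ε : ℝ} (hε : 0 ≤ ε) (hb : ∀ i ∈ t, ∀ x, |ψ i x| ≤ ε) (x : RN N) :
    |∑ i ∈ t, ψ i x| ≤ ε := by
  by_cases hx : ∃ j ∈ t, x ∈ V j
  · obtain ⟨j, hj, hxj⟩ := hx
    rw [sum_eq_of_mem h hd hj hxj]
    exact hb j hj x
  · push Not at hx
    rw [Finset.sum_eq_zero fun i hi => (h i hi).eq_zero (hx i hi)]
    simpa using hε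

theorem abs_clamp_le (a b : ℝ) (hb : 0 ≤ b) : |min (max a (-b)) b| ≤ |a| := by
  rw [abs_le]
  constructor
  · rcases abs_cases a with h | h <;> simp only [le_min_iff, le_max_iff] <;>
      exact ⟨Or.inl (by linarith), by linarith⟩
  · rcases abs_cases a with h | h
    · exact (min_le_left _ _).trans (max_le h.1.ge (by linarith))
    · exact (min_le_left _ _).trans (max_le (by linarith) (by linarith))

/-- Lattice truncation: a Lipschitz function that is small on `U` can be modified near the boundary
of `U` into one with compact support, without increasing its gradient beyond `s`. -/
theorem exists_lattice_truncation {U : Set (RN N)} (hUb : Bornology.IsBounded U)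
    {e : RN N → ℝ} {L : ℝ≥0} (he : LipschitzWith L e) {s δ κ : ℝ}
    (hs : 0 ≤ s) (hδ : 0 < δ) (hκ : 0 ≤ κ) (heκ : ∀ x ∈ U, |e x| ≤ κ) (hκs : κ ≤ s * δ) :
    ∃ ψ : RN N → ℝ, IsLipTest U ψ ∧ (∀ x, |ψ x| ≤ κ) ∧
      (∀ x, 2 * δ ≤ Metric.infDist x Uᶜ → ψ x = e x) ∧
      ∀ᵐ x, gradient ψ x = gradient e x ∨ ‖gradient ψ x‖ ≤ s := by
  -- The barrier has slope `s`, vanishes within distance `δ` of the complement, which makes the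
  -- support of the clamp compact in `U`, and at depth `2 * δ` has height at least `s * δ ≥ κ`, so
  -- that there the clamp is inactive.
  set h : RN N → ℝ := fun x => s * max (Metric.infDist x Uᶜ - δ) 0 with hh
  have hh0 : ∀ x, 0 ≤ h x := fun x => mul_nonneg hs (le_max_right _ _)
  have hhl : LipschitzWith s.toNNReal h := by
    have h1 : LipschitzWith 1 fun x : RN N => max (Metric.infDist x Uᶜ - δ) 0 := by
      refine LipschitzWith.max_const ?_ 0
      refine LipschitzWith.of_dist_le_mul fun x y => ?_
      have := (Metric.lipschitz_infDist_pt Uᶜ).dist_le_mul x y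
      simpa [Real.dist_eq] using this
    refine LipschitzWith.of_dist_le_mul fun x y => ?_
    have := h1.dist_le_mul x y
    rw [Real.dist_eq] at this ⊢
    rw [hh, ← mul_sub, abs_mul, abs_of_nonneg hs, Real.coe_toNNReal s hs]
    gcongr
    simpa using this
  have hml : LipschitzWith (max L s.toNNReal) fun y => max (e y) (-h y) := by
    have := he.max hhl.neg
    simpa using this
  have hcl : LipschitzWith (max (max L s.toNNReal) s.toNNReal)
      fun y => min (max (e y) (-h y)) (h y) := hml.min hhl
  have hz : ∀ x, Metric.infDist x Uᶜ ≤ δ → min (max (e x) (-h x)) (h x) = 0 := by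
    intro x hx
    have : h x = 0 := by simp [hh, hx]
    simp [this]
  have hts : tsupport (fun y => min (max (e y) (-h y)) (h y)) ⊆ {x | δ ≤ Metric.infDist x Uᶜ} := by
    refine closure_minimal ?_ (isClosed_le continuous_const (Metric.continuous_infDist_pt _))
    intro x hx
    by_contra hx'
    exact hx (hz x (not_le.1 hx').le)
  have hsub : {x | δ ≤ Metric.infDist x Uᶜ} ⊆ U := by
    intro x hx
    by_contra hx'
    have h1 : Metric.infDist x Uᶜ = 0 := Metric.infDist_zero_of_mem hx'
    simp only [mem_ofPred_eq] at hx
    linarith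
  have hab : ∀ x, |min (max (e x) (-h x)) (h x)| ≤ κ := by
    intro x
    by_cases hx : x ∈ U
    · exact (abs_clamp_le _ _ (hh0 x)).trans (heκ x hx)
    · rw [hz x (by rw [Metric.infDist_zero_of_mem hx]; exact hδ.le)]
      simpa using hκ
  refine ⟨fun y => min (max (e y) (-h y)) (h y), ⟨⟨_, hcl⟩, ?_, hts.trans hsub⟩, hab, ?_, ?_⟩
  · exact Metric.isCompact_of_isClosed_isBounded (isClosed_tsupport _)
      (hUb.subset (hts.trans hsub))
  · intro x hx
    have hxU : x ∈ U := hsub (by simp only [mem_ofPred_eq]; linarith)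
    have h1 : κ ≤ h x := by
      refine hκs.trans ?_
      simp only [hh]
      gcongr
      exact le_max_of_le_left (by linarith)
    have h2 := abs_le.1 ((heκ x hxU).trans h1)
    simp only
    rw [max_eq_left h2.1, min_eq_left h2.2]
  · filter_upwards [he.ae_differentiableAt, hhl.ae_differentiableAt, hml.ae_differentiableAt,
      hcl.ae_differentiableAt] with x h1 h2 h3 h4
    rcases gradient_clamp h1 h2 h3 h4 with h5 | h5
    · exact Or.inl h5
    · right
      rw [h5]
      exact (hhl.norm_gradient_le x).trans (Real.coe_toNNReal s hs).le

/-- Integration by parts against the constant function `1`. The direction `-d` absorbs the sign in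
the integration by parts formula. -/
theorem integral_inner_gradient_eq_zero {ψ : RN N → ℝ} {U : Set (RN N)} (hψ : IsLipTest U ψ)
    (d : RN N) : ∫ x, inner ℝ (gradient ψ x) d = 0 := by
  obtain ⟨C, hC⟩ := hψ.lipschitz
  have h := (LipschitzWith.const (α := RN N) (1 : ℝ)).integral_lineDeriv_mul_eq (μ := volume) hC
    hψ.compact (-d)
  have h0 : ∀ x : RN N, lineDeriv ℝ (fun _ : RN N => (1 : ℝ)) x (-d) = 0 := fun x => by
    rw [(differentiableAt_const (1 : ℝ)).lineDeriv_eq_fderiv]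
    simp
  simp only [neg_neg, mul_one, h0, zero_mul, integral_zero] at h
  rw [h]
  refine integral_congr_ae ?_
  filter_upwards [hC.ae_differentiableAt] with x hx
  rw [hx.lineDeriv_eq_fderiv, inner_gradient_left]

end LipschitzGradients

/-! ### Sawtooth functions with two prescribed gradients. -/

section Sawtooth

variable {N : ℕ}

theorem hasGradientAt_affine (c : ℝ) (d x : RN N) :
    HasGradientAt (fun y => c + inner ℝ d y) d x := by
  rw [hasGradientAt_iff_hasFDerivAt]
  have h : HasFDerivAt (fun y => inner ℝ d y) (InnerProductSpace.toDual ℝ (RN N) d) x :=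
    (InnerProductSpace.toDual ℝ (RN N) d).hasFDerivAt
  exact h.const_add c

theorem volume_hyperplane {d : RN N} (hd : d ≠ 0) (t : ℝ) :
    volume {x : RN N | inner ℝ d x = t} = 0 := by
  by_cases hne : ∃ x₀ : RN N, inner ℝ d x₀ = t
  · obtain ⟨x₀, hx₀⟩ := hne
    let W : Submodule ℝ (RN N) := LinearMap.ker (InnerProductSpace.toDual ℝ (RN N) d).toLinearMap
    have hW : W ≠ ⊤ := by
      intro h
      have h1 : d ∈ W := h ▸ Submodule.mem_top
      have h2 : inner ℝ d d = (0 : ℝ) := h1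
      exact hd (inner_self_eq_zero.1 h2)
    have h1 : {x : RN N | inner ℝ d x = t} = (fun x => -x₀ + x) ⁻¹' (W : Set (RN N)) := by
      ext x
      have : -x₀ + x ∈ W ↔ inner ℝ d (-x₀ + x) = (0 : ℝ) := Iff.rfl
      simp only [mem_ofPred_eq, mem_preimage, SetLike.mem_coe, this, inner_add_right,
        inner_neg_right, hx₀]
      constructor <;> intro h <;> linarith
    rw [h1, measure_preimage_add]
    exact Measure.addHaar_submodule _ W hW
  · have : {x : RN N | inner ℝ d x = t} = ∅ := by
      ext x
      simp only [mem_ofPred_eq, mem_empty_iff_false, iff_false]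
      exact fun h => hne ⟨x, h⟩
    simp [this]

/-- The `1`-periodic function with slope `b` on `(0, a)` and slope `-a` on `(a, 1)`, where
`a + b = 1`. -/
noncomputable def sawtooth (a b t : ℝ) : ℝ := min (b * Int.fract t) (a * (1 - Int.fract t))

theorem sawtooth_nonneg {a b : ℝ} (ha : 0 < a) (hb : 0 < b) (t : ℝ) : 0 ≤ sawtooth a b t :=
  le_min (mul_nonneg hb.le (Int.fract_nonneg t))
    (mul_nonneg ha.le (sub_nonneg.2 (Int.fract_lt_one t).le))

theorem sawtooth_le_one {a b : ℝ} (ha : 0 < a) (hb : 0 < b) (hab : a + b = 1) (t : ℝ) :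
    sawtooth a b t ≤ 1 := by
  refine (min_le_left _ _).trans ?_
  have := Int.fract_lt_one t
  have := Int.fract_nonneg t
  nlinarith

/-- The tent over the cell `[k, k + 1]` agrees with the sawtooth on that cell and is nonpositive off
it, so the sawtooth is the upper envelope of its tents. -/
theorem tent_le_sawtooth {a b : ℝ} (ha : 0 < a) (hb : 0 < b) (k : ℤ) (t : ℝ) :
    min (b * (t - k)) (a * (1 - (t - k))) ≤ sawtooth a b t := by
  rcases lt_trichotomy k ⌊t⌋ with h | h | h
  · refine (min_le_right _ _).trans (le_trans ?_ (sawtooth_nonneg ha hb t))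
    have h1 : ((k + 1 : ℤ) : ℝ) ≤ t := Int.le_floor.1 h
    push_cast at h1
    nlinarith
  · rw [h]
    rfl
  · refine (min_le_left _ _).trans (le_trans ?_ (sawtooth_nonneg ha hb t))
    have h1 : t < k := Int.floor_lt.1 h
    nlinarith

/-- The tent of the cell of `s` has slopes of size at most one and lies below the sawtooth at `t`.
Comparing with it avoids any discussion of how many cells separate `s` from `t`. -/
theorem sawtooth_sub_le {a b : ℝ} (ha : 0 < a) (hb : 0 < b) (hab : a + b = 1) (s t : ℝ) :
    sawtooth a b s - sawtooth a b t ≤ |s - t| := by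
  have h1 := tent_le_sawtooth ha hb ⌊s⌋ t
  have h2 : sawtooth a b s = min (b * (s - ⌊s⌋)) (a * (1 - (s - ⌊s⌋))) := rfl
  have h3 : sawtooth a b s - |s - t| ≤ min (b * (t - ⌊s⌋)) (a * (1 - (t - ⌊s⌋))) := by
    rw [h2]
    refine le_min ?_ ?_
    · have := min_le_left (b * (s - ⌊s⌋)) (a * (1 - (s - ⌊s⌋)))
      have : b * (s - t) ≤ |s - t| := by
        rcases abs_cases (s - t) with h | h <;> rw [h.1] <;> nlinarith
      nlinarith
    · have := min_le_right (b * (s - ⌊s⌋)) (a * (1 - (s - ⌊s⌋)))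
      have : -(a * (s - t)) ≤ |s - t| := by
        rcases abs_cases (s - t) with h | h <;> rw [h.1] <;> nlinarith
      nlinarith
  linarith

theorem sawtooth_eq_left {a b : ℝ} (hab : a + b = 1) (hb : 0 < b) {k : ℤ} {t : ℝ}
    (h1 : k < t) (h2 : t < k + a) : sawtooth a b t = b * (t - k) := by
  have hf : ⌊t⌋ = k := Int.floor_eq_iff.2 ⟨h1.le, by linarith⟩
  have hf' : Int.fract t = t - k := by rw [Int.fract, hf]
  rw [sawtooth, hf', min_eq_left]
  nlinarith

theorem sawtooth_eq_right {a b : ℝ} (hab : a + b = 1) (ha : 0 < a) {k : ℤ} {t : ℝ}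
    (h1 : k + a < t) (h2 : t < k + 1) : sawtooth a b t = a * (1 - (t - k)) := by
  have hf : ⌊t⌋ = k := Int.floor_eq_iff.2 ⟨by linarith, by linarith⟩
  have hf' : Int.fract t = t - k := by rw [Int.fract, hf]
  rw [sawtooth, hf', min_eq_right]
  nlinarith

/-- The rescaling `σ * sawtooth a b (⟪d, x⟫ / σ)` keeps the slopes and shrinks the height to `σ`.
The gradient takes its two values on alternating open stripes, and the stripe boundaries are
countably many hyperplanes, hence null. -/
theorem exists_sawtooth_function {d : RN N} (hd : d ≠ 0) {a b σ : ℝ} (ha : 0 < a) (hb : 0 < b)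
    (hab : a + b = 1) (hσ : 0 < σ) :
    ∃ (ζ : RN N → ℝ) (O₁ O₂ : Set (RN N)), (∃ C, LipschitzWith C ζ) ∧ (∀ x, |ζ x| ≤ σ) ∧
      IsOpen O₁ ∧ IsOpen O₂ ∧ Disjoint O₁ O₂ ∧ volume (O₁ ∪ O₂)ᶜ = 0 ∧
      (∀ x ∈ O₁, gradient ζ x = b • d) ∧ (∀ x ∈ O₂, gradient ζ x = -(a • d)) := by
  have hτ : Continuous fun x : RN N => inner ℝ d x / σ := by fun_prop
  set I₁ : Set ℝ := ⋃ k : ℤ, Ioo (k : ℝ) (k + a) with hI₁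
  set I₂ : Set ℝ := ⋃ k : ℤ, Ioo (k + a : ℝ) (k + 1) with hI₂
  refine ⟨fun x => σ * sawtooth a b (inner ℝ d x / σ), (fun x => inner ℝ d x / σ) ⁻¹' I₁,
    (fun x => inner ℝ d x / σ) ⁻¹' I₂, ⟨‖d‖₊, ?_⟩, ?_, ?_, ?_, ?_, ?_, ?_, ?_⟩
  · refine LipschitzWith.of_le_add_mul _ fun x y => ?_
    have h1 := sawtooth_sub_le ha hb hab (inner ℝ d x / σ) (inner ℝ d y / σ)
    have h2 : |inner ℝ d x / σ - inner ℝ d y / σ| ≤ ‖d‖ * dist x y / σ := by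
      rw [← sub_div, abs_div, abs_of_pos hσ, ← inner_sub_right, dist_eq_norm]
      gcongr
      exact abs_real_inner_le_norm d (x - y)
    have h3 := mul_le_mul_of_nonneg_left (h1.trans h2) hσ.le
    rw [mul_div_cancel₀ _ hσ.ne'] at h3
    rw [coe_nnnorm]
    linarith
  · intro x
    have h1 := sawtooth_nonneg ha hb (inner ℝ d x / σ)
    have h2 := sawtooth_le_one ha hb hab (inner ℝ d x / σ)
    rw [abs_of_nonneg (mul_nonneg hσ.le h1)]
    nlinarith
  · exact (isOpen_iUnion fun k => isOpen_Ioo).preimage hτ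
  · exact (isOpen_iUnion fun k => isOpen_Ioo).preimage hτ
  · refine Disjoint.preimage _ ?_
    rw [Set.disjoint_left]
    intro t h1 h2
    obtain ⟨k, hk⟩ := mem_iUnion.1 h1
    obtain ⟨l, hl⟩ := mem_iUnion.1 h2
    have e1 : ⌊t⌋ = k := Int.floor_eq_iff.2 ⟨hk.1.le, by linarith [hk.2]⟩
    have e2 : ⌊t⌋ = l := Int.floor_eq_iff.2 ⟨by linarith [hl.1], hl.2⟩
    rw [← e1] at hk
    rw [← e2] at hl
    linarith [hk.2, hl.1]
  · have hsub : ((fun x : RN N => inner ℝ d x / σ) ⁻¹' I₁ ∪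
        (fun x : RN N => inner ℝ d x / σ) ⁻¹' I₂)ᶜ ⊆
        ⋃ k : ℤ, ({x : RN N | inner ℝ d x = σ * k} ∪ {x : RN N | inner ℝ d x = σ * (k + a)}) := by
      intro x hx
      rw [mem_compl_iff, mem_union, not_or] at hx
      refine mem_iUnion.2 ⟨⌊inner ℝ d x / σ⌋, ?_⟩
      set t := inner ℝ d x / σ with ht
      have hxt : inner ℝ d x = σ * t := by rw [ht]; field_simp
      by_contra hcon
      simp only [mem_union, mem_ofPred_eq, not_or, hxt, mul_right_inj' hσ.ne'] at hcon
      have h1 := lt_of_le_of_ne (Int.floor_le t) (Ne.symm hcon.1)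
      rcases lt_or_gt_of_ne hcon.2 with h2 | h2
      · exact hx.1 (mem_iUnion.2 ⟨⌊t⌋, h1, h2⟩)
      · exact hx.2 (mem_iUnion.2 ⟨⌊t⌋, h2, Int.lt_floor_add_one t⟩)
    refine measure_mono_null hsub (measure_iUnion_null fun k => ?_)
    exact measure_union_null (volume_hyperplane hd _) (volume_hyperplane hd _)
  · intro x hx
    obtain ⟨k, hk⟩ := mem_iUnion.1 hx
    have h1 : (fun y : RN N => σ * sawtooth a b (inner ℝ d y / σ)) =ᶠ[𝓝 x]
        fun y => -(σ * b * k) + inner ℝ (b • d) y := by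
      filter_upwards [(isOpen_Ioo.preimage hτ).mem_nhds hk] with y hy
      rw [sawtooth_eq_left hab hb hy.1 hy.2, real_inner_smul_left]
      field_simp
      ring
    rw [h1.gradient_eq, (hasGradientAt_affine _ _ x).gradient]
  · intro x hx
    obtain ⟨k, hk⟩ := mem_iUnion.1 hx
    have h1 : (fun y : RN N => σ * sawtooth a b (inner ℝ d y / σ)) =ᶠ[𝓝 x]
        fun y => σ * a * (1 + k) + inner ℝ (-(a • d)) y := by
      filter_upwards [(isOpen_Ioo.preimage hτ).mem_nhds hk] with y hy
      rw [sawtooth_eq_right hab ha hy.1 hy.2, inner_neg_left, real_inner_smul_left]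
      field_simp
      ring
    rw [h1.gradient_eq, (hasGradientAt_affine _ _ x).gradient]

end Sawtooth

/-! ### Slopes realisable at a given cost. -/

section Laminable

variable {N : ℕ}

/-- The slope `ξ` is laminable at cost `c`: on every bounded open set the affine function of slope
`ξ` can be perturbed by an arbitrarily small Lipschitz function with compact support so that the
gradient stays in a smaller ball and the mean of `φ` over the new gradients is at most `c`, up to an
arbitrarily small error. -/
def Laminable (K : ℝ) (φ : RN N → ℝ) (ξ : RN N) (c : ℝ) : Prop :=
  ∀ U : Set (RN N), IsOpen U → Bornology.IsBounded U → ∀ ε : ℝ, 0 < ε →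
    ∃ ψ : RN N → ℝ, IsLipTest U ψ ∧ (∀ x, |ψ x| ≤ ε) ∧
      (∃ K' < K, ∀ᵐ x, x ∈ U → ‖ξ + gradient ψ x‖ ≤ K') ∧
      ∫ x in U, φ (ξ + gradient ψ x) ≤ c * volume.real U + ε

theorem Laminable.mono {K : ℝ} {φ : RN N → ℝ} {ξ : RN N} {c c' : ℝ} (h : Laminable K φ ξ c)
    (hc : c ≤ c') : Laminable K φ ξ c' := by
  intro U hU hb ε hε
  obtain ⟨ψ, h1, h2, h3, h4⟩ := h U hU hb ε hε
  refine ⟨ψ, h1, h2, h3, h4.trans ?_⟩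
  gcongr

theorem laminable_self {K : ℝ} (φ : RN N → ℝ) {ξ : RN N} (hξ : ‖ξ‖ < K) :
    Laminable K φ ξ (φ ξ) := by
  intro U hU hb ε hε
  refine ⟨fun _ => 0, IsLipTest.zero U, fun x => by simpa using hε.le,
    ⟨‖ξ‖, hξ, Eventually.of_forall fun x _ => ?_⟩, ?_⟩
  · rw [gradient_fun_const, add_zero]
  · simp only [gradient_fun_const, add_zero, integral_const, smul_eq_mul]
    rw [measureReal_restrict_apply_univ]
    linarith [mul_comm (φ ξ) (volume.real U)]

/-- The boundary layers of an open set decrease to the empty set inside a set of finite measure. -/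
theorem tendsto_volume_near_compl {U : Set (RN N)} (hU : IsOpen U) (hb : Bornology.IsBounded U)
    (hc : Uᶜ.Nonempty) {τ : ℝ} (hτ : 0 < τ) :
    ∃ δ : ℝ, 0 < δ ∧ volume.real (U ∩ {x | Metric.infDist x Uᶜ ≤ 2 * δ}) < τ := by
  have hs : Antitone fun n : ℕ => U ∩ {x | Metric.infDist x Uᶜ ≤ 2 * (1 / ((n : ℝ) + 1))} := by
    intro m n hmn x hx
    have h1 : (1 : ℝ) / ((n : ℝ) + 1) ≤ 1 / ((m : ℝ) + 1) := by gcongr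
    have h2 := hx.2
    simp only [mem_ofPred_eq] at h2
    have h3 : Metric.infDist x Uᶜ ≤ 2 * (1 / ((m : ℝ) + 1)) := by linarith
    exact ⟨hx.1, h3⟩
  have hm : ∀ n : ℕ, MeasurableSet (U ∩ {x | Metric.infDist x Uᶜ ≤ 2 * (1 / ((n : ℝ) + 1))}) :=
    fun n => hU.measurableSet.inter
      (isClosed_le (Metric.continuous_infDist_pt _) continuous_const).measurableSet
  have h1 := tendsto_measure_iInter_atTop (μ := volume) (fun n => (hm n).nullMeasurableSet) hs
    ⟨0, ((measure_mono inter_subset_left).trans_lt hb.measure_lt_top).ne⟩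
  have h2 : (⋂ n : ℕ, U ∩ {x | Metric.infDist x Uᶜ ≤ 2 * (1 / ((n : ℝ) + 1))}) = ∅ := by
    ext x
    simp only [mem_iInter, mem_inter_iff, mem_ofPred_eq, mem_empty_iff_false, iff_false, not_forall]
    by_contra hcon
    push Not at hcon
    have hx : x ∈ U := (hcon 0).1
    have hpos : 0 < Metric.infDist x Uᶜ :=
      (hU.isClosed_compl.notMem_iff_infDist_pos hc).1 fun h => h hx
    obtain ⟨n, hn⟩ := exists_nat_one_div_lt (half_pos hpos)
    have := (hcon n).2
    linarith
  rw [h2, measure_empty] at h1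
  obtain ⟨n, hn⟩ := (h1.eventually (gt_mem_nhds (ENNReal.ofReal_pos.2 hτ))).exists
  refine ⟨1 / ((n : ℝ) + 1), by positivity, ?_⟩
  rw [Measure.real]
  exact (ENNReal.lt_ofReal_iff_toReal_lt
    ((measure_mono inter_subset_left).trans_lt hb.measure_lt_top).ne).1 hn

end Laminable

/-! ### Convexity of the laminable costs and comparison with the bipolar. -/

section Laminates

variable {N : ℕ}

/-- `Metric.infDist` to the empty set is `0`, so it measures depth inside `U` only when the
complement is nonempty. In dimension zero the whole space is bounded, whence `0 < N`. -/
theorem nonempty_compl_of_isBounded (hN : 0 < N) {U : Set (RN N)} (hb : Bornology.IsBounded U) :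
    Uᶜ.Nonempty := by
  have : Nonempty (Fin N) := ⟨⟨0, hN⟩⟩
  rw [nonempty_compl]
  rintro rfl
  exact NoncompactSpace.noncompact_univ (X := RN N)
    (Metric.isCompact_of_isClosed_isBounded isClosed_univ hb)

theorem integrableOn_comp_of_bdd {φ : RN N → ℝ} (hφ : Measurable φ) {C : ℝ}
    (h0 : ∀ ξ, 0 ≤ φ ξ) (hC : ∀ ξ, φ ξ ≤ C) {g : RN N → RN N} (hg : Measurable g)
    {V : Set (RN N)} (hV : volume V ≠ ⊤) : IntegrableOn (fun x => φ (g x)) V :=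
  Measure.integrableOn_of_bounded hV (hφ.comp hg).aestronglyMeasurable (M := C)
    (Eventually.of_forall fun x => by
      rw [Real.norm_eq_abs, abs_of_nonneg (h0 _)]
      exact hC _)

theorem setIntegral_comp_le_of_bdd {φ : RN N → ℝ} (hφ : Measurable φ) {C : ℝ}
    (h0 : ∀ ξ, 0 ≤ φ ξ) (hC : ∀ ξ, φ ξ ≤ C) {g : RN N → RN N} (hg : Measurable g)
    {V : Set (RN N)} (hV : volume V ≠ ⊤) : ∫ x in V, φ (g x) ≤ C * volume.real V := by
  refine (integral_mono (integrableOn_comp_of_bdd hφ h0 hC hg hV)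
    (integrableOn_const (C := C) hV) fun x => hC _).trans_eq ?_
  rw [setIntegral_const, smul_eq_mul, mul_comm]

/-- Lipschitz functions whose gradients are `b • d` and `-(a • d)` up to a small set use these
values in the proportions `a` and `b`. -/
theorem volume_le_of_gradient {U V₁ V₂ : Set (RN N)} (hb : Bornology.IsBounded U) (hV₁ : MeasurableSet V₁) (hV₂ : MeasurableSet V₂)
    (hd : Disjoint V₁ V₂) (h1 : V₁ ⊆ U) (h2 : V₂ ⊆ U) {ψ : RN N → ℝ} (hψ : IsLipTest U ψ)
    {d : RN N} (hd0 : d ≠ 0) {a b L : ℝ}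
    (hg1 : ∀ x ∈ V₁, gradient ψ x = b • d) (hg2 : ∀ x ∈ V₂, gradient ψ x = -(a • d))
    (hL : ∀ᵐ x, ‖gradient ψ x‖ ≤ L) :
    |b * volume.real V₁ - a * volume.real V₂| ≤ L / ‖d‖ * volume.real (U \ (V₁ ∪ V₂)) := by
  have hdp : 0 < ‖d‖ := norm_pos_iff.2 hd0
  have hfin : ∀ V ⊆ U, volume V ≠ ⊤ := fun V hV =>
    ((measure_mono hV).trans_lt hb.measure_lt_top).ne
  have hmeas : Measurable fun x => inner ℝ (gradient ψ x) d :=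
    (measurable_gradient ψ).inner_const
  have hbd : ∀ᵐ x, ‖inner ℝ (gradient ψ x) d‖ ≤ L * ‖d‖ := by
    filter_upwards [hL] with x hx
    exact (norm_inner_le_norm _ _).trans (by gcongr)
  have hint : ∀ V ⊆ U, IntegrableOn (fun x => inner ℝ (gradient ψ x) d) V := fun V hV =>
    Measure.integrableOn_of_bounded (hfin V hV) hmeas.aestronglyMeasurable
      (ae_restrict_of_ae hbd)
  -- The component along `d` has mean zero on `U`. Its contributions from `V₁` and `V₂` therefore
  -- balance up to the integral over the remaining set.
  have h3 : ∫ x in U, inner ℝ (gradient ψ x) d = 0 := by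
    rw [setIntegral_eq_integral_of_forall_compl_eq_zero, integral_inner_gradient_eq_zero hψ d]
    intro x hx
    rw [hψ.gradient_eq_zero hx, inner_zero_left]
  have h12 : V₁ ∪ V₂ ⊆ U := union_subset h1 h2
  rw [← integral_inter_add_sdiff (hV₁.union hV₂) (hint U subset_rfl),
    inter_eq_self_of_subset_right h12, setIntegral_union hd hV₂ (hint _ h1) (hint _ h2)] at h3
  have i1 : ∫ x in V₁, inner ℝ (gradient ψ x) d = b * ‖d‖ ^ 2 * volume.real V₁ := by
    rw [setIntegral_congr_fun (g := fun _ => b * ‖d‖ ^ 2) hV₁ fun x hx => by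
      simp only [hg1 x hx, real_inner_smul_left, real_inner_self_eq_norm_sq]]
    rw [setIntegral_const, smul_eq_mul, mul_comm]
  have i2 : ∫ x in V₂, inner ℝ (gradient ψ x) d = -(a * ‖d‖ ^ 2 * volume.real V₂) := by
    rw [setIntegral_congr_fun (g := fun _ => -(a * ‖d‖ ^ 2)) hV₂ fun x hx => by
      simp only [hg2 x hx, inner_neg_left, real_inner_smul_left, real_inner_self_eq_norm_sq]]
    rw [setIntegral_const, smul_eq_mul]
    ring
  have i3 : |∫ x in U \ (V₁ ∪ V₂), inner ℝ (gradient ψ x) d| ≤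
      L * ‖d‖ * volume.real (U \ (V₁ ∪ V₂)) := by
    rw [← Real.norm_eq_abs]
    exact norm_setIntegral_le_of_norm_le_const_ae (hfin _ sdiff_subset).lt_top
      (ae_restrict_of_ae hbd)
  rw [i1, i2] at h3
  have h4 : (b * volume.real V₁ - a * volume.real V₂) * ‖d‖ ^ 2 =
      -∫ x in U \ (V₁ ∪ V₂), inner ℝ (gradient ψ x) d := by linarith
  have h5 : |b * volume.real V₁ - a * volume.real V₂| * ‖d‖ ^ 2 ≤
      L * ‖d‖ * volume.real (U \ (V₁ ∪ V₂)) := by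
    have : ‖d‖ ^ 2 = |‖d‖ ^ 2| := (abs_of_nonneg (by positivity)).symm
    rw [this, ← abs_mul, h4, abs_neg]
    exact i3
  rw [div_mul_eq_mul_div, le_div_iff₀ hdp]
  have h6 : (|b * volume.real V₁ - a * volume.real V₂| * ‖d‖) * ‖d‖ ≤
      (L * volume.real (U \ (V₁ ∪ V₂))) * ‖d‖ := by nlinarith
  exact le_of_mul_le_mul_right h6 hdp

/-- A sawtooth with gradients `b • d` and `-(a • d)`, where `d = ξ₁ - ξ₂`, turns the slope `a • ξ₁ +
b • ξ₂` into `ξ₁` and `ξ₂` on open stripes, where the two given laminations are then inserted.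
`volume_le_of_gradient` shows that the stripes occupy the proportions `a` and `b` up to the boundary
layer. -/
theorem Laminable.combo (hN : 0 < N) {K : ℝ} {φ : RN N → ℝ} (hφ : Measurable φ) {C : ℝ}
    (h0 : ∀ ξ, 0 ≤ φ ξ) (hC : ∀ ξ, φ ξ ≤ C) {ξ₁ ξ₂ : RN N} {c₁ c₂ : ℝ}
    (hξ₁ : ‖ξ₁‖ < K) (hξ₂ : ‖ξ₂‖ < K) (hc₁ : 0 ≤ c₁) (hc₂ : 0 ≤ c₂)
    (h₁ : Laminable K φ ξ₁ c₁) (h₂ : Laminable K φ ξ₂ c₂) {a b : ℝ} (ha : 0 < a) (hb : 0 < b)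
    (hab : a + b = 1) : Laminable K φ (a • ξ₁ + b • ξ₂) (a * c₁ + b * c₂) := by
  -- When the slopes coincide there is no direction of oscillation. The cheaper of the two
  -- laminations then costs no more than the average.
  by_cases hd : ξ₁ - ξ₂ = 0
  · obtain rfl := sub_eq_zero.1 hd
    rw [← add_smul, hab, one_smul]
    rcases le_total c₁ c₂ with h | h
    · exact h₁.mono (by nlinarith)
    · exact h₂.mono (by nlinarith)
  intro U hU hUb ε hε
  set ξ := a • ξ₁ + b • ξ₂ with hξdef
  set d := ξ₁ - ξ₂ with hddef
  have e1 : ξ + b • d = ξ₁ := by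
    rw [hξdef, hddef, smul_sub]
    have : a • ξ₁ + b • ξ₂ + (b • ξ₁ - b • ξ₂) = (a + b) • ξ₁ := by rw [add_smul]; abel
    rw [this, hab, one_smul]
  have e2 : ξ + -(a • d) = ξ₂ := by
    rw [hξdef, hddef, smul_sub]
    have : a • ξ₁ + b • ξ₂ + -(a • ξ₁ - a • ξ₂) = (a + b) • ξ₂ := by rw [add_smul]; abel
    rw [this, hab, one_smul]
  have hξ : ‖ξ‖ < K := by
    have := (convex_ball (0 : RN N) K) (by simpa using hξ₁) (by simpa using hξ₂) ha.le hb.le hab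
    simpa using this
  have hdp : 0 < ‖d‖ := norm_pos_iff.2 hd
  -- Slope allowed to the truncation: `‖ξ‖ + s < K`.
  set s := (K - ‖ξ‖) / 2 with hsdef
  have hs : 0 < s := by rw [hsdef]; linarith
  set L := ‖d‖ + s with hLdef
  have hC0 : 0 ≤ C := (h0 0).trans (hC 0)
  -- Price per unit volume of the part outside the stripes: `(c₁ + c₂) * (L / ‖d‖)` for the
  -- imbalance it causes in the proportions and `C` for the integrand on it. The summand `1` keeps
  -- `A` positive.
  set A := (c₁ + c₂) * (L / ‖d‖) + C + 1 with hAdef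
  have hA : 0 < A := by positivity
  obtain ⟨δ, hδ, hδτ⟩ := tendsto_volume_near_compl hU hUb (nonempty_compl_of_isBounded hN hUb)
    (show 0 < ε / 2 / A by positivity)
  -- The bound `s * δ` is what the truncation requires; `ε / 2` leaves `ε / 4` to each of the two
  -- inner perturbations.
  set σ := min (ε / 2) (s * δ) with hσdef
  have hσ : 0 < σ := lt_min (by positivity) (by positivity)
  obtain ⟨ζ, O₁, O₂, ⟨Cζ, hζL⟩, hζσ, hO₁, hO₂, hOd, hOn, hζ₁, hζ₂⟩ :=
    exists_sawtooth_function hd ha hb hab hσ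
  obtain ⟨ψ₀, hψ₀, hψ₀σ, hψ₀eq, hψ₀g⟩ := exists_lattice_truncation hUb hζL hs.le hδ hσ.le
    (fun x _ => hζσ x) (min_le_right _ _)
  set I : Set (RN N) := {x | 2 * δ < Metric.infDist x Uᶜ} with hIdef
  have hI : IsOpen I := isOpen_lt continuous_const (Metric.continuous_infDist_pt _)
  have hIU : I ⊆ U := by
    intro x hx
    by_contra hxU
    have hx' : 2 * δ < Metric.infDist x Uᶜ := hx
    rw [Metric.infDist_zero_of_mem hxU] at hx'
    linarith
  have hψ₀ζ : ∀ x ∈ I, gradient ψ₀ x = gradient ζ x := by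
    intro x hx
    refine Filter.EventuallyEq.gradient_eq ?_
    filter_upwards [hI.mem_nhds hx] with y hy
    exact hψ₀eq y (le_of_lt hy)
  set V₁ := I ∩ O₁ with hV₁def
  set V₂ := I ∩ O₂ with hV₂def
  have hV₁ : IsOpen V₁ := hI.inter hO₁
  have hV₂ : IsOpen V₂ := hI.inter hO₂
  have hV₁U : V₁ ⊆ U := inter_subset_left.trans hIU
  have hV₂U : V₂ ⊆ U := inter_subset_left.trans hIU
  have hVd : Disjoint V₁ V₂ := hOd.mono inter_subset_right inter_subset_right
  have hg₁ : ∀ x ∈ V₁, gradient ψ₀ x = b • d := fun x hx => by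
    rw [hψ₀ζ x hx.1, hζ₁ x hx.2]
  have hg₂ : ∀ x ∈ V₂, gradient ψ₀ x = -(a • d) := fun x hx => by
    rw [hψ₀ζ x hx.1, hζ₂ x hx.2]
  have hae : ∀ᵐ x : RN N, x ∈ O₁ ∪ O₂ := by
    rw [ae_iff]
    exact hOn
  have hgL : ∀ᵐ x, ‖gradient ψ₀ x‖ ≤ L := by
    filter_upwards [hψ₀g, hae] with x hx hx'
    rcases hx with hx | hx
    · rw [hx]
      rcases hx' with hx' | hx'
      · rw [hζ₁ x hx', norm_smul, Real.norm_eq_abs, abs_of_pos hb]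
        nlinarith
      · rw [hζ₂ x hx', norm_neg, norm_smul, Real.norm_eq_abs, abs_of_pos ha]
        nlinarith
    · exact hx.trans (by rw [hLdef]; linarith)
  have hvol := volume_le_of_gradient hUb hV₁.measurableSet hV₂.measurableSet hVd hV₁U hV₂U hψ₀
    hd hg₁ hg₂ hgL
  obtain ⟨ψ₁, hψ₁, hψ₁ε, ⟨K₁, hK₁, hψ₁K⟩, hψ₁i⟩ := h₁ V₁ hV₁ (hUb.subset hV₁U) (ε / 4) (by positivity)
  obtain ⟨ψ₂, hψ₂, hψ₂ε, ⟨K₂, hK₂, hψ₂K⟩, hψ₂i⟩ := h₂ V₂ hV₂ (hUb.subset hV₂U) (ε / 4) (by positivity)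
  set ψ : RN N → ℝ := fun x => ψ₀ x + (ψ₁ x + ψ₂ x) with hψdef
  have hgrad : ∀ᵐ x, gradient ψ x = gradient ψ₀ x + (gradient ψ₁ x + gradient ψ₂ x) := by
    filter_upwards [hψ₀.ae_differentiableAt, hψ₁.ae_differentiableAt,
      hψ₂.ae_differentiableAt] with x q0 q1 q2
    rw [hψdef, gradient_add' q0 (q1.fun_add q2), gradient_add' q1 q2]
  have hG₁ : ∀ᵐ x, x ∈ V₁ → ξ + gradient ψ x = ξ₁ + gradient ψ₁ x := by
    filter_upwards [hgrad] with x hx hxV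
    rw [hx, hg₁ x hxV, hψ₂.gradient_eq_zero (fun h => hVd.le_bot ⟨hxV, h⟩), add_zero, ← add_assoc,
      e1]
  have hG₂ : ∀ᵐ x, x ∈ V₂ → ξ + gradient ψ x = ξ₂ + gradient ψ₂ x := by
    filter_upwards [hgrad] with x hx hxV
    rw [hx, hg₂ x hxV, hψ₁.gradient_eq_zero (fun h => hVd.le_bot ⟨h, hxV⟩), zero_add, ← add_assoc,
      e2]
  have hmeas : Measurable fun x => ξ + gradient ψ x := (measurable_gradient ψ).const_add ξ
  have hfin : ∀ V ⊆ U, volume V ≠ ⊤ := fun V hV =>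
    ((measure_mono hV).trans_lt hUb.measure_lt_top).ne
  refine ⟨ψ, hψ₀.add ((hψ₁.mono hV₁U).add (hψ₂.mono hV₂U)), ?_, ?_, ?_⟩
  · intro x
    have t0 := hψ₀σ x
    have t1 := hψ₁ε x
    have t2 := hψ₂ε x
    have t3 : σ ≤ ε / 2 := min_le_left _ _
    have t4 := abs_add_le (ψ₀ x) (ψ₁ x + ψ₂ x)
    have t5 := abs_add_le (ψ₁ x) (ψ₂ x)
    simp only [hψdef]
    linarith
  · refine ⟨max (max K₁ K₂) (max (max ‖ξ₁‖ ‖ξ₂‖) (‖ξ‖ + s)), ?_, ?_⟩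
    · simp only [max_lt_iff]
      exact ⟨⟨hK₁, hK₂⟩, ⟨hξ₁, hξ₂⟩, by rw [hsdef]; linarith⟩
    · filter_upwards [hG₁, hG₂, hψ₁K, hψ₂K, hgrad, hψ₀g, hae] with x q1 q2 q3 q4 q5 q6 q7 hxU
      by_cases hx1 : x ∈ V₁
      · rw [q1 hx1]
        exact (q3 hx1).trans (le_max_of_le_left (le_max_left _ _))
      by_cases hx2 : x ∈ V₂
      · rw [q2 hx2]
        exact (q4 hx2).trans (le_max_of_le_left (le_max_right _ _))
      refine le_max_of_le_right ?_
      rw [q5, hψ₁.gradient_eq_zero hx1, hψ₂.gradient_eq_zero hx2, add_zero, add_zero]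
      rcases q6 with q6 | q6
      · refine le_max_of_le_left ?_
        rw [q6]
        rcases q7 with q7 | q7
        · rw [hζ₁ x q7, e1]
          exact le_max_left _ _
        · rw [hζ₂ x q7, e2]
          exact le_max_right _ _
      · refine le_max_of_le_right ((norm_add_le _ _).trans ?_)
        gcongr
  · have hi : ∀ V ⊆ U, IntegrableOn (fun x => φ (ξ + gradient ψ x)) V := fun V hV =>
      integrableOn_comp_of_bdd hφ h0 hC hmeas (hfin V hV)
    have h12 : V₁ ∪ V₂ ⊆ U := union_subset hV₁U hV₂U
    rw [← integral_inter_add_sdiff (hV₁.union hV₂).measurableSet (hi U subset_rfl),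
      inter_eq_self_of_subset_right h12,
      setIntegral_union hVd hV₂.measurableSet (hi _ hV₁U) (hi _ hV₂U)]
    have j1 : ∫ x in V₁, φ (ξ + gradient ψ x) = ∫ x in V₁, φ (ξ₁ + gradient ψ₁ x) :=
      setIntegral_congr_ae hV₁.measurableSet (by
        filter_upwards [hG₁] with x hx hxV
        rw [hx hxV])
    have j2 : ∫ x in V₂, φ (ξ + gradient ψ x) = ∫ x in V₂, φ (ξ₂ + gradient ψ₂ x) :=
      setIntegral_congr_ae hV₂.measurableSet (by
        filter_upwards [hG₂] with x hx hxV
        rw [hx hxV])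
    have j3 := setIntegral_comp_le_of_bdd hφ h0 hC hmeas (hfin (U \ (V₁ ∪ V₂)) sdiff_subset)
    set τ := volume.real (U \ (V₁ ∪ V₂)) with hτdef
    have hτ : τ ≤ ε / 2 / A := by
      refine le_trans ?_ hδτ.le
      rw [hτdef, Measure.real, Measure.real]
      refine ENNReal.toReal_mono (hfin _ inter_subset_left) (measure_mono_ae ?_)
      filter_upwards [hae] with x hx hxU
      refine ⟨hxU.1, ?_⟩
      by_contra hcon
      have hxI : 2 * δ < Metric.infDist x Uᶜ := not_le.1 hcon
      rcases hx with hx | hx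
      · exact hxU.2 (Or.inl ⟨hxI, hx⟩)
      · exact hxU.2 (Or.inr ⟨hxI, hx⟩)
    have hτ0 : 0 ≤ τ := measureReal_nonneg
    have hsum : volume.real V₁ + volume.real V₂ ≤ volume.real U := by
      rw [← measureReal_union hVd hV₂.measurableSet (hfin _ hV₁U) (hfin _ hV₂U)]
      exact measureReal_mono h12 (hfin _ subset_rfl)
    have hv := abs_le.1 hvol
    have hv1 : volume.real V₁ ≤ a * volume.real U + L / ‖d‖ * τ := by
      have : volume.real V₁ = a * (volume.real V₁ + volume.real V₂) +
          (b * volume.real V₁ - a * volume.real V₂) := by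
        have : b = 1 - a := by linarith
        rw [this]; ring
      rw [this]
      have := mul_le_mul_of_nonneg_left hsum ha.le
      linarith [hv.2]
    have hv2 : volume.real V₂ ≤ b * volume.real U + L / ‖d‖ * τ := by
      have : volume.real V₂ = b * (volume.real V₁ + volume.real V₂) -
          (b * volume.real V₁ - a * volume.real V₂) := by
        have : b = 1 - a := by linarith
        rw [this]; ring
      rw [this]
      have := mul_le_mul_of_nonneg_left hsum hb.le
      linarith [hv.1]
    have hfinal : A * τ ≤ ε / 2 := by
      have := mul_le_mul_of_nonneg_left hτ hA.le
      rwa [mul_div_cancel₀ _ hA.ne'] at this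
    have k1 := mul_le_mul_of_nonneg_left hv1 hc₁
    have k2 := mul_le_mul_of_nonneg_left hv2 hc₂
    have hAτ : A * τ = (c₁ + c₂) * (L / ‖d‖ * τ) + C * τ + τ := by rw [hAdef]; ring
    rw [j1, j2]
    nlinarith

/-- Existence of a subgradient of a convex function at a point of an open set. -/
theorem ConvexOn.exists_subgradient {s : Set (RN N)} (hs : IsOpen s) {q : RN N → ℝ}
    (hq : ConvexOn ℝ s q) {ξ : RN N} (hξ : ξ ∈ s) :
    ∃ p : RN N, ∀ η ∈ s, q ξ + inner ℝ p (η - ξ) ≤ q η := by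
  have hconv : Convex ℝ {z : RN N × ℝ | z.1 ∈ s ∧ q z.1 < z.2} := hq.convex_strict_epigraph
  have hcont := hq.continuousOn hs
  have hopen : IsOpen {z : RN N × ℝ | z.1 ∈ s ∧ q z.1 < z.2} := by
    have h1 : ContinuousOn (fun z : RN N × ℝ => q z.1 - z.2) (Prod.fst ⁻¹' s) :=
      (hcont.comp continuousOn_fst fun z hz => hz).sub continuousOn_snd
    have h2 := h1.isOpen_inter_preimage (hs.preimage continuous_fst) (isOpen_Iio (a := (0 : ℝ)))
    convert! h2 using 1
    ext z
    simp
  obtain ⟨F, hF⟩ := geometric_hahn_banach_open_point (x := (ξ, q ξ)) hconv hopen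
    (fun h => lt_irrefl _ h.2)
  have hsplit : ∀ (η : RN N) (t : ℝ), F (η, t) = F (η, 0) + t * F (0, 1) := by
    intro η t
    have : (η, t) = (η, (0 : ℝ)) + t • ((0 : RN N), (1 : ℝ)) := by simp
    rw [this, map_add, map_smul, smul_eq_mul]
  set m := F ((0 : RN N), (1 : ℝ)) with hm
  -- The separating hyperplane is not vertical: raising a point above `(ξ, q ξ)` keeps it in the
  -- strict epigraph and strictly lowers `F`. Dividing by `-m` then gives the slope.
  have hm0 : m < 0 := by
    have := hF (ξ, q ξ + 1) ⟨hξ, by simp⟩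
    rw [hsplit ξ (q ξ + 1), hsplit ξ (q ξ)] at this
    linarith
  let F₁ : RN N →L[ℝ] ℝ := F.comp (ContinuousLinearMap.inl ℝ (RN N) ℝ)
  have hF₁ : ∀ η, F₁ η = F (η, 0) := fun η => by simp [F₁]
  refine ⟨(-m)⁻¹ • (InnerProductSpace.toDual ℝ (RN N)).symm F₁, fun η hη => ?_⟩
  rw [real_inner_smul_left, InnerProductSpace.toDual_symm_apply, map_sub, hF₁, hF₁]
  refine le_of_forall_gt_imp_ge_of_dense fun t ht => ?_
  have h1 := hF (η, t) ⟨hη, ht⟩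
  rw [hsplit η t, hsplit ξ (q ξ)] at h1
  have h2 : (-m)⁻¹ * (F (η, 0) - F (ξ, 0)) ≤ t - q ξ := by
    rw [inv_mul_le_iff₀ (by linarith)]
    linarith
  linarith

theorem bddAbove_polar {K C : ℝ} {φ : RN N → ℝ} (h0 : ∀ ξ ∈ Metric.ball (0 : RN N) K, C ≤ φ ξ)
    (p : RN N) :
    BddAbove ((fun η => inner ℝ p η - φ η) '' Metric.ball (0 : RN N) K) := by
  refine ⟨‖p‖ * K - C, ?_⟩
  rintro _ ⟨η, hη, rfl⟩
  have h1 := (abs_le.1 (abs_real_inner_le_norm p η)).2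
  have h2 : ‖η‖ ≤ K := by simpa using (mem_ball_zero_iff.1 hη).le
  have h3 := mul_le_mul_of_nonneg_left h2 (norm_nonneg p)
  have h4 := h0 η hη
  linarith

theorem inner_sub_polar_le {K C : ℝ} {φ : RN N → ℝ}
    (h0 : ∀ ξ ∈ Metric.ball (0 : RN N) K, C ≤ φ ξ)
    (p : RN N) {η : RN N} (hη : η ∈ Metric.ball (0 : RN N) K) :
    inner ℝ p η - polar (Metric.ball 0 K) φ p ≤ φ η := by
  have := le_csSup (bddAbove_polar h0 p) (mem_image_of_mem _ hη)
  rw [polar]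
  linarith

theorem bddAbove_bipolar {K C : ℝ} {φ : RN N → ℝ}
    (h0 : ∀ ξ ∈ Metric.ball (0 : RN N) K, C ≤ φ ξ)
    {ξ : RN N} (hξ : ξ ∈ Metric.ball (0 : RN N) K) :
    BddAbove (range fun p : RN N => inner ℝ p ξ - polar (Metric.ball 0 K) φ p) := by
  refine ⟨φ ξ, ?_⟩
  rintro _ ⟨p, rfl⟩
  exact inner_sub_polar_le h0 p hξ

/-- The infimal cost `q` is convex by `Laminable.combo` and at most `φ` because the zero
perturbation is allowed. A subgradient `p` of `q` at `ξ` gives an affine minorant of `φ` with value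
`q ξ` at `ξ`, so `q ξ` is at most the bipolar. The `ε` pays for the infimum not being attained. -/
theorem laminable_bipolar (hN : 0 < N) {K : ℝ} {φ : RN N → ℝ} (hφ : Measurable φ) {C : ℝ}
    (h0 : ∀ ξ, 0 ≤ φ ξ) (hC : ∀ ξ, φ ξ ≤ C) {ξ : RN N} (hξ : ‖ξ‖ < K) {ε : ℝ} (hε : 0 < ε) :
    Laminable K φ ξ (bipolar (Metric.ball 0 K) φ ξ + ε) := by
  have hK : 0 < K := (norm_nonneg ξ).trans_lt hξ
  -- Only nonnegative costs are kept, so that the infimum is taken over a set bounded below.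
  set S : RN N → Set ℝ := fun η => {c | 0 ≤ c ∧ Laminable K φ η c} with hS
  have hSb : ∀ η, BddBelow (S η) := fun η => ⟨0, fun c hc => hc.1⟩
  have hmem : ∀ η, ‖η‖ < K → φ η ∈ S η := fun η hη => ⟨h0 η, laminable_self φ hη⟩
  set q : RN N → ℝ := fun η => sInf (S η) with hq
  have hqlt : ∀ η, ‖η‖ < K → ∀ t, 0 < t → ∃ c ∈ S η, c < q η + t := fun η hη t ht =>
    exists_lt_of_csInf_lt ⟨_, hmem η hη⟩ (by simp only [hq]; linarith)
  have hconv : ConvexOn ℝ (Metric.ball (0 : RN N) K) q := by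
    rw [convexOn_iff_forall_pos]
    refine ⟨convex_ball _ _, fun η₁ h₁ η₂ h₂ a b ha hb hab => ?_⟩
    rw [mem_ball_zero_iff] at h₁ h₂
    refine le_of_forall_pos_le_add fun t ht => ?_
    obtain ⟨c₁, hc₁, hc₁'⟩ := hqlt η₁ h₁ t ht
    obtain ⟨c₂, hc₂, hc₂'⟩ := hqlt η₂ h₂ t ht
    have h3 : q (a • η₁ + b • η₂) ≤ a * c₁ + b * c₂ :=
      csInf_le (hSb _) ⟨add_nonneg (mul_nonneg ha.le hc₁.1) (mul_nonneg hb.le hc₂.1),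
        Laminable.combo hN hφ h0 hC h₁ h₂ hc₁.1 hc₂.1 hc₁.2 hc₂.2 ha hb hab⟩
    simp only [smul_eq_mul]
    have h4 := mul_le_mul_of_nonneg_left hc₁'.le ha.le
    have h5 := mul_le_mul_of_nonneg_left hc₂'.le hb.le
    have h6 : (a + b) * t = t := by rw [hab, one_mul]
    linarith
  have hξ' : ξ ∈ Metric.ball (0 : RN N) K := by simpa using hξ
  obtain ⟨p, hp⟩ := hconv.exists_subgradient Metric.isOpen_ball hξ'
  have hpol : polar (Metric.ball 0 K) φ p ≤ inner ℝ p ξ - q ξ := by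
    refine csSup_le ⟨_, mem_image_of_mem _ hξ'⟩ ?_
    rintro _ ⟨η, hη, rfl⟩
    have h1 := hp η hη
    have h2 : q η ≤ φ η := csInf_le (hSb _) (hmem η (by simpa using hη))
    rw [inner_sub_right] at h1
    simp only
    linarith
  have hle : q ξ ≤ bipolar (Metric.ball 0 K) φ ξ := by
    refine le_trans ?_ (le_ciSup (bddAbove_bipolar (C := 0) (fun η _ => h0 η) hξ') p)
    linarith
  obtain ⟨c, hc, hc'⟩ := hqlt ξ hξ ε hε
  exact hc.2.mono (by linarith)

end Laminates

/-! ### Affine replacement and lamination on a small ball. -/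

section BallPerturbation

variable {N : ℕ}

theorem volume_real_ball_mul (x : RN N) {t : ℝ} (ht : 0 < t) (r : ℝ) :
    volume.real (Metric.ball x (t * r)) = t ^ N * volume.real (Metric.ball x r) := by
  rw [Measure.real, Measure.real, Measure.addHaar_ball_mul_of_pos _ _ ht, ENNReal.toReal_mul,
    ENNReal.toReal_ofReal (by positivity), finrank_euclideanSpace_fin,
    ← Measure.addHaar_ball_center volume x]

/-- Near a point of differentiability, a Lipschitz function can be made affine on most of a small
ball, and then be laminated there. -/
theorem exists_ball_perturbation (hN : 0 < N) {K : ℝ} {φ : RN N → ℝ} (hφ : Measurable φ) {C : ℝ}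
    (h0 : ∀ ξ, 0 ≤ φ ξ) (hC : ∀ ξ, φ ξ ≤ C) {w : RN N → ℝ} {M : ℝ≥0} (hw : LipschitzWith M w)
    (hM : (M : ℝ) < K) {x₀ : RN N} (hx₀ : DifferentiableAt ℝ w x₀) {c : ℝ} (hc : 0 ≤ c)
    (hP : Laminable K φ (gradient w x₀) c) {ε : ℝ} (hε : 0 < ε) :
    ∀ᶠ r in 𝓝[>] (0 : ℝ), ∃ ψ : RN N → ℝ, IsLipTest (Metric.ball x₀ r) ψ ∧ (∀ x, |ψ x| ≤ ε) ∧
      (∃ K' < K, ∀ᵐ x, x ∈ Metric.ball x₀ r → ‖gradient w x + gradient ψ x‖ ≤ K') ∧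
      ∫ x in Metric.ball x₀ r, φ (gradient w x + gradient ψ x) ≤
        (c + ε) * volume.real (Metric.ball x₀ r) := by
  set ξ := gradient w x₀ with hξdef
  have hξM : ‖ξ‖ ≤ M := hw.norm_gradient_le x₀
  have hC0 : 0 ≤ C := (h0 0).trans (hC 0)
  set s := (K - M) / 2 with hsdef
  have hs : 0 < s := by rw [hsdef]; linarith
  -- The relative thickness `2 * θ` of the shell lost to truncation is chosen so small that even the
  -- maximal integrand `C` contributes less than `ε / 4` per unit volume of the ball.
  obtain ⟨θ, ⟨hθ0, hθ2⟩, hθC⟩ : ∃ θ ∈ Ioo (0 : ℝ) (1 / 2), C * (1 - (1 - 2 * θ) ^ N) < ε / 4 := by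
    have h1 : ContinuousAt (fun θ : ℝ => C * (1 - (1 - 2 * θ) ^ N)) 0 := by fun_prop
    have h2 : ∀ᶠ θ in 𝓝 (0 : ℝ), C * (1 - (1 - 2 * θ) ^ N) < ε / 4 := by
      refine h1.eventually_lt_const ?_
      simpa using hε
    have h3 : ∀ᶠ θ in 𝓝[>] (0 : ℝ), θ ∈ Ioo (0 : ℝ) (1 / 2) :=
      Ioo_mem_nhdsGT (by norm_num)
    exact (h3.and (h2.filter_mono nhdsWithin_le_nhds)).exists
  set e : RN N → ℝ := fun x => (w x₀ - inner ℝ ξ x₀ + inner ℝ ξ x) - w x with hedef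
  have haff : LipschitzWith ‖ξ‖₊ fun x => w x₀ - inner ℝ ξ x₀ + inner ℝ ξ x := by
    refine LipschitzWith.of_le_add_mul _ fun x y => ?_
    have h1 := (abs_le.1 (abs_real_inner_le_norm ξ (x - y))).2
    rw [inner_sub_right, ← dist_eq_norm] at h1
    rw [coe_nnnorm]
    linarith
  have hel : LipschitzWith (‖ξ‖₊ + M) e := haff.sub hw
  have hgaff : ∀ x, HasGradientAt (fun x => w x₀ - inner ℝ ξ x₀ + inner ℝ ξ x) ξ x :=
    hasGradientAt_affine _ _
  have hge : ∀ᵐ x, gradient e x = ξ - gradient w x := by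
    filter_upwards [hw.ae_differentiableAt] with x hx
    rw [hedef, gradient_sub' (hgaff x).differentiableAt hx, (hgaff x).gradient]
  -- Differentiability at `x₀` makes the affine error `o(‖x - x₀‖)`, hence at most `s * (θ * r)` on
  -- the ball of radius `r`: the smallness needed to truncate at depth `θ * r` with slope `s`.
  have hsmall : ∀ᶠ x in 𝓝 x₀, |e x| ≤ s * θ * ‖x - x₀‖ := by
    have h1 := hx₀.hasFDerivAt.isLittleO.def (show 0 < s * θ by positivity)
    filter_upwards [h1] with x hx
    rw [← inner_gradient_left, inner_sub_right, Real.norm_eq_abs, abs_sub_comm] at hx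
    convert hx using 2
    simp only [hedef, hξdef]
    ring
  obtain ⟨ρ, hρ, hρe⟩ := Metric.eventually_nhds_iff.1 hsmall
  have hev : ∀ᶠ r in 𝓝[>] (0 : ℝ), r ∈ Ioo 0 (min ρ (ε / 2 / (s * θ))) :=
    Ioo_mem_nhdsGT (lt_min hρ (by positivity))
  filter_upwards [hev] with r hr
  have hr0 : 0 < r := hr.1
  have hrρ : r < ρ := hr.2.trans_le (min_le_left _ _)
  have hrε : s * (θ * r) ≤ ε / 2 := by
    have h1 := hr.2.trans_le (min_le_right _ _)
    rw [lt_div_iff₀ (by positivity)] at h1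
    linarith
  set B := Metric.ball x₀ r with hB
  have hBb : Bornology.IsBounded B := Metric.isBounded_ball
  have hBpos : 0 < volume.real B :=
    ENNReal.toReal_pos (Metric.measure_ball_pos _ _ hr0).ne' measure_ball_lt_top.ne
  obtain ⟨ψ₀, hψ₀, hψ₀κ, hψ₀eq, hψ₀g⟩ := exists_lattice_truncation (U := B) hBb hel hs.le
    (show 0 < θ * r by positivity) (κ := s * (θ * r)) (by positivity) (fun x hx => by
      have hx' : dist x x₀ < r := hx
      refine (hρe (hx'.trans hrρ)).trans ?_
      rw [← dist_eq_norm, mul_assoc]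
      gcongr) le_rfl
  set B' := Metric.ball x₀ ((1 - 2 * θ) * r) with hB'
  have ht : 0 < 1 - 2 * θ := by linarith
  have hB'B : B' ⊆ B := Metric.ball_subset_ball (by nlinarith)
  have hvol : volume.real B' = (1 - 2 * θ) ^ N * volume.real B := volume_real_ball_mul x₀ ht r
  have hψ₀e : ∀ x ∈ B', ψ₀ x = e x := by
    intro x hx
    refine hψ₀eq x ((Metric.le_infDist (nonempty_compl_of_isBounded hN hBb)).2 fun y hy => ?_)
    have hx' : dist x x₀ < (1 - 2 * θ) * r := hx
    have hy' : r ≤ dist y x₀ := not_lt.1 hy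
    have := dist_triangle_left y x₀ x
    linarith
  have hψ₀ge : ∀ x ∈ B', gradient ψ₀ x = gradient e x := by
    intro x hx
    refine Filter.EventuallyEq.gradient_eq ?_
    filter_upwards [Metric.isOpen_ball.mem_nhds hx] with y hy using hψ₀e y hy
  -- The error in `Laminable` is absolute, whereas the conclusion needs one proportional to the
  -- volume of the ball.
  obtain ⟨ψ₁, hψ₁, hψ₁ε, ⟨K₁, hK₁, hψ₁K⟩, hψ₁i⟩ := hP B' Metric.isOpen_ball
    Metric.isBounded_ball (min (ε / 2) (ε / 2 * volume.real B)) (by positivity)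
  set ψ : RN N → ℝ := fun x => ψ₀ x + ψ₁ x with hψdef
  have hgrad : ∀ᵐ x, gradient ψ x = gradient ψ₀ x + gradient ψ₁ x := by
    filter_upwards [hψ₀.ae_differentiableAt, hψ₁.ae_differentiableAt] with x q0 q1
    rw [hψdef, gradient_add' q0 q1]
  have hG : ∀ᵐ x, x ∈ B' → gradient w x + gradient ψ x = ξ + gradient ψ₁ x := by
    filter_upwards [hgrad, hge] with x hx hx' hxB
    rw [hx, hψ₀ge x hxB, hx']
    abel
  have hmeas : Measurable fun x => gradient w x + gradient ψ x :=
    (measurable_gradient w).add (measurable_gradient ψ)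
  have hfin : ∀ V ⊆ B, volume V ≠ ⊤ := fun V hV =>
    ((measure_mono hV).trans_lt hBb.measure_lt_top).ne
  refine ⟨ψ, hψ₀.add (hψ₁.mono hB'B), fun x => ?_, ?_, ?_⟩
  · have h1 := hψ₀κ x
    have h2 := (hψ₁ε x).trans (min_le_left _ _)
    have h3 := abs_add_le (ψ₀ x) (ψ₁ x)
    simp only [hψdef]
    linarith
  · refine ⟨max K₁ (M + s), max_lt hK₁ (by rw [hsdef]; linarith), ?_⟩
    filter_upwards [hG, hgrad, hge, hψ₀g, hψ₁K] with x q1 q2 q3 q4 q5 hxB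
    by_cases hx : x ∈ B'
    · rw [q1 hx]
      exact (q5 hx).trans (le_max_left _ _)
    · refine le_max_of_le_right ?_
      rw [q2, hψ₁.gradient_eq_zero hx, add_zero]
      rcases q4 with q4 | q4
      · rw [q4, q3, add_sub_cancel]
        linarith
      · exact (norm_add_le _ _).trans (add_le_add (hw.norm_gradient_le x) q4)
  · have hi : IntegrableOn (fun x => φ (gradient w x + gradient ψ x)) B :=
      integrableOn_comp_of_bdd hφ h0 hC hmeas (hfin B subset_rfl)
    rw [← integral_inter_add_sdiff Metric.isOpen_ball.measurableSet hi (s := B) (t := B'),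
      inter_eq_self_of_subset_right hB'B]
    have j1 : ∫ x in B', φ (gradient w x + gradient ψ x) = ∫ x in B', φ (ξ + gradient ψ₁ x) :=
      setIntegral_congr_ae Metric.isOpen_ball.measurableSet (by
        filter_upwards [hG] with x hx hxV
        rw [hx hxV])
    have j2 := setIntegral_comp_le_of_bdd hφ h0 hC hmeas (hfin (B \ B') sdiff_subset)
    have j3 : volume.real (B \ B') = volume.real B - volume.real B' :=
      measureReal_sdiff hB'B Metric.isOpen_ball.measurableSet (hfin B subset_rfl)
    have j4 : volume.real B' ≤ volume.real B := measureReal_mono hB'B (hfin B subset_rfl)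
    have j5 := min_le_right (ε / 2) (ε / 2 * volume.real B)
    have j6 : C * volume.real (B \ B') ≤ ε / 4 * volume.real B := by
      rw [j3, hvol]
      have := mul_le_mul_of_nonneg_right hθC.le hBpos.le
      linarith
    rw [j1]
    nlinarith [mul_le_mul_of_nonneg_left j4 hc]

end BallPerturbation

/-! ### Local Lipschitz representatives of elements of `W^{1,∞}`. -/

section Sobolev

variable {N : ℕ}

open scoped Convolution
open ContinuousLinearMap (lsmul)

theorem IsTestFunction.exists_lipschitzWith {Ω : Set (RN N)} {φ : RN N → ℝ}
    (hφ : IsTestFunction Ω φ) : ∃ C, LipschitzWith C φ :=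
  ContDiff.lipschitzWith_of_hasCompactSupport (𝕂 := ℝ) hφ.2.1 hφ.1 (by simp)

/-- Integration by parts for a Lipschitz function and a test function. -/
theorem LipschitzWith.integral_mul_inner_gradient {w : RN N → ℝ} {C : ℝ≥0} (hw : LipschitzWith C w)
    {Ω : Set (RN N)} {φ : RN N → ℝ} (hφ : IsTestFunction Ω φ) (e : RN N) :
    ∫ x, w x * inner ℝ (gradient φ x) e = -∫ x, inner ℝ (gradient w x) e * φ x := by
  obtain ⟨D, hD⟩ := hφ.exists_lipschitzWith
  have h := hw.integral_lineDeriv_mul_eq (μ := volume) hD hφ.2.1 e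
  have h1 : ∫ x, inner ℝ (gradient w x) e * φ x = ∫ x, lineDeriv ℝ w x e * φ x := by
    refine integral_congr_ae ?_
    filter_upwards [hw.ae_differentiableAt] with x hx
    rw [hx.lineDeriv_eq_fderiv, inner_gradient_left]
  rw [h1, h, ← integral_neg]
  refine integral_congr_ae (Eventually.of_forall fun x => ?_)
  have hx : DifferentiableAt ℝ φ x := (hφ.1.differentiable (by simp)) x
  simp only
  rw [hx.lineDeriv_eq_fderiv, inner_gradient_left, map_neg]
  ring

theorem IsTestFunction.gradient_eq_zero {Ω : Set (RN N)} {φ : RN N → ℝ}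
    (hφ : IsTestFunction Ω φ) {x : RN N} (hx : x ∉ Ω) : gradient φ x = 0 := by
  obtain ⟨C, hC⟩ := hφ.exists_lipschitzWith
  exact IsLipTest.gradient_eq_zero ⟨⟨C, hC⟩, hφ.2.1, hφ.2.2⟩ hx

theorem IsTestFunction.eq_zero {Ω : Set (RN N)} {φ : RN N → ℝ}
    (hφ : IsTestFunction Ω φ) {x : RN N} (hx : x ∉ Ω) : φ x = 0 := by
  obtain ⟨C, hC⟩ := hφ.exists_lipschitzWith
  exact IsLipTest.eq_zero ⟨⟨C, hC⟩, hφ.2.1, hφ.2.2⟩ hx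

/-- The reflected and translated kernel `z ↦ ρ (x - z)` as a test function. -/
theorem isTestFunction_sub_left {Ω : Set (RN N)} {ρ : RN N → ℝ} (hρ : ContDiff ℝ ∞ ρ)
    (hc : HasCompactSupport ρ) {x : RN N} (h : ∀ z, x - z ∈ tsupport ρ → z ∈ Ω) :
    IsTestFunction Ω fun z => ρ (x - z) := by
  have hts : tsupport (fun z => ρ (x - z)) ⊆ (fun z => x - z) ⁻¹' tsupport ρ :=
    tsupport_comp_subset_preimage ρ (f := fun z => x - z) (by fun_prop)
  refine ⟨hρ.comp (by fun_prop), ?_, fun z hz => h z (hts hz)⟩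
  exact hc.comp_homeomorph (Homeomorph.subLeft x)

theorem gradient_sub_left {ρ : RN N → ℝ} (hρ : ContDiff ℝ ∞ ρ) (x z e : RN N) :
    inner ℝ (gradient (fun z => ρ (x - z)) z) e = -fderiv ℝ ρ (x - z) e := by
  rw [inner_gradient_left]
  have h1 : HasFDerivAt ρ (fderiv ℝ ρ (x - z)) (x - z) :=
    ((hρ.differentiable (by simp)) _).hasFDerivAt
  have h2 : HasFDerivAt (fun z : RN N => x - z) (-ContinuousLinearMap.id ℝ (RN N)) z :=
    (hasFDerivAt_id z).const_sub x
  have h3 : HasFDerivAt (fun z => ρ (x - z)) _ z := h1.comp z h2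
  rw [h3.fderiv]
  simp

/-- All derivatives fall on the kernel, and the sign comes from its reflection. The integral has the
form occurring in `HasWeakGradient`, with the translated reflected kernel as test function. -/
theorem hasFDerivAt_mollification {ρ : RN N → ℝ} (hρ : ContDiff ℝ ∞ ρ)
    (hc : HasCompactSupport ρ) {U : RN N → ℝ} (hU : LocallyIntegrable U volume) (x : RN N) :
    DifferentiableAt ℝ (ρ ⋆[lsmul ℝ ℝ, volume] U) x ∧
      ∀ e, fderiv ℝ (ρ ⋆[lsmul ℝ ℝ, volume] U) x e =
        -∫ z, U z * inner ℝ (gradient (fun z => ρ (x - z)) z) e := by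
  have h := hc.hasFDerivAt_convolution_left (μ := volume) (lsmul ℝ ℝ) (hρ.of_le (by simp)) hU x
  refine ⟨h.differentiableAt, fun e => ?_⟩
  have hex := (hc.fderiv (𝕜 := ℝ)).convolutionExists_left ((lsmul ℝ ℝ).precompL (RN N))
    (hρ.continuous_fderiv (by simp)) hU x
  rw [h.fderiv, convolution_eq_swap, ContinuousLinearMap.integral_apply hex.integrable_swap,
    ← integral_neg]
  refine integral_congr_ae (Eventually.of_forall fun z => ?_)
  simp only
  rw [gradient_sub_left hρ, ContinuousLinearMap.precompL_apply]
  simp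
  ring

/-- If the distributional derivative of `U` at scale `ρ` is given by `H` then the mollification has
derivative bounded by the bound of `H`. -/
theorem norm_fderiv_mollification_le {ρ : RN N → ℝ} (hρ : ContDiff ℝ ∞ ρ)
    (hc : HasCompactSupport ρ) (hρ0 : ∀ z, 0 ≤ ρ z) (hρ1 : ∫ z, ρ z = 1) {U : RN N → ℝ}
    (hU : LocallyIntegrable U volume) {H : RN N → RN N} {M : ℝ} (hM : 0 ≤ M)
    (hH : ∀ᵐ x, ‖H x‖ ≤ M) {x : RN N}
    (hx : ∀ e, ∫ z, U z * inner ℝ (gradient (fun z => ρ (x - z)) z) e =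
      -∫ z, inner ℝ (H z) e * ρ (x - z)) :
    ‖fderiv ℝ (ρ ⋆[lsmul ℝ ℝ, volume] U) x‖ ≤ M := by
  refine ContinuousLinearMap.opNorm_le_bound _ hM fun e => ?_
  rw [(hasFDerivAt_mollification hρ hc hU x).2 e, hx e, neg_neg]
  have hint : Integrable (fun z => M * ‖e‖ * ρ (x - z)) volume := by
    have : Integrable ρ volume := hρ.continuous.integrable_of_hasCompactSupport hc
    exact (this.comp_sub_left x).const_mul _
  refine (norm_integral_le_of_norm_le hint ?_).trans_eq ?_
  · filter_upwards [hH] with z hz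
    rw [norm_mul, Real.norm_of_nonneg (hρ0 _)]
    have := hρ0 (x - z)
    gcongr
    exact (norm_inner_le_norm _ _).trans (by gcongr)
  · rw [integral_const_mul, integral_sub_left_eq_self ρ volume x, hρ1, mul_one]

/-- Vectors are equal if their inner products with the standard basis are. -/
theorem eq_of_inner_single {v w : RN N}
    (h : ∀ i : Fin N, inner ℝ v (EuclideanSpace.single i (1 : ℝ)) =
      inner ℝ w (EuclideanSpace.single i (1 : ℝ))) : v = w := by
  ext i
  simpa [EuclideanSpace.inner_single_right] using h i

/-- Both gradients satisfy the same integration by parts identity against test functions of `B`. The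
fundamental lemma of the calculus of variations then applies to each coordinate of their difference.
-/
theorem gradient_ae_eq_of_hasWeakGradient {B : Set (RN N)} (hB : IsOpen B) {w : RN N → ℝ} {C : ℝ≥0}
    (hw : LipschitzWith C w) {u : RN N → ℝ} {G : RN N → RN N} (hG : IntegrableOn G B)
    (hu : ∀ᵐ x, x ∈ B → w x = u x) (h : HasWeakGradient B u G) :
    ∀ᵐ x, x ∈ B → gradient w x = G x := by
  have hmain : ∀ e : RN N, ∀ᵐ x, x ∈ B → inner ℝ (gradient w x - G x) e = (0 : ℝ) := by
    intro e
    have hgi : LocallyIntegrable (gradient w) volume := by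
      refine (locallyIntegrable_const (C : ℝ)).mono
        (measurable_gradient w).aestronglyMeasurable (Eventually.of_forall fun x => ?_)
      simpa using hw.norm_gradient_le x
    have hli : LocallyIntegrableOn (fun x => inner ℝ (gradient w x - G x) e) B := by
      have h1 : LocallyIntegrableOn (fun x => gradient w x - G x) B :=
        (hgi.locallyIntegrableOn B).sub hG.locallyIntegrableOn
      intro x hx
      obtain ⟨s, hs, hi⟩ := h1 x hx
      exact ⟨s, hs, hi.inner_const e⟩
    refine hB.ae_eq_zero_of_integral_contDiff_smul_eq_zero hli fun φ h1 h2 h3 => ?_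
    have hφ : IsTestFunction B φ := ⟨h1, h2, h3⟩
    have i1 := hw.integral_mul_inner_gradient hφ e
    have i2 := h φ hφ e
    have i3 : ∫ x in B, u x * inner ℝ (gradient φ x) e = ∫ x, w x * inner ℝ (gradient φ x) e := by
      rw [← setIntegral_eq_integral_of_forall_compl_eq_zero (s := B)
        (f := fun x => w x * inner ℝ (gradient φ x) e) fun x hx => by
          rw [hφ.gradient_eq_zero hx, inner_zero_left, mul_zero]]
      refine setIntegral_congr_ae hB.measurableSet ?_
      filter_upwards [hu] with x hx hxB
      rw [hx hxB]
    have i4 : ∫ x in B, inner ℝ (gradient w x) e * φ x = ∫ x, inner ℝ (gradient w x) e * φ x :=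
      setIntegral_eq_integral_of_forall_compl_eq_zero fun x hx => by
        rw [hφ.eq_zero hx, mul_zero]
    rw [← setIntegral_eq_integral_of_forall_compl_eq_zero (s := B) fun x hx => by
      rw [hφ.eq_zero hx, zero_smul]]
    obtain ⟨D, hD⟩ := hφ.2.1.exists_bound_of_continuous hφ.1.continuous
    have hb : ∀ F : RN N → RN N, IntegrableOn F B →
        IntegrableOn (fun x => inner ℝ (F x) e * φ x) B := fun F hF =>
      (hF.inner_const e).mul_bdd (c := D) hφ.1.continuous.aestronglyMeasurable
        (Eventually.of_forall hD)
    have j1 : IntegrableOn (fun x => inner ℝ (gradient w x) e * φ x) B := by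
      have : Integrable (fun x => φ x • gradient w x) volume :=
        hgi.integrable_smul_left_of_hasCompactSupport hφ.1.continuous hφ.2.1
      refine ((this.inner_const e).congr (Eventually.of_forall fun x => ?_)).integrableOn
      simp only
      rw [real_inner_smul_left, mul_comm]
    have : ∀ x, φ x • inner ℝ (gradient w x - G x) e =
        inner ℝ (gradient w x) e * φ x - inner ℝ (G x) e * φ x := fun x => by
      rw [inner_sub_left, smul_eq_mul]; ring
    simp only [this]
    rw [integral_sub j1 (hb G hG), i4]
    linarith
  have := ae_all_iff.2 fun i : Fin N => hmain (EuclideanSpace.single i 1)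
  filter_upwards [this] with x hx hxB
  refine eq_of_inner_single fun i => ?_
  have := hx i hxB
  rwa [inner_sub_left, sub_eq_zero] at this

theorem HasWeakGradient.mono {Ω B : Set (RN N)} (hΩ : MeasurableSet Ω) (hBΩ : B ⊆ Ω) {u : RN N → ℝ} {G : RN N → RN N} (h : HasWeakGradient Ω u G) :
    HasWeakGradient B u G := by
  intro φ hφ e
  have h1 := h φ ⟨hφ.1, hφ.2.1, hφ.2.2.trans hBΩ⟩ e
  rwa [setIntegral_eq_of_subset_of_forall_sdiff_eq_zero hΩ hBΩ fun x hx => by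
      rw [hφ.gradient_eq_zero hx.2, inner_zero_left, mul_zero],
    setIntegral_eq_of_subset_of_forall_sdiff_eq_zero hΩ hBΩ fun x hx => by
      rw [hφ.eq_zero hx.2, mul_zero]] at h1

theorem ae_norm_sobGrad_le {Ω : Set (RN N)} (u : W1Inf Ω) :
    ∀ᵐ x ∂(lebOn Ω), ‖sobGrad u x‖ ≤ ‖sobGrad u‖ := by
  have h := Lp.memLp (sobGrad u)
  filter_upwards [ae_le_eLpNormEssSup (f := sobGrad u) (μ := lebOn Ω)] with x hx
  rw [Lp.norm_def, eLpNorm_exponent_top]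
  have := ENNReal.toReal_mono (by simpa using h.2.ne) hx
  simpa using this

/-- A sequence of bumps shrinking to the origin. -/
noncomputable def mollifier {δ : ℝ} (hδ : 0 < δ) (n : ℕ) : ContDiffBump (0 : RN N) where
  rIn := δ / (n + 1) / 2
  rOut := δ / (n + 1)
  rIn_pos := by positivity
  rIn_lt_rOut := half_lt_self (by positivity)

theorem tendsto_mollifier_rOut {δ : ℝ} (hδ : 0 < δ) :
    Tendsto (fun n => (mollifier (N := N) hδ n).rOut) atTop (𝓝 0) := by
  have := (tendsto_one_div_add_atTop_nhds_zero_nat (𝕜 := ℝ)).const_mul δ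
  simpa [mollifier, div_eq_mul_inv] using this

theorem mollifier_rOut_le {δ : ℝ} (hδ : 0 < δ) (n : ℕ) : (mollifier (N := N) hδ n).rOut ≤ δ := by
  refine div_le_self hδ.le ?_
  have : (0 : ℝ) ≤ n := by positivity
  linarith

theorem ae_tendsto_mollification {δ : ℝ} (hδ : 0 < δ) {U : RN N → ℝ}
    (hU : LocallyIntegrable U volume) :
    ∀ᵐ x, Tendsto (fun n => ((mollifier hδ n).normed volume ⋆[lsmul ℝ ℝ, volume] U) x) atTop
      (𝓝 (U x)) :=
  ContDiffBump.ae_convolution_tendsto_right_of_locallyIntegrable (K := 2)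
    (tendsto_mollifier_rOut hδ)
    (Eventually.of_forall fun n => by simp only [mollifier]; linarith) hU

/-- Elements of `W^{1,∞}` are locally Lipschitz. -/
theorem exists_lipschitz_representative {Ω : Set (RN N)} (hΩ : IsOpen Ω)
    (hb : Bornology.IsBounded Ω) (u : W1Inf Ω) {x₀ : RN N} (hx₀ : x₀ ∈ Ω) :
    ∃ R : ℝ, 0 < R ∧ Metric.ball x₀ R ⊆ Ω ∧ ∃ w : RN N → ℝ, LipschitzWith ‖sobGrad u‖₊ w ∧
      ∀ᵐ x, x ∈ Metric.ball x₀ R → gradient w x = sobGrad u x := by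
  obtain ⟨r, hr, hrΩ⟩ := Metric.isOpen_iff.1 hΩ x₀ hx₀
  have : IsFiniteMeasure (lebOn Ω) := ⟨by simpa using hb.measure_lt_top⟩
  set R := r / 3 with hR
  have hR0 : 0 < R := by positivity
  set B := Metric.ball x₀ R with hBdef
  have hBΩ : B ⊆ Ω := (Metric.ball_subset_ball (by rw [hR]; linarith)).trans hrΩ
  set U : RN N → ℝ := Ω.indicator (sobVal u) with hUdef
  set H : RN N → RN N := Ω.indicator (sobGrad u) with hHdef
  have hui : IntegrableOn (sobVal u) Ω := (Lp.memLp (sobVal u)).integrable (by simp)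
  have hGi : IntegrableOn (sobGrad u) Ω := (Lp.memLp (sobGrad u)).integrable (by simp)
  have hUi : LocallyIntegrable U volume := (hui.integrable_indicator hΩ.measurableSet).locallyIntegrable
  have hHb : ∀ᵐ x, ‖H x‖ ≤ ‖sobGrad u‖ := by
    have h1 := (ae_restrict_iff' hΩ.measurableSet).1 (ae_norm_sobGrad_le u)
    filter_upwards [h1] with x hx
    by_cases hxΩ : x ∈ Ω
    · rw [hHdef, indicator_of_mem hxΩ]
      exact hx hxΩ
    · rw [hHdef, indicator_of_notMem hxΩ, norm_zero]
      exact norm_nonneg _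
  have hlip : ∀ n, LipschitzOnWith ‖sobGrad u‖₊
      ((mollifier hR0 n).normed volume ⋆[lsmul ℝ ℝ, volume] U) B := by
    intro n
    set ρ := (mollifier (N := N) hR0 n).normed volume with hρ
    have hρs : ContDiff ℝ ∞ ρ := (mollifier hR0 n).contDiff_normed
    have hρc : HasCompactSupport ρ := (mollifier hR0 n).hasCompactSupport_normed
    refine (convex_ball x₀ R).lipschitzOnWith_of_nnnorm_fderiv_le (𝕜 := ℝ)
      (fun x _ => (hasFDerivAt_mollification hρs hρc hUi x).1) fun x hx => ?_
    refine norm_fderiv_mollification_le hρs hρc (mollifier hR0 n).nonneg_normed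
      (mollifier hR0 n).integral_normed hUi (norm_nonneg _) hHb fun e => ?_
    have htest : IsTestFunction Ω fun z => ρ (x - z) := by
      refine isTestFunction_sub_left hρs hρc fun z hz => hrΩ ?_
      rw [hρ, ContDiffBump.tsupport_normed_eq, mem_closedBall_zero_iff, ← dist_eq_norm] at hz
      have h1 := mollifier_rOut_le (N := N) hR0 n
      have h2 : dist x x₀ < R := hx
      have h3 := dist_triangle_left z x₀ x
      rw [Metric.mem_ball]
      linarith
    have h1 := u.2 _ htest e
    have h2 : ∀ z, U z * inner ℝ (gradient (fun z => ρ (x - z)) z) e =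
        Ω.indicator (fun z => sobVal u z * inner ℝ (gradient (fun z => ρ (x - z)) z) e) z := by
      intro z
      by_cases hz : z ∈ Ω <;> simp [hUdef, hz]
    have h3 : ∀ z, inner ℝ (H z) e * ρ (x - z) =
        Ω.indicator (fun z => inner ℝ (sobGrad u z) e * ρ (x - z)) z := by
      intro z
      by_cases hz : z ∈ Ω <;> simp [hHdef, hz]
    simp only [h2, h3]
    rw [integral_indicator hΩ.measurableSet, integral_indicator hΩ.measurableSet]
    exact h1
  have hconv := ae_tendsto_mollification (N := N) hR0 hUi
  set A := {x | x ∈ B ∧ Tendsto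
    (fun n => ((mollifier hR0 n).normed volume ⋆[lsmul ℝ ℝ, volume] U) x) atTop (𝓝 (U x))} with hA
  -- The mollifications share the Lipschitz constant `‖∇u‖_∞` on the convex ball, and this passes to
  -- their limit on the set of convergence, which has full measure. The extension below keeps the
  -- constant exactly, which preserves the strict inequality with `K`.
  have hUA : LipschitzOnWith ‖sobGrad u‖₊ U A := by
    refine LipschitzOnWith.of_dist_le_mul fun x hx y hy => ?_
    refine le_of_tendsto (hx.2.dist hy.2) (Eventually.of_forall fun n => ?_)
    exact (hlip n).dist_le_mul x hx.1 y hy.1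
  obtain ⟨w, hw, hwU⟩ := hUA.extend_real
  refine ⟨R, hR0, hBΩ, w, hw, ?_⟩
  refine gradient_ae_eq_of_hasWeakGradient Metric.isOpen_ball hw (hGi.mono_set hBΩ) (u := sobVal u)
    ?_ (HasWeakGradient.mono hΩ.measurableSet hBΩ u.2)
  filter_upwards [hconv] with x hx hxB
  rw [← hwU ⟨hxB, hx⟩, hUdef, indicator_of_mem (hBΩ hxB)]

/-- At almost every point, an element of `W^{1,∞}` coincides near the point with a Lipschitz function
that is differentiable there. -/
theorem ae_exists_lipschitz_representative {Ω : Set (RN N)} (hΩ : IsOpen Ω)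
    (hb : Bornology.IsBounded Ω) (u : W1Inf Ω) :
    ∀ᵐ x₀ ∂(lebOn Ω), ∃ w : RN N → ℝ, LipschitzWith ‖sobGrad u‖₊ w ∧ DifferentiableAt ℝ w x₀ ∧
      gradient w x₀ = sobGrad u x₀ ∧
      ∃ R : ℝ, 0 < R ∧ ∀ᵐ x, x ∈ Metric.ball x₀ R → gradient w x = sobGrad u x := by
  choose! R hR hRΩ w hw hwg using fun x (hx : x ∈ Ω) => exists_lipschitz_representative hΩ hb u hx
  -- The representative depends on the ball. A countable subcover keeps the union of the exceptional
  -- sets null.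
  obtain ⟨t, htΩ, htc, ht⟩ := TopologicalSpace.countable_cover_nhdsWithin (s := Ω)
    (f := fun x => Metric.ball x (R x))
    fun x hx => mem_nhdsWithin_of_mem_nhds (Metric.ball_mem_nhds x (hR x hx))
  have hall : ∀ᵐ x, ∀ y ∈ t, DifferentiableAt ℝ (w y) x ∧
      (x ∈ Metric.ball y (R y) → gradient (w y) x = sobGrad u x) := by
    rw [ae_ball_iff htc]
    intro y hy
    filter_upwards [(hw y (htΩ hy)).ae_differentiableAt, hwg y (htΩ hy)] with x h1 h2
    exact ⟨h1, h2⟩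
  rw [ae_restrict_iff' hΩ.measurableSet]
  filter_upwards [hall] with x hx hxΩ
  obtain ⟨y, hy, hxy⟩ := mem_iUnion₂.1 (ht hxΩ)
  obtain ⟨ρ, hρ, hρB⟩ := Metric.isOpen_iff.1 Metric.isOpen_ball x hxy
  refine ⟨w y, hw y (htΩ hy), (hx y hy).1, (hx y hy).2 hxy, ρ, hρ, ?_⟩
  filter_upwards [hwg y (htΩ hy)] with z hz hzB
  exact hz (hρB hzB)

end Sobolev

/-! ### Membership in `W_0^{1,∞}` and weak convergence of gradients. -/

section ZeroTrace

variable {N : ℕ}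

open scoped Convolution
open ContinuousLinearMap (lsmul)

theorem tendsto_eLpNorm_one_of_bounded {α F : Type*} [MeasurableSpace α] [NormedAddCommGroup F]
    {μ : Measure α} [IsFiniteMeasure μ] {f : ℕ → α → F} (hm : ∀ n, AEStronglyMeasurable (f n) μ)
    {C : ℝ} (hC : ∀ n, ∀ᵐ x ∂μ, ‖f n x‖ ≤ C)
    (hf : ∀ᵐ x ∂μ, Tendsto (fun n => f n x) atTop (𝓝 0)) :
    Tendsto (fun n => eLpNorm (f n) 1 μ) atTop (𝓝 0) := by
  simp only [eLpNorm_one_eq_lintegral_enorm]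
  have h := tendsto_lintegral_of_dominated_convergence' (μ := μ) (F := fun n x => ‖f n x‖ₑ)
    (f := fun _ => 0) (fun _ => ENNReal.ofReal C) (fun n => (hm n).enorm) (fun n => ?_) ?_ ?_
  · simpa using h
  · filter_upwards [hC n] with x hx
    rw [← ofReal_norm]
    exact ENNReal.ofReal_le_ofReal hx
  · rw [lintegral_const]
    exact ENNReal.mul_ne_top ENNReal.ofReal_ne_top (measure_ne_top _ _)
  · filter_upwards [hf] with x hx
    simpa using hx.enorm

theorem isTestFunction_mollification {Ω : Set (RN N)} {ψ : RN N → ℝ} (hψ : IsLipTest Ω ψ) {δ : ℝ}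
    (hδ : 0 < δ) (hδΩ : Metric.cthickening δ (tsupport ψ) ⊆ Ω) (n : ℕ) :
    IsTestFunction Ω ((mollifier hδ n).normed volume ⋆[lsmul ℝ ℝ, volume] ψ) := by
  refine ⟨(mollifier hδ n).hasCompactSupport_normed.contDiff_convolution_left _
    (mollifier hδ n).contDiff_normed hψ.continuous.locallyIntegrable,
    (mollifier hδ n).hasCompactSupport_normed.convolution _ hψ.compact, ?_⟩
  refine subset_trans (closure_minimal ?_ Metric.isClosed_cthickening) hδΩ
  intro x hx
  obtain ⟨y, hy, z, hz, rfl⟩ := support_convolution_subset _ hx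
  refine Metric.mem_cthickening_of_dist_le _ z δ _ (subset_tsupport _ hz) ?_
  have h1 := subset_tsupport _ hy
  rw [ContDiffBump.tsupport_normed_eq, mem_closedBall_zero_iff] at h1
  simpa [dist_eq_norm] using h1.trans (mollifier_rOut_le hδ n)

theorem IsLipTest.integral_mollifier_gradient {U : Set (RN N)} {ψ : RN N → ℝ} (hψ : IsLipTest U ψ)
    {ρ : RN N → ℝ} (hρ : ContDiff ℝ ∞ ρ) (hc : HasCompactSupport ρ) (x e : RN N) :
    ∫ z, ψ z * inner ℝ (gradient (fun z => ρ (x - z)) z) e =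
      -∫ z, inner ℝ (gradient ψ z) e * ρ (x - z) := by
  obtain ⟨C, hC⟩ := hψ.lipschitz
  exact hC.integral_mul_inner_gradient
    (isTestFunction_sub_left (Ω := univ) hρ hc fun z _ => mem_univ z) e

/-- Each component of the gradient of a mollification is the mollification of that component, so
Lebesgue differentiation applies coordinatewise. -/
theorem IsLipTest.ae_tendsto_gradient_mollification {U : Set (RN N)} {ψ : RN N → ℝ}
    (hψ : IsLipTest U ψ) {δ : ℝ} (hδ : 0 < δ) :
    ∀ᵐ x, Tendsto
      (fun n => gradient ((mollifier hδ n).normed volume ⋆[lsmul ℝ ℝ, volume] ψ) x) atTop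
      (𝓝 (gradient ψ x)) := by
  obtain ⟨C, hC⟩ := hψ.lipschitz
  have hgi : LocallyIntegrable (gradient ψ) volume := by
    refine (locallyIntegrable_const (C : ℝ)).mono
      (measurable_gradient ψ).aestronglyMeasurable (Eventually.of_forall fun x => ?_)
    simpa using hC.norm_gradient_le x
  have hli : ∀ e : RN N, LocallyIntegrable (fun x => inner ℝ (gradient ψ x) e) volume := by
    intro e x
    obtain ⟨s, hs, hi⟩ := hgi x
    exact ⟨s, hs, hi.inner_const e⟩
  have hall : ∀ᵐ x, ∀ i : Fin N, Tendsto (fun n => ((mollifier hδ n).normed volume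
      ⋆[lsmul ℝ ℝ, volume] fun x => inner ℝ (gradient ψ x) (EuclideanSpace.basisFun (Fin N) ℝ i)) x)
      atTop (𝓝 (inner ℝ (gradient ψ x) (EuclideanSpace.basisFun (Fin N) ℝ i))) :=
    ae_all_iff.2 fun i => ae_tendsto_mollification hδ (hli _)
  filter_upwards [hall] with x hx
  have hsum : ∀ v : RN N, v = ∑ i, inner ℝ v (EuclideanSpace.basisFun (Fin N) ℝ i) •
      EuclideanSpace.basisFun (Fin N) ℝ i := fun v => by
    conv_lhs => rw [← (EuclideanSpace.basisFun (Fin N) ℝ).sum_repr' v]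
    refine Finset.sum_congr rfl fun i _ => ?_
    rw [real_inner_comm]
  rw [hsum (gradient ψ x)]
  have heq : ∀ n, gradient ((mollifier hδ n).normed volume ⋆[lsmul ℝ ℝ, volume] ψ) x =
      ∑ i, ((mollifier hδ n).normed volume ⋆[lsmul ℝ ℝ, volume] fun x =>
        inner ℝ (gradient ψ x) (EuclideanSpace.basisFun (Fin N) ℝ i)) x •
        EuclideanSpace.basisFun (Fin N) ℝ i := by
    intro n
    have hρs : ContDiff ℝ ∞ ((mollifier (N := N) hδ n).normed volume) :=
      (mollifier hδ n).contDiff_normed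
    have hρc : HasCompactSupport ((mollifier (N := N) hδ n).normed volume) :=
      (mollifier hδ n).hasCompactSupport_normed
    rw [hsum (gradient _ x)]
    refine Finset.sum_congr rfl fun i _ => ?_
    rw [inner_gradient_left, (hasFDerivAt_mollification hρs hρc
      hψ.continuous.locallyIntegrable x).2, hψ.integral_mollifier_gradient hρs hρc, neg_neg,
      convolution_eq_swap]
    congr 1
    refine integral_congr_ae (Eventually.of_forall fun z => ?_)
    simp [mul_comm]
  simp only [heq]
  exact tendsto_finsetSum _ fun i _ => (hx i).smul_const _

/-- Lipschitz functions with compact support in `Ω` belong to `W_0^{1,∞}(Ω)`. -/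
theorem IsLipTest.exists_w1Inf {Ω : Set (RN N)} (hΩ : IsOpen Ω) (hb : Bornology.IsBounded Ω)
    {ψ : RN N → ℝ} (hψ : IsLipTest Ω ψ) :
    ∃ w : W1Inf Ω, w ∈ W01Inf Ω ∧ sobVal w =ᵐ[lebOn Ω] ψ ∧ sobGrad w =ᵐ[lebOn Ω] gradient ψ := by
  have : IsFiniteMeasure (lebOn Ω) := ⟨by simpa using hb.measure_lt_top⟩
  obtain ⟨C, hC⟩ := hψ.lipschitz
  obtain ⟨D, hD⟩ := hψ.compact.exists_bound_of_continuous hψ.continuous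
  have hm1 : MemLp ψ ∞ (lebOn Ω) :=
    MemLp.of_bound hψ.continuous.aestronglyMeasurable D (Eventually.of_forall hD)
  have hm2 : MemLp (gradient ψ) ∞ (lebOn Ω) :=
    MemLp.of_bound (measurable_gradient ψ).aestronglyMeasurable C
      (Eventually.of_forall hC.norm_gradient_le)
  have hweak : HasWeakGradient Ω (hm1.toLp ψ) (hm2.toLp (gradient ψ)) := by
    intro φ hφ e
    have h1 : ∫ x in Ω, hm1.toLp ψ x * inner ℝ (gradient φ x) e =
        ∫ x in Ω, ψ x * inner ℝ (gradient φ x) e := by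
      refine integral_congr_ae ?_
      filter_upwards [hm1.coeFn_toLp] with x hx
      rw [hx]
    have h2 : ∫ x in Ω, inner ℝ (hm2.toLp (gradient ψ) x) e * φ x =
        ∫ x in Ω, inner ℝ (gradient ψ x) e * φ x := by
      refine integral_congr_ae ?_
      filter_upwards [hm2.coeFn_toLp] with x hx
      rw [hx]
    rw [h1, h2, setIntegral_eq_integral_of_forall_compl_eq_zero fun x hx => by
        rw [hφ.gradient_eq_zero hx, inner_zero_left, mul_zero],
      setIntegral_eq_integral_of_forall_compl_eq_zero fun x hx => by
        rw [hφ.eq_zero hx, mul_zero]]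
    exact hC.integral_mul_inner_gradient hφ e
  -- Room around the support for mollifying without leaving `Ω`.
  obtain ⟨δ, hδ, hδΩ⟩ := hψ.compact.isCompact.exists_cthickening_subset_open hΩ hψ.subset
  refine ⟨⟨(hm1.toLp ψ, hm2.toLp (gradient ψ)), hweak⟩, ?_, hm1.coeFn_toLp, hm2.coeFn_toLp⟩
  refine ⟨fun n => (mollifier hδ n).normed volume ⋆[lsmul ℝ ℝ, volume] ψ,
    fun n => isTestFunction_mollification hψ hδ hδΩ n, ?_, ?_⟩
  · have hdist : ∀ n x, ‖ψ x - ((mollifier hδ n).normed volume ⋆[lsmul ℝ ℝ, volume] ψ) x‖ ≤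
        C * (mollifier (N := N) hδ n).rOut := by
      intro n x
      rw [← dist_eq_norm, dist_comm]
      refine ContDiffBump.dist_normed_convolution_le hψ.continuous.aestronglyMeasurable
        fun y hy => (hC.dist_le_mul y x).trans ?_
      gcongr
      exact (Metric.mem_ball.1 hy).le
    have hcongr : ∀ n, eLpNorm (fun x => hm1.toLp ψ x -
        ((mollifier hδ n).normed volume ⋆[lsmul ℝ ℝ, volume] ψ) x) 1 (lebOn Ω) =
        eLpNorm (fun x => ψ x -
        ((mollifier hδ n).normed volume ⋆[lsmul ℝ ℝ, volume] ψ) x) 1 (lebOn Ω) := fun n => by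
      refine eLpNorm_congr_ae ?_
      filter_upwards [hm1.coeFn_toLp] with x hx
      rw [hx]
    change Tendsto (fun n => eLpNorm (fun x => hm1.toLp ψ x -
        ((mollifier hδ n).normed volume ⋆[lsmul ℝ ℝ, volume] ψ) x) 1 (lebOn Ω)) atTop (𝓝 0)
    simp only [hcongr]
    refine tendsto_eLpNorm_one_of_bounded (C := C * δ) (fun n => ?_) (fun n => ?_) ?_
    · exact (hψ.continuous.sub
        (isTestFunction_mollification hψ hδ hδΩ n).1.continuous).aestronglyMeasurable
    · refine Eventually.of_forall fun x => (hdist n x).trans ?_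
      gcongr
      exact mollifier_rOut_le hδ n
    · refine Eventually.of_forall fun x => ?_
      refine squeeze_zero_norm (fun n => hdist n x) ?_
      simpa using (tendsto_mollifier_rOut (N := N) hδ).const_mul (C : ℝ)
  · have hcongr : ∀ n, eLpNorm (fun x => hm2.toLp (gradient ψ) x -
        gradient ((mollifier hδ n).normed volume ⋆[lsmul ℝ ℝ, volume] ψ) x) 1 (lebOn Ω) =
        eLpNorm (fun x => gradient ψ x -
        gradient ((mollifier hδ n).normed volume ⋆[lsmul ℝ ℝ, volume] ψ) x) 1 (lebOn Ω) :=
      fun n => by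
        refine eLpNorm_congr_ae ?_
        filter_upwards [hm2.coeFn_toLp] with x hx
        rw [hx]
    change Tendsto (fun n => eLpNorm (fun x => hm2.toLp (gradient ψ) x -
        gradient ((mollifier hδ n).normed volume ⋆[lsmul ℝ ℝ, volume] ψ) x) 1 (lebOn Ω)) atTop (𝓝 0)
    simp only [hcongr]
    refine tendsto_eLpNorm_one_of_bounded (C := C + C) (fun n => ?_) (fun n => ?_) ?_
    · exact ((measurable_gradient _).sub (measurable_gradient _)).aestronglyMeasurable
    · refine Eventually.of_forall fun x => (norm_sub_le _ _).trans ?_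
      refine add_le_add (hC.norm_gradient_le x) ?_
      have hρs : ContDiff ℝ ∞ ((mollifier (N := N) hδ n).normed volume) :=
        (mollifier hδ n).contDiff_normed
      have hρc : HasCompactSupport ((mollifier (N := N) hδ n).normed volume) :=
        (mollifier hδ n).hasCompactSupport_normed
      rw [norm_gradient]
      exact norm_fderiv_mollification_le hρs hρc (mollifier hδ n).nonneg_normed
        (mollifier hδ n).integral_normed hψ.continuous.locallyIntegrable C.2
        (Eventually.of_forall hC.norm_gradient_le)
        fun e => hψ.integral_mollifier_gradient hρs hρc x e
    · filter_upwards [ae_restrict_of_ae (hψ.ae_tendsto_gradient_mollification hδ)] with x hx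
      simpa using hx.const_sub (gradient ψ x)

/-- Gradients of uniformly small functions with bounded gradients converge weakly to zero. -/
theorem tendsto_integral_inner_gradient {ψ : ℕ → RN N → ℝ} {Ω : Set (RN N)}
    (hψ : ∀ n, IsLipTest Ω (ψ n)) {ε : ℕ → ℝ} (hb : ∀ n x, |ψ n x| ≤ ε n)
    (hε : Tendsto ε atTop (𝓝 0)) {C : ℝ} (hC : ∀ n, ∀ᵐ x, ‖gradient (ψ n) x‖ ≤ C)
    {p : RN N → RN N} (hp : Integrable p) :
    Tendsto (fun n => ∫ x, inner ℝ (gradient (ψ n) x) (p x)) atTop (𝓝 0) := by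
  have hC0 : 0 ≤ C := by
    obtain ⟨x, hx⟩ := (hC 0).exists
    exact (norm_nonneg _).trans hx
  have hint : ∀ n {q : RN N → RN N}, Integrable q →
      Integrable (fun x => inner ℝ (gradient (ψ n) x) (q x)) := by
    intro n q hq
    refine (hq.norm.const_mul C).mono'
      ((measurable_gradient _).aestronglyMeasurable.inner hq.1) ?_
    filter_upwards [hC n] with x hx
    exact (norm_inner_le_norm _ _).trans (by gcongr)
  rw [Metric.tendsto_atTop']
  intro η hη
  -- Against a smooth compactly supported `g` the derivative can be moved onto `g`, which exhibits
  -- the factor `ε n`. The `L¹` error is paid with the gradient bound, and `C + 1` avoids dividing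
  -- by zero.
  obtain ⟨g, hg1, hg2, hg3⟩ := MemLp.exist_eLpNorm_sub_le (μ := volume) ENNReal.one_ne_top le_rfl
    (memLp_one_iff_integrable.2 hp) (show 0 < η / 2 / (C + 1) by positivity)
  have hgi : Integrable g := hg2.continuous.integrable_of_hasCompactSupport hg1
  have hpgi : Integrable fun x => p x - g x := hp.sub hgi
  have hpg : ∫ x, ‖p x - g x‖ ≤ η / 2 / (C + 1) := by
    rw [eLpNorm_one_eq_lintegral_enorm] at hg3
    rw [integral_norm_eq_lintegral_enorm hpgi.1]
    exact ENNReal.toReal_le_of_le_ofReal (by positivity) hg3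
  set b := EuclideanSpace.basisFun (Fin N) ℝ with hbdef
  have htest : ∀ i, IsTestFunction univ fun x => inner ℝ (b i) (g x) := by
    intro i
    refine ⟨contDiff_const.inner ℝ hg2, ?_, subset_univ _⟩
    exact hg1.mono fun x hx hgx => hx (by simp [hgx])
  have hparts : ∀ n, ∫ x, inner ℝ (gradient (ψ n) x) (g x) =
      ∑ i, -∫ x, ψ n x * inner ℝ (gradient (fun x => inner ℝ (b i) (g x)) x) (b i) := by
    intro n
    obtain ⟨L, hL⟩ := (hψ n).lipschitz
    have h1 : ∀ x, inner ℝ (gradient (ψ n) x) (g x) =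
        ∑ i, inner ℝ (gradient (ψ n) x) (b i) * inner ℝ (b i) (g x) := fun x =>
      (b.sum_inner_mul_inner _ _).symm
    simp only [h1]
    rw [integral_finsetSum]
    · refine Finset.sum_congr rfl fun i _ => ?_
      rw [hL.integral_mul_inner_gradient (htest i), neg_neg]
    · intro i _
      have h2 : Integrable fun x => inner ℝ (b i) (g x) • b i :=
        (hgi.const_inner (b i)).smul_const _
      refine (hint n h2).congr (Eventually.of_forall fun x => ?_)
      simp only
      rw [real_inner_smul_right, mul_comm]
  set A := ∑ i, ∫ x, ‖inner ℝ (gradient (fun x => inner ℝ (b i) (g x)) x) (b i)‖ with hA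
  have hsmall : ∀ n, |∫ x, inner ℝ (gradient (ψ n) x) (g x)| ≤ ε n * A := by
    intro n
    rw [hparts n, hA, Finset.mul_sum]
    refine (Finset.abs_sum_le_sum_abs _ _).trans (Finset.sum_le_sum fun i _ => ?_)
    rw [abs_neg, ← integral_const_mul, ← Real.norm_eq_abs]
    have hi := (htest i).integrable_gradient (b i)
    rw [lebOn, Measure.restrict_univ] at hi
    refine norm_integral_le_of_norm_le (hi.norm.const_mul _) (Eventually.of_forall fun x => ?_)
    rw [norm_mul]
    gcongr
    exact hb n x
  have hlim : Tendsto (fun n => ε n * A) atTop (𝓝 0) := by simpa using hε.mul_const A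
  obtain ⟨n₀, hn₀⟩ := (Metric.tendsto_atTop'.1 hlim) (η / 2) (by positivity)
  refine ⟨n₀, fun n hn => ?_⟩
  have h1 := hn₀ n hn
  rw [Real.dist_eq, sub_zero] at h1 ⊢
  have h2 : ∫ x, inner ℝ (gradient (ψ n) x) (p x) =
      (∫ x, inner ℝ (gradient (ψ n) x) (p x - g x)) + ∫ x, inner ℝ (gradient (ψ n) x) (g x) := by
    rw [← integral_add (hint n hpgi) (hint n hgi)]
    refine integral_congr_ae (Eventually.of_forall fun x => ?_)
    simp only
    rw [inner_sub_right, sub_add_cancel]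
  have h3 : |∫ x, inner ℝ (gradient (ψ n) x) (p x - g x)| ≤ C * (η / 2 / (C + 1)) := by
    rw [← Real.norm_eq_abs]
    refine (norm_integral_le_of_norm_le (hpgi.norm.const_mul C) ?_).trans ?_
    · filter_upwards [hC n] with x hx
      exact (norm_inner_le_norm _ _).trans (by gcongr)
    · rw [integral_const_mul]
      gcongr
  have h4 : C * (η / 2 / (C + 1)) ≤ η / 2 := by
    rw [mul_div_assoc', div_le_iff₀ (by positivity)]
    nlinarith
  rw [h2]
  refine (abs_add_le _ _).trans_lt ?_
  have h5 := hsmall n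
  have h6 := le_abs_self (ε n * A)
  linarith

end ZeroTrace

/-! ### Measurability of the bipolar and integrable approximate subgradients. -/

section MeasurableSelection

variable {N : ℕ}

theorem polar_le_polar_add {K : ℝ} (hK : 0 < K) {φ χ : RN N → ℝ} {C t : ℝ}
    (h0 : ∀ ξ ∈ Metric.ball (0 : RN N) K, C ≤ φ ξ)
    (h : ∀ ξ ∈ Metric.ball (0 : RN N) K, φ ξ ≤ χ ξ + t) (p : RN N) :
    polar (Metric.ball 0 K) χ p ≤ polar (Metric.ball 0 K) φ p + t := by
  refine csSup_le ((Metric.nonempty_ball.2 hK).image _) ?_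
  rintro _ ⟨η, hη, rfl⟩
  have h1 := inner_sub_polar_le h0 p hη
  have h2 := h η hη
  simp only
  linarith

/-- A supremum of affine functions whose slopes have norm less than `K`. Continuity of the polar in
`p` reduces the supremum defining the bipolar to a countable dense set. -/
theorem lipschitzWith_polar {K C : ℝ} (hK : 0 < K) {φ : RN N → ℝ}
    (h0 : ∀ ξ ∈ Metric.ball (0 : RN N) K, C ≤ φ ξ) :
    LipschitzWith K.toNNReal (polar (Metric.ball 0 K) φ) := by
  refine LipschitzWith.of_le_add_mul _ fun p q => ?_
  rw [Real.coe_toNNReal K hK.le]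
  refine csSup_le ((Metric.nonempty_ball.2 hK).image _) ?_
  rintro _ ⟨η, hη, rfl⟩
  have h1 := inner_sub_polar_le h0 q hη
  have h2 := (abs_le.1 (abs_real_inner_le_norm (p - q) η)).2
  have h3 : ‖η‖ ≤ K := (mem_ball_zero_iff.1 hη).le
  have h4 := mul_le_mul_of_nonneg_left h3 (norm_nonneg (p - q))
  rw [inner_sub_left] at h2
  rw [dist_eq_norm]
  simp only
  linarith

theorem inner_sub_polar_le_bipolar {K C : ℝ} {φ : RN N → ℝ}
    (h0 : ∀ ξ ∈ Metric.ball (0 : RN N) K, C ≤ φ ξ) {ξ : RN N}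
    (hξ : ξ ∈ Metric.ball (0 : RN N) K) (p : RN N) :
    inner ℝ p ξ - polar (Metric.ball 0 K) φ p ≤ bipolar (Metric.ball 0 K) φ ξ :=
  le_ciSup (bddAbove_bipolar h0 hξ) p

theorem bipolar_le {K C : ℝ} {φ : RN N → ℝ} (h0 : ∀ ξ ∈ Metric.ball (0 : RN N) K, C ≤ φ ξ)
    {ξ : RN N} (hξ : ξ ∈ Metric.ball (0 : RN N) K) : bipolar (Metric.ball 0 K) φ ξ ≤ φ ξ :=
  ciSup_le fun p => inner_sub_polar_le h0 p hξ

theorem bipolar_nonneg {K : ℝ} {φ : RN N → ℝ} (h0 : ∀ ξ ∈ Metric.ball (0 : RN N) K, 0 ≤ φ ξ)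
    {ξ : RN N} (hξ : ξ ∈ Metric.ball (0 : RN N) K) : 0 ≤ bipolar (Metric.ball 0 K) φ ξ := by
  refine le_trans ?_ (inner_sub_polar_le_bipolar h0 hξ 0)
  rw [inner_zero_left, zero_sub, neg_nonneg]
  refine csSup_le ⟨_, mem_image_of_mem _ hξ⟩ ?_
  rintro _ ⟨η, hη, rfl⟩
  have := h0 η hη
  simp only [inner_zero_left]
  linarith

theorem exists_lt_inner_sub_polar {D : ℕ → RN N} (hD : DenseRange D) {K C : ℝ} {φ : RN N → ℝ}
    (h0 : ∀ ξ ∈ Metric.ball (0 : RN N) K, C ≤ φ ξ) {ξ : RN N}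
    (hξ : ξ ∈ Metric.ball (0 : RN N) K) {t : ℝ} (ht : t < bipolar (Metric.ball 0 K) φ ξ) :
    ∃ k, t < inner ℝ (D k) ξ -
      polar (Metric.ball 0 K) φ (D k) := by
  have hK : 0 < K := Metric.pos_of_mem_ball hξ
  obtain ⟨p, hp⟩ := exists_lt_of_lt_ciSup ht
  have hc : Continuous fun p : RN N => inner ℝ p ξ - polar (Metric.ball 0 K) φ p :=
    (continuous_id.inner continuous_const).sub (lipschitzWith_polar hK h0).continuous
  obtain ⟨q, hq, k, rfl⟩ := hD.inter_open_nonempty _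
    (isOpen_lt continuous_const hc) ⟨p, hp⟩
  exact ⟨k, hq⟩

theorem bipolar_eq_iSup_of_denseRange {D : ℕ → RN N} (hD : DenseRange D) {K C : ℝ} {φ : RN N → ℝ}
    (h0 : ∀ ξ ∈ Metric.ball (0 : RN N) K, C ≤ φ ξ) {ξ : RN N}
    (hξ : ξ ∈ Metric.ball (0 : RN N) K) :
    bipolar (Metric.ball 0 K) φ ξ = ⨆ k, (inner ℝ (D k) ξ -
      polar (Metric.ball 0 K) φ (D k)) := by
  have hb : BddAbove (range fun k => inner ℝ (D k) ξ -
      polar (Metric.ball 0 K) φ (D k)) :=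
    (bddAbove_bipolar h0 hξ).mono (by rintro _ ⟨k, rfl⟩; exact ⟨_, rfl⟩)
  refine le_antisymm (le_of_forall_lt fun t ht => ?_)
    (ciSup_le fun k => inner_sub_polar_le_bipolar h0 hξ _)
  obtain ⟨k, hk⟩ := exists_lt_inner_sub_polar hD h0 hξ ht
  exact hk.trans_le (le_ciSup hb k)

/-- The least admissible index. Adding the complement of the union to every set makes the search
terminate everywhere. -/
theorem exists_measurable_index {α : Type*} [MeasurableSpace α] {μ : Measure α} {E : ℕ → Set α}
    (hE : ∀ k, MeasurableSet (E k)) (h : ∀ᵐ x ∂μ, ∃ k, x ∈ E k) :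
    ∃ κ : α → ℕ, Measurable κ ∧ ∀ᵐ x ∂μ, x ∈ E (κ x) := by
  classical
  have hex : ∀ x, ∃ k, x ∈ E k ∪ (⋃ j, E j)ᶜ := by
    intro x
    by_cases hx : x ∈ ⋃ j, E j
    · obtain ⟨k, hk⟩ := mem_iUnion.1 hx
      exact ⟨k, Or.inl hk⟩
    · exact ⟨0, Or.inr hx⟩
  refine ⟨fun x => Nat.find (hex x), measurable_find hex fun k =>
    (hE k).union (MeasurableSet.iUnion hE).compl, ?_⟩
  filter_upwards [h] with x hx
  rcases Nat.find_spec (hex x) with h1 | h1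
  · exact h1
  · exact absurd (mem_iUnion.2 hx) h1

/-- A converse to Lusin's theorem: the compact sets exhaust `Ω` up to a null set, and `F` is
measurable on each. The set `A` carries conditions known only almost everywhere, and is shrunk to a
measurable set of full measure. -/
theorem aemeasurable_of_lusin {Ω : Set (RN N)} (hΩ : MeasurableSet Ω) {A : Set (RN N)}
    (hA : ∀ᵐ x ∂(lebOn Ω), x ∈ A) {F : RN N → ℝ}
    (h : ∀ δ : ℝ, 0 < δ → ∃ T : Set (RN N), T ⊆ Ω ∧ IsCompact T ∧
      volume (Ω \ T) < ENNReal.ofReal δ ∧ ContinuousOn F (T ∩ A)) :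
    AEMeasurable F (lebOn Ω) := by
  choose! T hTΩ hTc hTδ hTF using h
  obtain ⟨A', hA', hA'm, hA'n⟩ := exists_measurable_superset_of_null (ae_iff.1 hA)
  have hAsub : A'ᶜ ⊆ A := by
    intro x hx
    by_contra hxA
    exact hx (hA' hxA)
  have hpos : ∀ n : ℕ, (0 : ℝ) < 1 / ((n : ℝ) + 1) := fun n => by positivity
  have hm : ∀ n : ℕ, AEMeasurable F ((lebOn Ω).restrict (T (1 / ((n : ℝ) + 1)) ∩ A'ᶜ)) := by
    intro n
    have h1 : MeasurableSet (T (1 / ((n : ℝ) + 1)) ∩ A'ᶜ) :=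
      (hTc _ (hpos n)).measurableSet.inter hA'm.compl
    exact ((hTF _ (hpos n)).mono (inter_subset_inter_right _ hAsub)).aemeasurable h1
  have hU := aemeasurable_iUnion_iff.2 hm
  have hcov : ∀ᵐ x ∂(lebOn Ω), x ∈ ⋃ n : ℕ, T (1 / ((n : ℝ) + 1)) ∩ A'ᶜ := by
    have hN : ∀ᵐ x ∂(lebOn Ω), x ∈ ⋃ n : ℕ, T (1 / ((n : ℝ) + 1)) := by
      rw [ae_restrict_iff' hΩ, ae_iff]
      refine le_antisymm (ENNReal.le_of_forall_pos_le_add fun t ht _ => ?_) zero_le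
      rw [zero_add]
      obtain ⟨n, hn⟩ := exists_nat_one_div_lt (show (0 : ℝ) < t from ht)
      refine (measure_mono (t := Ω \ T (1 / ((n : ℝ) + 1))) ?_).trans
        ((hTδ _ (hpos n)).le.trans ?_)
      · intro x hx
        simp only [mem_ofPred_eq, Classical.not_imp, mem_iUnion, not_exists] at hx
        exact ⟨hx.1, hx.2 n⟩
      · refine (ENNReal.ofReal_le_ofReal hn.le).trans_eq ?_
        exact ENNReal.ofReal_coe_nnreal
    have hA'' : ∀ᵐ x ∂(lebOn Ω), x ∈ A'ᶜ := by
      rw [ae_iff]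
      simpa using hA'n
    filter_upwards [hN, hA''] with x h1 h2
    obtain ⟨n, hn⟩ := mem_iUnion.1 h1
    exact mem_iUnion.2 ⟨n, hn, h2⟩
  rwa [Measure.restrict_eq_self_of_ae_mem hcov] at hU

/-- The polar changes by at most the uniform distance between two integrands. Continuity in `x`
uniformly in `ξ` therefore passes to it on the Lusin sets, although the supremum runs over
uncountably many slopes. -/
theorem IsAdmissibleLagrangian.aemeasurable_polar {Ω : Set (RN N)} (hΩ : MeasurableSet Ω) {K : ℝ}
    (hK : 0 < K) {f : RN N → RN N → ℝ} (hf : IsAdmissibleLagrangian Ω K f) (p : RN N) :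
    AEMeasurable (fun x => polar (Metric.ball 0 K) (f x) p) (lebOn Ω) := by
  obtain ⟨a, -, ha⟩ := hf.bound
  refine aemeasurable_of_lusin hΩ
    (A := {x | ∀ ξ ∈ Metric.ball (0 : RN N) K, 0 ≤ f x ξ})
    (by filter_upwards [ha] with x hx ξ hξ using (hx ξ hξ).1) fun δ hδ => ?_
  obtain ⟨T, hT1, hT2, hT3, hT4⟩ := hf.lusin δ hδ
  refine ⟨T, hT1, hT2, hT3, ?_⟩
  rw [Metric.continuousOn_iff]
  intro x hx ε hε
  obtain ⟨η, hη, hη'⟩ := hT4 x hx.1 (ε / 2) (by positivity)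
  refine ⟨η, hη, fun y hy hyx => ?_⟩
  have h1 := hη' y hy.1 hyx
  have h2 := polar_le_polar_add (t := ε / 2) hK hx.2
    (fun ξ hξ => by linarith [(abs_lt.1 (h1 ξ hξ)).1] :
      ∀ ξ ∈ Metric.ball (0 : RN N) K, f x ξ ≤ f y ξ + ε / 2) p
  have h3 := polar_le_polar_add (t := ε / 2) hK hy.2
    (fun ξ hξ => by linarith [(abs_lt.1 (h1 ξ hξ)).2] :
      ∀ ξ ∈ Metric.ball (0 : RN N) K, f y ξ ≤ f x ξ + ε / 2) p
  rw [Real.dist_eq, abs_lt]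
  constructor <;> linarith

theorem IsAdmissibleLagrangian.aemeasurable_bipolar {Ω : Set (RN N)} (hΩ : MeasurableSet Ω) {K : ℝ}
    (hK : 0 < K) {f : RN N → RN N → ℝ} (hf : IsAdmissibleLagrangian Ω K f) {V : RN N → RN N}
    (hV : AEMeasurable V (lebOn Ω)) (hVK : ∀ᵐ x ∂(lebOn Ω), V x ∈ Metric.ball (0 : RN N) K) :
    AEMeasurable (fun x => bipolar (Metric.ball 0 K) (f x) (V x)) (lebOn Ω) := by
  obtain ⟨a, -, ha⟩ := hf.bound
  obtain ⟨D, hD⟩ : ∃ D : ℕ → RN N, DenseRange D :=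
    ⟨_, TopologicalSpace.denseRange_denseSeq (RN N)⟩
  have h1 : AEMeasurable (fun x => ⨆ k, (inner ℝ (D k) (V x) -
      polar (Metric.ball 0 K) (f x) (D k))) (lebOn Ω) :=
    AEMeasurable.iSup fun k => (aemeasurable_const.inner hV).sub (hf.aemeasurable_polar hΩ hK _)
  refine h1.congr ?_
  filter_upwards [ha, hVK] with x h2 h3
  exact (bipolar_eq_iSup_of_denseRange hD (fun ξ hξ => (h2 ξ hξ).1) h3).symm

theorem IsAdmissibleLagrangian.integrable_bipolar {Ω : Set (RN N)} (hΩ : MeasurableSet Ω) {K : ℝ}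
    (hK : 0 < K) {f : RN N → RN N → ℝ} (hf : IsAdmissibleLagrangian Ω K f) {V : RN N → RN N}
    (hV : AEMeasurable V (lebOn Ω)) (hVK : ∀ᵐ x ∂(lebOn Ω), V x ∈ Metric.ball (0 : RN N) K) :
    Integrable (fun x => bipolar (Metric.ball 0 K) (f x) (V x)) (lebOn Ω) := by
  obtain ⟨a, hai, ha⟩ := hf.bound
  refine Integrable.mono' hai (hf.aemeasurable_bipolar hΩ hK hV hVK).aestronglyMeasurable ?_
  filter_upwards [ha, hVK] with x h1 h2
  have h3 : ∀ ξ ∈ Metric.ball (0 : RN N) K, 0 ≤ f x ξ := fun ξ hξ => (h1 ξ hξ).1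
  rw [Real.norm_of_nonneg (bipolar_nonneg h3 h2)]
  exact (bipolar_le h3 h2).trans (h1 _ h2).2

theorem IsAdmissibleLagrangian.integrable_comp {Ω : Set (RN N)} {K : ℝ}
    {f : RN N → RN N → ℝ} (hf : IsAdmissibleLagrangian Ω K f) {V : RN N → RN N}
    (hV : AEMeasurable V (lebOn Ω)) (hVK : ∀ᵐ x ∂(lebOn Ω), V x ∈ Metric.ball (0 : RN N) K) :
    Integrable (fun x => f x (V x)) (lebOn Ω) := by
  obtain ⟨a, hai, ha⟩ := hf.bound
  obtain ⟨g, hg, hfg⟩ := hf.borel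
  have h1 : AEMeasurable (fun x => g (x, V x)) (lebOn Ω) :=
    hg.comp_aemeasurable (aemeasurable_id.prodMk hV)
  refine Integrable.mono' hai (h1.congr ?_).aestronglyMeasurable ?_
  · filter_upwards [hfg, hVK] with x h2 h3
    exact (h2 _ h3).symm
  · filter_upwards [ha, hVK] with x h2 h3
    rw [Real.norm_of_nonneg (h2 _ h3).1]
    exact (h2 _ h3).2

/-- An integrable field of approximate subgradients of the bipolar along `V`. -/
theorem IsAdmissibleLagrangian.exists_integrable_subgradient {Ω : Set (RN N)}
    (hΩ : MeasurableSet Ω) (hΩf : volume Ω ≠ ⊤) {K : ℝ}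
    (hK : 0 < K) {f : RN N → RN N → ℝ} (hf : IsAdmissibleLagrangian Ω K f) {V : RN N → RN N}
    (hV : AEMeasurable V (lebOn Ω)) {M : ℝ} (hMK : M < K) (hVM : ∀ᵐ x ∂(lebOn Ω), ‖V x‖ ≤ M)
    {ε : ℝ} (hε : 0 < ε) :
    ∃ p : RN N → RN N, Integrable p (lebOn Ω) ∧ ∀ᵐ x ∂(lebOn Ω), ∀ ξ ∈ Metric.ball (0 : RN N) K,
      bipolar (Metric.ball 0 K) (f x) (V x) - ε + inner ℝ (p x) (ξ - V x) ≤ f x ξ := by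
  obtain ⟨a, hai, ha⟩ := hf.bound
  have hVK : ∀ᵐ x ∂(lebOn Ω), V x ∈ Metric.ball (0 : RN N) K := by
    filter_upwards [hVM] with x hx
    rw [mem_ball_zero_iff]
    exact hx.trans_lt hMK
  obtain ⟨D, hD⟩ : ∃ D : ℕ → RN N, DenseRange D :=
    ⟨_, TopologicalSpace.denseRange_denseSeq (RN N)⟩
  have hFm : ∀ k, AEMeasurable (fun x => inner ℝ (D k) (V x) -
      polar (Metric.ball 0 K) (f x) (D k)) (lebOn Ω) := fun k =>
    (aemeasurable_const.inner hV).sub (hf.aemeasurable_polar hΩ hK _)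
  choose F hFm hF using hFm
  obtain ⟨β, hβm, hβ⟩ := hf.aemeasurable_bipolar hΩ hK hV hVK
  have hEm : ∀ k, MeasurableSet {x | β x - ε < F k x} := fun k =>
    measurableSet_lt (hβm.sub_const ε) (hFm k)
  have hEx : ∀ᵐ x ∂(lebOn Ω), ∃ k, x ∈ {x | β x - ε < F k x} := by
    filter_upwards [ha, hVK, hβ, ae_all_iff.2 hF] with x h1 h2 h3 h4
    obtain ⟨k, hk⟩ := exists_lt_inner_sub_polar hD (fun ξ hξ => (h1 ξ hξ).1) h2
      (sub_lt_self (bipolar (Metric.ball 0 K) (f x) (V x)) hε)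
    rw [h3] at hk
    exact ⟨k, hk.trans_eq (h4 k)⟩
  obtain ⟨κ, hκ, hκE⟩ := exists_measurable_index hEm hEx
  obtain ⟨p, hp⟩ : ∃ p : RN N → RN N, ∀ x, p x = D (κ x) := ⟨_, fun _ => rfl⟩
  have hpm : Measurable p := by
    rw [funext hp]
    exact (measurable_from_nat (f := D)).comp hκ
  have hsub : ∀ᵐ x ∂(lebOn Ω), ∀ ξ ∈ Metric.ball (0 : RN N) K,
      bipolar (Metric.ball 0 K) (f x) (V x) - ε + inner ℝ (p x) (ξ - V x) ≤ f x ξ := by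
    filter_upwards [ha, hκE, hβ, ae_all_iff.2 hF] with x h1 h2 h3 h4 ξ hξ
    have h5 : β x - ε < F (κ x) x := h2
    rw [← h3, ← h4 (κ x), ← hp x] at h5
    have h6 := inner_sub_polar_le (fun ξ hξ => (h1 ξ hξ).1) (p x) hξ
    rw [inner_sub_right]
    linarith
  refine ⟨p, ?_, hsub⟩
  -- A step of length `δ` from `V x` in any direction stays in the ball. Testing the subgradient
  -- inequality in the direction of `p x` gives `‖p x‖ * δ ≤ a x + ε`, which is the integrable
  -- bound.
  set δ := (K - M) / 2 with hδdef
  have hδ : 0 < δ := by rw [hδdef]; linarith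
  have hdom : Integrable (fun x => (a x + ε) / δ) (lebOn Ω) := by
    have hc : Integrable (fun _ : RN N => ε) (lebOn Ω) := integrableOn_const hΩf
    exact (Integrable.add hai hc).div_const δ
  refine hdom.mono' hpm.aestronglyMeasurable ?_
  filter_upwards [ha, hsub, hVK, hVM] with x h1 h2 h3 h4
  have h0 : ∀ ξ ∈ Metric.ball (0 : RN N) K, 0 ≤ f x ξ := fun ξ hξ => (h1 ξ hξ).1
  have hb0 := bipolar_nonneg h0 h3
  rw [le_div_iff₀ hδ]
  by_cases hpx : p x = 0
  · rw [hpx, norm_zero, zero_mul]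
    have := h1 _ h3
    linarith
  have hpn : 0 < ‖p x‖ := norm_pos_iff.2 hpx
  set ξ := V x + (δ / ‖p x‖) • p x with hξ
  have hξK : ξ ∈ Metric.ball (0 : RN N) K := by
    rw [mem_ball_zero_iff]
    refine (norm_add_le _ _).trans_lt ?_
    rw [norm_smul, Real.norm_of_nonneg (by positivity), div_mul_cancel₀ _ hpn.ne']
    linarith
  have h5 := h2 ξ hξK
  have h6 := (h1 ξ hξK).2
  have h7 : inner ℝ (p x) (ξ - V x) = ‖p x‖ * δ := by
    rw [hξ, add_sub_cancel_left, real_inner_smul_right, real_inner_self_eq_norm_sq]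
    field_simp
  linarith

end MeasurableSelection

/-! ### Covering by balls on which the integrand can be relaxed. -/

section Approximation

variable {N : ℕ}

/-- Besicovitch covering gives countably many disjoint closed balls covering `S` up to a null set.
Their total volume is finite since they lie in `Ω`, so the tail can be dropped; spheres are null, so
open balls suffice. -/
theorem exists_finite_disjoint_balls {Ω S T : Set (RN N)} (hΩ : volume Ω ≠ ⊤)
    (hTS : volume (T \ S) = 0) {P : RN N → ℝ → Prop}
    (hP : ∀ x ∈ S, ∀ᶠ r in 𝓝[>] (0 : ℝ), P x r)
    (hPΩ : ∀ x r, P x r → Metric.closedBall x r ⊆ Ω) {η : ℝ≥0∞} (hη : 0 < η) :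
    ∃ (s : Finset (RN N)) (r : RN N → ℝ), (∀ x ∈ s, P x (r x)) ∧
      (s : Set (RN N)).PairwiseDisjoint (fun x => Metric.ball x (r x)) ∧
      volume (T \ ⋃ x ∈ s, Metric.ball x (r x)) < η := by
  classical
  obtain ⟨t, r, htc, htS, htr, htn, htd⟩ := Besicovitch.exists_disjoint_closedBall_covering_ae
    volume (fun x => {r | P x r}) S (fun x hx δ hδ => by
      obtain ⟨r, hr1, hr2⟩ := ((hP x hx).and (Ioo_mem_nhdsGT hδ)).exists
      exact ⟨r, hr1, hr2⟩) (fun _ => 1) (fun _ _ => one_pos)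
  have : Countable t := htc
  have hd' : Pairwise (Function.onFun Disjoint fun x : t => Metric.closedBall (x : RN N) (r x)) :=
    fun x y hxy => htd x.2 y.2 fun h => hxy (Subtype.ext h)
  have hsum : ∑' x : t, volume (Metric.closedBall (x : RN N) (r x)) ≠ ⊤ := by
    rw [← measure_iUnion hd' fun x => measurableSet_closedBall]
    exact ((measure_mono (iUnion_subset fun x : t => hPΩ _ _ (htr x x.2).1)).trans_lt hΩ.lt_top).ne
  obtain ⟨s, hs⟩ := ((ENNReal.tendsto_tsum_compl_atTop_zero hsum).eventually
    (gt_mem_nhds hη)).exists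
  refine ⟨s.image Subtype.val, r, ?_, ?_, ?_⟩
  · intro x hx
    obtain ⟨y, -, rfl⟩ := Finset.mem_image.1 hx
    exact (htr y y.2).1
  · intro x hx y hy hxy
    obtain ⟨x, -, rfl⟩ := Finset.mem_image.1 hx
    obtain ⟨y, -, rfl⟩ := Finset.mem_image.1 hy
    exact (htd x.2 y.2 hxy).mono Metric.ball_subset_closedBall Metric.ball_subset_closedBall
  · have hsub : T \ ⋃ x ∈ s.image Subtype.val, Metric.ball x (r x) ⊆
        ((T \ S) ∪ (S \ ⋃ x ∈ t, Metric.closedBall x (r x)) ∪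
          ⋃ x : t, Metric.sphere (x : RN N) (r x)) ∪
        ⋃ x : {x : t // x ∉ s}, Metric.closedBall (x : RN N) (r x) := by
      intro x hx
      by_cases hxS : x ∈ S
      swap
      · exact Or.inl (Or.inl (Or.inl ⟨hx.1, hxS⟩))
      by_cases hxt : x ∈ ⋃ x ∈ t, Metric.closedBall x (r x)
      swap
      · exact Or.inl (Or.inl (Or.inr ⟨hxS, hxt⟩))
      obtain ⟨y, hy, hxy⟩ := mem_iUnion₂.1 hxt
      by_cases hys : (⟨y, hy⟩ : t) ∈ s
      · refine Or.inl (Or.inr (mem_iUnion.2 ⟨⟨y, hy⟩, ?_⟩))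
        rcases (Metric.mem_closedBall.1 hxy).lt_or_eq with h | h
        · exact absurd (mem_iUnion₂.2 ⟨y, Finset.mem_image.2 ⟨_, hys, rfl⟩, h⟩) hx.2
        · exact h
      · exact Or.inr (mem_iUnion.2 ⟨⟨⟨y, hy⟩, hys⟩, hxy⟩)
    refine (measure_mono hsub).trans_lt ((measure_union_le _ _).trans_lt ?_)
    have h0 : volume ((T \ S) ∪ (S \ ⋃ x ∈ t, Metric.closedBall x (r x)) ∪
          ⋃ x : t, Metric.sphere (x : RN N) (r x)) = 0 :=
      measure_union_null (measure_union_null hTS htn)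
        (measure_iUnion_null fun x => Measure.addHaar_sphere_of_ne_zero _ _ (htr x x.2).2.1.ne')
    rw [h0, zero_add]
    exact (measure_iUnion_le _).trans_lt hs

theorem exists_small_setIntegral {Ω : Set (RN N)} {a : RN N → ℝ} (ha : IntegrableOn a Ω)
    {ε : ℝ} (hε : 0 < ε) :
    ∃ δ : ℝ≥0∞, 0 < δ ∧ ∀ s ⊆ Ω, volume s < δ → ∫ x in s, a x ≤ ε := by
  obtain ⟨δ, hδ, h⟩ := exists_pos_setLIntegral_lt_of_measure_lt (μ := volume.restrict Ω)
    (f := fun x => ‖a x‖ₑ) ha.2.ne (ENNReal.ofReal_pos.2 hε).ne'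
  refine ⟨δ, hδ, fun s hs hsδ => ?_⟩
  have h1 := h s ((Measure.restrict_apply_le _ _).trans_lt hsδ)
  rw [Measure.restrict_restrict_of_subset hs] at h1
  refine (Real.le_norm_self _).trans ((norm_integral_le_lintegral_norm _).trans ?_)
  simp only [ofReal_norm]
  exact ENNReal.toReal_le_of_le_ofReal hε.le h1.le

theorem polar_congr {B : Set (RN N)} {φ χ : RN N → ℝ} (h : ∀ ξ ∈ B, φ ξ = χ ξ) (p : RN N) :
    polar B φ p = polar B χ p := by
  rw [polar, polar, image_congr fun η hη => by rw [h η hη]]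

theorem bipolar_congr {B : Set (RN N)} {φ χ : RN N → ℝ} (h : ∀ ξ ∈ B, φ ξ = χ ξ) (ξ : RN N) :
    bipolar B φ ξ = bipolar B χ ξ := by
  simp only [bipolar, polar_congr h]

theorem setIntegral_le_of_lebesguePoint {β : RN N → ℝ} {x : RN N}
    (h : Tendsto (fun r => ⨍ y in Metric.closedBall x r, β y) (𝓝[>] 0) (𝓝 (β x))) {ε : ℝ}
    (hε : 0 < ε) :
    ∀ᶠ r in 𝓝[>] (0 : ℝ), β x * volume.real (Metric.ball x r) ≤
      (∫ y in Metric.ball x r, β y) + ε * volume.real (Metric.ball x r) := by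
  have h1 : ∀ᶠ r in 𝓝[>] (0 : ℝ), β x - ε < ⨍ y in Metric.closedBall x r, β y :=
    h.eventually_const_lt (by linarith)
  filter_upwards [h1, self_mem_nhdsWithin] with r hr hr0
  have hr0 : 0 < r := hr0
  -- The averages come on closed balls, while the perturbations live on open ones.
  have hae : Metric.closedBall x r =ᵐ[volume] Metric.ball x r := by
    refine (ae_eq_set.2 ⟨?_, ?_⟩)
    · rw [Metric.closedBall_sdiff_ball]
      exact Measure.addHaar_sphere_of_ne_zero _ _ hr0.ne'
    · rw [sdiff_eq_empty.2 Metric.ball_subset_closedBall, measure_empty]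
  rw [setAverage_congr hae, setAverage_eq, smul_eq_mul] at hr
  have hpos : 0 < volume.real (Metric.ball x r) :=
    ENNReal.toReal_pos (Metric.measure_ball_pos _ _ hr0).ne' measure_ball_lt_top.ne
  rw [inv_mul_eq_div, lt_div_iff₀ hpos] at hr
  linarith

/-- A ball in `Ω` on which `f` can be relaxed along the gradient field `V` with error `t`. -/
def IsRelaxationBall (Ω T : Set (RN N)) (K : ℝ) (f : RN N → RN N → ℝ) (V : RN N → RN N) (ε t : ℝ)
    (x₀ : RN N) (r : ℝ) : Prop :=
  Metric.closedBall x₀ r ⊆ Ω ∧ ∃ ψ : RN N → ℝ, IsLipTest (Metric.ball x₀ r) ψ ∧ (∀ x, |ψ x| ≤ ε) ∧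
    (∃ K' < K, ∀ᵐ x, x ∈ Metric.ball x₀ r → ‖V x + gradient ψ x‖ ≤ K') ∧
    ∫ x in Metric.ball x₀ r ∩ T, f x (V x + gradient ψ x) ≤
      (∫ x in Metric.ball x₀ r, bipolar (Metric.ball 0 K) (f x) (V x)) +
        t * volume.real (Metric.ball x₀ r)

/-- The integrand is frozen at `x₀` and relaxed by `exists_ball_perturbation`. The error `t` splits
into four quarters: the gap to the bipolar, the lamination on the ball, the oscillation of `f` in
`x` on `T`, and the Lebesgue point approximation. -/
theorem eventually_isRelaxationBall (hN : 0 < N) {Ω T : Set (RN N)} (hΩ : IsOpen Ω) (hTΩ : T ⊆ Ω)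
    (hTc : IsCompact T) {K : ℝ} {f : RN N → RN N → ℝ} (hf : IsAdmissibleLagrangian Ω K f)
    (hT : ∀ x ∈ T, ∀ ε : ℝ, 0 < ε → ∃ η : ℝ, 0 < η ∧ ∀ y ∈ T, dist y x < η →
      ∀ ξ ∈ Metric.ball (0 : RN N) K, |f y ξ - f x ξ| < ε)
    {V : RN N → RN N} {M : ℝ≥0} (hMK : (M : ℝ) < K) {x₀ : RN N}
    (hx₀ : x₀ ∈ T) {a : ℝ} (hfa : ∀ ξ ∈ Metric.ball (0 : RN N) K, 0 ≤ f x₀ ξ ∧ f x₀ ξ ≤ a)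
    {g : RN N × RN N → ℝ} (hg : Measurable g)
    (hfg : ∀ ξ ∈ Metric.ball (0 : RN N) K, f x₀ ξ = g (x₀, ξ))
    {w : RN N → ℝ} (hw : LipschitzWith M w) (hwd : DifferentiableAt ℝ w x₀)
    (hwV : gradient w x₀ = V x₀) {R : ℝ} (hR : 0 < R)
    (hwR : ∀ᵐ x, x ∈ Metric.ball x₀ R → gradient w x = V x)
    (hleb : Tendsto (fun r => ⨍ y in Metric.closedBall x₀ r,
      Ω.indicator (fun x => bipolar (Metric.ball 0 K) (f x) (V x)) y) (𝓝[>] 0)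
      (𝓝 (Ω.indicator (fun x => bipolar (Metric.ball 0 K) (f x) (V x)) x₀))) {ε t : ℝ}
    (hε : 0 < ε) (ht : 0 < t) :
    ∀ᶠ r in 𝓝[>] (0 : ℝ), IsRelaxationBall Ω T K f V ε t x₀ r := by
  have hK : 0 < K := M.2.trans_lt hMK
  set B := Metric.ball (0 : RN N) K with hB
  -- Extension by zero makes the frozen integrand Borel and bounded everywhere. It is harmless
  -- because the perturbed gradients remain in the ball almost everywhere.
  set φ : RN N → ℝ := B.indicator fun ξ => g (x₀, ξ) with hφdef
  have hφB : ∀ ξ ∈ B, φ ξ = f x₀ ξ := fun ξ hξ => by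
    rw [hφdef, indicator_of_mem hξ, hfg ξ hξ]
  have hφm : Measurable φ :=
    (hg.comp measurable_prodMk_left).indicator measurableSet_ball
  have ha0 : 0 ≤ a := by
    have := hfa 0 (Metric.mem_ball_self hK)
    linarith
  have hφ0 : ∀ ξ, 0 ≤ φ ξ := fun ξ => by
    by_cases hξ : ξ ∈ B
    · rw [hφB ξ hξ]
      exact (hfa ξ hξ).1
    · rw [hφdef, indicator_of_notMem hξ]
  have hφa : ∀ ξ, φ ξ ≤ a := fun ξ => by
    by_cases hξ : ξ ∈ B
    · rw [hφB ξ hξ]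
      exact (hfa ξ hξ).2
    · rw [hφdef, indicator_of_notMem hξ]
      exact ha0
  have hξ : ‖V x₀‖ < K := by
    rw [← hwV]
    exact (hw.norm_gradient_le x₀).trans_lt hMK
  have hlam := laminable_bipolar hN hφm hφ0 hφa hξ (show 0 < t / 4 by positivity)
  have hbb : bipolar B φ (V x₀) = bipolar B (f x₀) (V x₀) := bipolar_congr hφB _
  rw [hbb, ← hwV] at hlam
  have hb0 : 0 ≤ bipolar B (f x₀) (V x₀) :=
    bipolar_nonneg (fun ξ hξ => (hfa ξ hξ).1) (by simpa using hξ)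
  rw [← hwV] at hb0
  have hball := exists_ball_perturbation hN hφm hφ0 hφa hw hMK hwd
    (add_nonneg hb0 (by positivity)) hlam (show 0 < min ε (t / 4) by positivity)
  obtain ⟨η, hη, hηT⟩ := hT x₀ hx₀ (t / 4) (by positivity)
  obtain ⟨ρ, hρ, hρΩ⟩ := Metric.isOpen_iff.1 hΩ x₀ (hTΩ hx₀)
  have hr : ∀ᶠ r in 𝓝[>] (0 : ℝ), r ∈ Ioo 0 (min R (min η ρ)) :=
    Ioo_mem_nhdsGT (lt_min hR (lt_min hη hρ))
  filter_upwards [hball, hr, setIntegral_le_of_lebesguePoint hleb (show 0 < t / 4 by positivity)]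
    with r h1 h2 h3
  have hrR : r < R := h2.2.trans_le (min_le_left _ _)
  have hrη : r < η := h2.2.trans_le ((min_le_right _ _).trans (min_le_left _ _))
  have hrρ : r < ρ := h2.2.trans_le ((min_le_right _ _).trans (min_le_right _ _))
  have hcl : Metric.closedBall x₀ r ⊆ Ω := (Metric.closedBall_subset_ball hrρ).trans hρΩ
  have hballΩ : Metric.ball x₀ r ⊆ Ω := Metric.ball_subset_closedBall.trans hcl
  obtain ⟨ψ, hψ, hψε, ⟨K', hK', hψK⟩, hψi⟩ := h1
  have hgr : ∀ᵐ x, x ∈ Metric.ball x₀ r → gradient w x + gradient ψ x = V x + gradient ψ x := by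
    filter_upwards [hwR] with x hx hxr
    rw [hx (Metric.ball_subset_ball hrR.le hxr)]
  have hVK : ∀ᵐ x, x ∈ Metric.ball x₀ r → ‖V x + gradient ψ x‖ ≤ K' := by
    filter_upwards [hgr, hψK] with x q1 q2 hxr
    rw [← q1 hxr]
    exact q2 hxr
  refine ⟨hcl, ψ, hψ, fun x => (hψε x).trans (min_le_left _ _), ⟨K', hK', hVK⟩, ?_⟩
  have hvf : volume (Metric.ball x₀ r) ≠ ⊤ := measure_ball_lt_top.ne
  have hvf' : volume (Metric.ball x₀ r ∩ T) ≠ ⊤ :=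
    ((measure_mono inter_subset_left).trans_lt hvf.lt_top).ne
  have hmT : MeasurableSet (Metric.ball x₀ r ∩ T) := measurableSet_ball.inter hTc.measurableSet
  have hφi : IntegrableOn (fun x => φ (gradient w x + gradient ψ x)) (Metric.ball x₀ r) :=
    integrableOn_comp_of_bdd hφm hφ0 hφa
      ((measurable_gradient w).add (measurable_gradient ψ)) hvf
  have s1 : ∫ x in Metric.ball x₀ r ∩ T, f x (V x + gradient ψ x) ≤
      ∫ x in Metric.ball x₀ r ∩ T, (φ (gradient w x + gradient ψ x) + t / 4) := by
    -- Nonnegativity of the left integrand replaces its integrability, which is not needed here.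
    refine integral_mono_of_nonneg ?_
      ((hφi.mono_set inter_subset_left).add (integrableOn_const hvf')) ?_
    · obtain ⟨b, -, hb⟩ := hf.bound
      have hb' := (ae_restrict_iff' hΩ.measurableSet).1 hb
      rw [EventuallyLE, ae_restrict_iff' hmT]
      filter_upwards [hb', hVK] with x q1 q2 hx
      refine (q1 (hTΩ hx.2) _ ?_).1
      rw [mem_ball_zero_iff]
      exact (q2 hx.1).trans_lt hK'
    · rw [EventuallyLE, ae_restrict_iff' hmT]
      filter_upwards [hVK, hgr] with x q1 q2 hx
      have hxB : V x + gradient ψ x ∈ B := by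
        rw [hB, mem_ball_zero_iff]
        exact (q1 hx.1).trans_lt hK'
      rw [q2 hx.1, hφB _ hxB]
      have := (abs_lt.1 (hηT x hx.2 (lt_trans hx.1 hrη) _ hxB)).2
      linarith
  have s2 : ∫ x in Metric.ball x₀ r ∩ T, (φ (gradient w x + gradient ψ x) + t / 4) ≤
      (∫ x in Metric.ball x₀ r, φ (gradient w x + gradient ψ x)) +
        t / 4 * volume.real (Metric.ball x₀ r) := by
    rw [integral_add (hφi.mono_set inter_subset_left) (integrableOn_const hvf'),
      setIntegral_const, smul_eq_mul, mul_comm]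
    refine add_le_add (setIntegral_mono_set hφi (Eventually.of_forall fun x => hφ0 _)
      inter_subset_left.eventuallyLE) ?_
    exact mul_le_mul_of_nonneg_left (measureReal_mono inter_subset_left hvf) (by positivity)
  have s3 : ∫ y in Metric.ball x₀ r,
      Ω.indicator (fun x => bipolar B (f x) (V x)) y =
      ∫ y in Metric.ball x₀ r, bipolar B (f y) (V y) :=
    setIntegral_congr_fun measurableSet_ball fun y hy => indicator_of_mem (hballΩ hy) _
  rw [s3, indicator_of_mem (hTΩ hx₀)] at h3
  rw [hwV] at hψi
  have s4 : min ε (t / 4) * volume.real (Metric.ball x₀ r) ≤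
      t / 4 * volume.real (Metric.ball x₀ r) :=
    mul_le_mul_of_nonneg_right (min_le_right _ _) measureReal_nonneg
  linarith

end Approximation

/-! ### Perturbation of `u` on the whole of `Ω`. -/

section Relaxation

variable {N : ℕ}

/-- Relaxation balls are summed over a finite disjoint family. The energy outside the balls or
outside the Lusin set is bounded by the integral of `a` over a set of small measure. -/
theorem exists_perturbation (hN : 0 < N) {Ω : Set (RN N)} (hΩ : IsOpen Ω)
    (hb : Bornology.IsBounded Ω) {K : ℝ} {f : RN N → RN N → ℝ} (hf : IsAdmissibleLagrangian Ω K f)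
    (u : W1Inf Ω) (hu : ‖sobGrad u‖ < K) {ε : ℝ} (hε : 0 < ε) :
    ∃ ψ : RN N → ℝ, IsLipTest Ω ψ ∧ (∀ x, |ψ x| ≤ ε) ∧
      (∃ K' < K, ∀ᵐ x ∂(lebOn Ω), ‖sobGrad u x + gradient ψ x‖ ≤ K') ∧
      ∫ x in Ω, f x (sobGrad u x + gradient ψ x) ≤
        (∫ x in Ω, bipolar (Metric.ball 0 K) (f x) (sobGrad u x)) + ε := by
  classical
  have hK : 0 < K := (norm_nonneg _).trans_lt hu
  have hΩf : volume Ω ≠ ⊤ := hb.measure_lt_top.ne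
  set V : RN N → RN N := ⇑(sobGrad u) with hVdef
  have hVm : AEMeasurable V (lebOn Ω) := (Lp.aestronglyMeasurable (sobGrad u)).aemeasurable
  have hVM : ∀ᵐ x ∂(lebOn Ω), ‖V x‖ ≤ ‖sobGrad u‖ := ae_norm_sobGrad_le u
  have hVK : ∀ᵐ x ∂(lebOn Ω), V x ∈ Metric.ball (0 : RN N) K := by
    filter_upwards [hVM] with x hx
    rw [mem_ball_zero_iff]
    exact hx.trans_lt hu
  have hβi : IntegrableOn (fun x => bipolar (Metric.ball 0 K) (f x) (V x)) Ω :=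
    hf.integrable_bipolar hΩ.measurableSet hK hVm hVK
  obtain ⟨a, hai, ha⟩ := hf.bound
  obtain ⟨g, hg, hfg⟩ := hf.borel
  set t := ε / (2 * (volume.real Ω + 1)) with htdef
  have hvol0 : 0 ≤ volume.real Ω := measureReal_nonneg
  have ht : 0 < t := by positivity
  obtain ⟨δ₀, hδ₀, hδa⟩ := exists_small_setIntegral hai (show 0 < ε / 2 by positivity)
  -- Two sets of measure below `δ` are discarded: the complement of the Lusin set and the part of it
  -- missed by the balls.
  obtain ⟨δ, hδ, hδδ⟩ : ∃ δ : ℝ, 0 < δ ∧ ENNReal.ofReal δ + ENNReal.ofReal δ ≤ δ₀ := by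
    rcases eq_or_ne δ₀ ⊤ with h | h
    · exact ⟨1, one_pos, by simp [h]⟩
    · have hpos := ENNReal.toReal_pos hδ₀.ne' h
      refine ⟨δ₀.toReal / 2, by positivity, ?_⟩
      rw [← ENNReal.ofReal_add (by positivity) (by positivity), add_halves, ENNReal.ofReal_toReal h]
  obtain ⟨T, hTΩ, hTc, hTδ, hT⟩ := hf.lusin δ hδ
  have hleb : ∀ᵐ x, Tendsto (fun r => ⨍ y in Metric.closedBall x r,
      Ω.indicator (fun x => bipolar (Metric.ball 0 K) (f x) (V x)) y) (𝓝[>] 0)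
      (𝓝 (Ω.indicator (fun x => bipolar (Metric.ball 0 K) (f x) (V x)) x)) := by
    filter_upwards [(Besicovitch.vitaliFamily (volume : Measure (RN N))).ae_tendsto_average
      (hβi.integrable_indicator hΩ.measurableSet).locallyIntegrable] with x hx
    exact hx.comp (Besicovitch.tendsto_filterAt volume x)
  have hgood : ∀ᵐ x ∂(lebOn Ω), x ∈ T →
      ∀ᶠ r in 𝓝[>] (0 : ℝ), IsRelaxationBall Ω T K f V ε t x r := by
    filter_upwards [ha, hfg, ae_restrict_of_ae hleb, ae_exists_lipschitz_representative hΩ hb u]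
      with x h1 h2 h3 h4 hxT
    obtain ⟨w, hw, hwd, hwV, R, hR, hwR⟩ := h4
    exact eventually_isRelaxationBall hN hΩ hTΩ hTc hf hT hu hxT h1 hg h2 hw hwd hwV hR hwR h3 hε ht
  set S := {x | ∀ᶠ r in 𝓝[>] (0 : ℝ), IsRelaxationBall Ω T K f V ε t x r} with hS
  have hTS : volume (T \ S) = 0 := by
    have h1 := (ae_restrict_iff' hΩ.measurableSet).1 hgood
    rw [ae_iff] at h1
    refine measure_mono_null (fun x hx => ?_) h1
    simp only [mem_ofPred_eq, Classical.not_imp]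
    exact ⟨hTΩ hx.1, hx.1, hx.2⟩
  obtain ⟨s, r, hsr, hsd, hsT⟩ := exists_finite_disjoint_balls hΩf hTS
    (P := IsRelaxationBall Ω T K f V ε t) (fun x hx => hx) (fun x r h => h.1)
    (ENNReal.ofReal_pos.2 hδ)
  choose! ψ hψ hψε hψK hψi using fun x (hx : x ∈ s) => (hsr x hx).2
  choose! k hkK hkb using hψK
  have hballΩ : ∀ x ∈ s, Metric.ball x (r x) ⊆ Ω := fun x hx =>
    Metric.ball_subset_closedBall.trans (hsr x hx).1
  set Ψ : RN N → ℝ := fun y => ∑ x ∈ s, ψ x y with hΨ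
  have hΨg : ∀ x ∈ s, ∀ y ∈ Metric.ball x (r x), gradient Ψ y = gradient (ψ x) y :=
    fun x hx y hy => gradient_sum_eq_of_mem hψ hsd (fun _ _ => Metric.isOpen_ball) hx hy
  have hΨt : IsLipTest (⋃ x ∈ s, Metric.ball x (r x)) Ψ :=
    IsLipTest.sum s fun x hx => (hψ x hx).mono
      (subset_biUnion_of_mem (u := fun x => Metric.ball x (r x)) hx)
  have hsub : (⋃ x ∈ s, Metric.ball x (r x)) ⊆ Ω := iUnion₂_subset hballΩ
  have hbd : ∃ K' < K, ∀ᵐ y ∂(lebOn Ω), ‖V y + gradient Ψ y‖ ≤ K' := by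
    -- Finiteness of the family is essential here: a maximum of finitely many bounds below `K` is
    -- still below `K`. The inserted norm handles points outside the balls.
    refine ⟨(insert ‖sobGrad u‖ (s.image k)).max' (Finset.insert_nonempty _ _), ?_, ?_⟩
    · rw [Finset.max'_lt_iff]
      intro c hc
      rcases Finset.mem_insert.1 hc with rfl | hc
      · exact hu
      · obtain ⟨x, hx, rfl⟩ := Finset.mem_image.1 hc
        exact hkK x hx
    · have h1 : ∀ᵐ y, ∀ x ∈ s, y ∈ Metric.ball x (r x) → ‖V y + gradient (ψ x) y‖ ≤ k x :=
        (ae_ball_iff s.countable_toSet).2 hkb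
      filter_upwards [ae_restrict_of_ae h1, hVM] with y h2 h3
      by_cases hy : y ∈ ⋃ x ∈ s, Metric.ball x (r x)
      · obtain ⟨x, hx, hyx⟩ := mem_iUnion₂.1 hy
        rw [hΨg x hx y hyx]
        exact (h2 x hx hyx).trans (Finset.le_max' _ _
          (Finset.mem_insert_of_mem (Finset.mem_image_of_mem k hx)))
      · rw [hΨt.gradient_eq_zero hy, add_zero]
        exact h3.trans (Finset.le_max' _ _ (Finset.mem_insert_self _ _))
  refine ⟨Ψ, hΨt.mono hsub, abs_sum_le_of_pairwiseDisjoint hψ hsd hε.le hψε, hbd, ?_⟩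
  obtain ⟨K', hK'K, hK'⟩ := hbd
  have hWK : ∀ᵐ y ∂(lebOn Ω), V y + gradient Ψ y ∈ Metric.ball (0 : RN N) K := by
    filter_upwards [hK'] with y hy
    rw [mem_ball_zero_iff]
    exact hy.trans_lt hK'K
  have hfi : IntegrableOn (fun y => f y (V y + gradient Ψ y)) Ω :=
    hf.integrable_comp (hVm.add (measurable_gradient Ψ).aemeasurable) hWK
  set Q := ⋃ x ∈ s, Metric.ball x (r x) ∩ T with hQ
  have hQm : MeasurableSet Q :=
    s.measurableSet_biUnion fun x _ => measurableSet_ball.inter hTc.measurableSet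
  have hQΩ : Q ⊆ Ω := iUnion₂_subset fun x hx => inter_subset_left.trans (hballΩ x hx)
  rw [← integral_inter_add_sdiff hQm hfi, inter_eq_self_of_subset_right hQΩ]
  have hrest : ∫ y in Ω \ Q, f y (V y + gradient Ψ y) ≤ ε / 2 := by
    refine le_trans (setIntegral_mono_on_ae (hfi.mono_set sdiff_subset) (hai.mono_set sdiff_subset)
      (hΩ.measurableSet.diff hQm) ?_) (hδa _ sdiff_subset ?_)
    · have h1 := (ae_restrict_iff' hΩ.measurableSet).1 ha
      have h2 := (ae_restrict_iff' hΩ.measurableSet).1 hWK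
      filter_upwards [h1, h2] with y q1 q2 hy
      exact (q1 hy.1 _ (q2 hy.1)).2
    · have h1 : Ω \ Q ⊆ (Ω \ T) ∪ (T \ ⋃ x ∈ s, Metric.ball x (r x)) := by
        intro y hy
        by_cases hyT : y ∈ T
        · refine Or.inr ⟨hyT, fun h => hy.2 ?_⟩
          obtain ⟨x, hx, hyx⟩ := mem_iUnion₂.1 h
          exact mem_iUnion₂.2 ⟨x, hx, hyx, hyT⟩
        · exact Or.inl ⟨hy.1, hyT⟩
      exact (measure_mono h1).trans_lt ((measure_union_le _ _).trans_lt
        ((ENNReal.add_lt_add hTδ hsT).trans_le hδδ))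
  have hpart : ∫ y in Q, f y (V y + gradient Ψ y) ≤
      (∫ x in Ω, bipolar (Metric.ball 0 K) (f x) (V x)) + t * volume.real Ω := by
    have hd1 : (s : Set (RN N)).Pairwise
        (Function.onFun Disjoint fun x => Metric.ball x (r x) ∩ T) := fun x hx y hy hxy =>
      (hsd hx hy hxy).mono inter_subset_left inter_subset_left
    rw [hQ, integral_biUnion_finset s (fun x _ => measurableSet_ball.inter hTc.measurableSet) hd1
      fun x hx => hfi.mono_set (inter_subset_left.trans (hballΩ x hx))]
    have h1 : ∀ x ∈ s, ∫ y in Metric.ball x (r x) ∩ T, f y (V y + gradient Ψ y) ≤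
        (∫ y in Metric.ball x (r x), bipolar (Metric.ball 0 K) (f y) (V y)) +
          t * volume.real (Metric.ball x (r x)) := by
      intro x hx
      refine le_of_eq_of_le ?_ (hψi x hx)
      exact setIntegral_congr_fun (measurableSet_ball.inter hTc.measurableSet) fun y hy => by
        simp only [hΨg x hx y hy.1]
    refine (Finset.sum_le_sum h1).trans ?_
    rw [Finset.sum_add_distrib, ← Finset.mul_sum,
      ← integral_biUnion_finset s (fun x _ => measurableSet_ball) hsd
        fun x hx => hβi.mono_set (hballΩ x hx),
      ← measureReal_biUnion_finset hsd (fun x _ => measurableSet_ball)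
        (fun x _ => measure_ball_lt_top.ne)]
    refine add_le_add (setIntegral_mono_set hβi ?_ hsub.eventuallyLE)
      (mul_le_mul_of_nonneg_left (measureReal_mono hsub hΩf) ht.le)
    filter_upwards [ha, hVK] with y q1 q2
    exact bipolar_nonneg (fun ξ hξ => (q1 ξ hξ).1) q2
  have hfin : t * volume.real Ω ≤ ε / 2 := by
    rw [htdef, div_mul_eq_mul_div, div_le_iff₀ (by positivity)]
    nlinarith
  linarith

end Relaxation

/-! ### Weak* continuous minorants, recovery sequences and semicontinuity. -/

section Envelopes

variable {N : ℕ}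

theorem Lp.norm_top_le_of_ae_bound {α E : Type*} [MeasurableSpace α] [NormedAddCommGroup E]
    {μ : Measure α} {h : Lp E ∞ μ} {C : ℝ} (hC : 0 ≤ C) (hh : ∀ᵐ x ∂μ, ‖h x‖ ≤ C) : ‖h‖ ≤ C := by
  rw [Lp.norm_def, eLpNorm_exponent_top]
  exact ENNReal.toReal_le_of_le_ofReal hC (eLpNormEssSup_le_of_ae_bound hh)

theorem integrable_inner_sobGrad {Ω : Set (RN N)} (w : W1Inf Ω) {p : RN N → RN N}
    (hp : Integrable p (lebOn Ω)) : Integrable (fun x => inner ℝ (sobGrad w x) (p x)) (lebOn Ω) := by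
  refine (hp.norm.const_mul ‖sobGrad w‖).mono'
    ((Lp.aestronglyMeasurable (sobGrad w)).inner hp.1) ?_
  filter_upwards [ae_norm_sobGrad_le w] with x hx
  exact (norm_inner_le_norm _ _).trans (by gcongr)

/-- Affine weak* continuous minorants of the functional. -/
theorem exists_affine_minorant {Ω : Set (RN N)} (hΩ : IsOpen Ω) (hb : Bornology.IsBounded Ω)
    {K : ℝ} {f : RN N → RN N → ℝ} (hf : IsAdmissibleLagrangian Ω K f)
    (u : W1Inf Ω) (hu : ‖sobGrad u‖ < K) {ε : ℝ} (hε : 0 < ε) :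
    ∃ h : Lp (RN N) 1 (lebOn Ω), ∀ w : W1Inf Ω,
      (∀ᵐ x ∂(lebOn Ω), sobGrad w x ∈ Metric.ball (0 : RN N) K) →
      (∫ x in Ω, bipolar (Metric.ball 0 K) (f x) (sobGrad u x)) - ε +
        ((∫ x in Ω, inner ℝ (sobGrad w x) (h x)) - ∫ x in Ω, inner ℝ (sobGrad u x) (h x)) ≤
      ∫ x in Ω, f x (sobGrad w x) := by
  have hK : 0 < K := (norm_nonneg _).trans_lt hu
  have hΩf : volume Ω ≠ ⊤ := hb.measure_lt_top.ne
  have hVm : AEMeasurable (sobGrad u) (lebOn Ω) :=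
    (Lp.aestronglyMeasurable (sobGrad u)).aemeasurable
  have hVK : ∀ᵐ x ∂(lebOn Ω), sobGrad u x ∈ Metric.ball (0 : RN N) K := by
    filter_upwards [ae_norm_sobGrad_le u] with x hx
    rw [mem_ball_zero_iff]
    exact hx.trans_lt hu
  -- A pointwise error `t` integrates to at most `ε`.
  set t := ε / (volume.real Ω + 1) with htdef
  have hvol0 : 0 ≤ volume.real Ω := measureReal_nonneg
  have ht : 0 < t := by positivity
  obtain ⟨p, hp, hpf⟩ := hf.exists_integrable_subgradient hΩ.measurableSet hΩf hK hVm hu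
    (ae_norm_sobGrad_le u) ht
  refine ⟨(memLp_one_iff_integrable.2 hp).toLp p, fun w hw => ?_⟩
  have hc : ∀ w : W1Inf Ω, ∫ x in Ω,
      inner ℝ (sobGrad w x) ((memLp_one_iff_integrable.2 hp).toLp p x) =
      ∫ x in Ω, inner ℝ (sobGrad w x) (p x) := fun w => by
    refine integral_congr_ae ?_
    filter_upwards [(memLp_one_iff_integrable.2 hp).coeFn_toLp] with x hx
    rw [hx]
  rw [hc, hc]
  have hβi : Integrable (fun x => bipolar (Metric.ball 0 K) (f x) (sobGrad u x)) (lebOn Ω) :=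
    hf.integrable_bipolar hΩ.measurableSet hK hVm hVK
  have hti : Integrable (fun _ : RN N => t) (lebOn Ω) := integrableOn_const hΩf
  have hfi := hf.integrable_comp (Lp.aestronglyMeasurable (sobGrad w)).aemeasurable hw
  have hiw := integrable_inner_sobGrad w hp
  have hiu := integrable_inner_sobGrad u hp
  have hβt : Integrable (fun x => bipolar (Metric.ball 0 K) (f x) (sobGrad u x) - t)
      (lebOn Ω) := hβi.sub hti
  have hwu : Integrable (fun x => inner ℝ (sobGrad w x) (p x) - inner ℝ (sobGrad u x) (p x))
      (lebOn Ω) := hiw.sub hiu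
  have h1 : ∫ x in Ω, ((bipolar (Metric.ball 0 K) (f x) (sobGrad u x) - t) +
      (inner ℝ (sobGrad w x) (p x) - inner ℝ (sobGrad u x) (p x))) ≤
      ∫ x in Ω, f x (sobGrad w x) := by
    refine integral_mono_ae (hβt.add hwu) hfi ?_
    filter_upwards [hpf, hw] with x q1 q2
    have := q1 _ q2
    rwa [inner_sub_right, real_inner_comm, real_inner_comm (sobGrad u x)] at this
  rw [integral_add hβt hwu, integral_sub hβi hti, integral_sub hiw hiu,
    setIntegral_const, smul_eq_mul] at h1
  have h2 : volume.real Ω * t ≤ ε := by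
    rw [htdef, mul_div_assoc', div_le_iff₀ (by positivity)]
    nlinarith
  linarith

/-- The values converge uniformly, which handles the first factor. For the gradients, `h` is
extended by zero and `tendsto_integral_inner_gradient` applies. -/
theorem tendsto_weakStar {Ω : Set (RN N)} (hΩ : MeasurableSet Ω) {u : W1Inf Ω} {v : ℕ → W1Inf Ω}
    {ψ : ℕ → RN N → ℝ} (hψ : ∀ n, IsLipTest Ω (ψ n)) {ε : ℕ → ℝ} (hψε : ∀ n x, |ψ n x| ≤ ε n)
    (hε : Tendsto ε atTop (𝓝 0)) {C : ℝ} (hC : ∀ n, ∀ᵐ x, ‖gradient (ψ n) x‖ ≤ C)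
    (hval : ∀ n, ∀ᵐ x ∂(lebOn Ω), sobVal (v n) x = sobVal u x + ψ n x)
    (hgrad : ∀ n, ∀ᵐ x ∂(lebOn Ω), sobGrad (v n) x = sobGrad u x + gradient (ψ n) x) :
    Tendsto v atTop (@nhds _ (weakStarTopology Ω) u) := by
  rw [nhds_induced, tendsto_comap_iff]
  refine Tendsto.prodMk_nhds ?_ ?_
  · refine tendsto_pi_nhds.2 fun g => ?_
    have hgi : Integrable g (lebOn Ω) := memLp_one_iff_integrable.1 (Lp.memLp g)
    have hui : Integrable (fun x => sobVal u x * g x) (lebOn Ω) :=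
      hgi.mul_of_top_right (Lp.memLp (sobVal u))
    have hψi : ∀ n, Integrable (fun x => ψ n x * g x) (lebOn Ω) := fun n =>
      hgi.bdd_mul (c := ε n) (hψ n).continuous.aestronglyMeasurable
        (Eventually.of_forall (hψε n))
    have heq : ∀ n, ∫ x in Ω, sobVal (v n) x * g x =
        (∫ x in Ω, sobVal u x * g x) + ∫ x in Ω, ψ n x * g x := fun n => by
      rw [← integral_add hui (hψi n)]
      refine integral_congr_ae ?_
      filter_upwards [hval n] with x hx
      rw [hx, add_mul]
    have hlim : Tendsto (fun n => ∫ x in Ω, ψ n x * g x) atTop (𝓝 0) := by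
      refine squeeze_zero_norm (a := fun n => ε n * ∫ x in Ω, ‖g x‖) (fun n => ?_)
        (by simpa using hε.mul_const _)
      rw [← integral_const_mul]
      refine norm_integral_le_of_norm_le (hgi.norm.const_mul _) (Eventually.of_forall fun x => ?_)
      rw [norm_mul]
      gcongr
      exact hψε n x
    change Tendsto (fun n => ∫ x in Ω, sobVal (v n) x * g x) atTop (𝓝 _)
    simp only [heq]
    simpa using hlim.const_add (∫ x in Ω, sobVal u x * g x)
  · refine tendsto_pi_nhds.2 fun h => ?_
    have hhi : Integrable h (lebOn Ω) := memLp_one_iff_integrable.1 (Lp.memLp h)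
    have hlim := tendsto_integral_inner_gradient hψ hψε hε hC
      (IntegrableOn.integrable_indicator hhi hΩ)
    have hind : ∀ n, ∫ x, inner ℝ (gradient (ψ n) x) (Ω.indicator h x) =
        ∫ x in Ω, inner ℝ (gradient (ψ n) x) (h x) := fun n => by
      rw [← integral_indicator hΩ]
      refine integral_congr_ae (Eventually.of_forall fun x => ?_)
      by_cases hx : x ∈ Ω <;> simp [hx]
    simp only [hind] at hlim
    have hψi : ∀ n, Integrable (fun x => inner ℝ (gradient (ψ n) x) (h x)) (lebOn Ω) := fun n => by
      refine (hhi.norm.const_mul C).mono'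
        ((measurable_gradient _).aestronglyMeasurable.inner hhi.1) ?_
      filter_upwards [ae_restrict_of_ae (hC n)] with x hx
      exact (norm_inner_le_norm _ _).trans (by gcongr)
    have heq : ∀ n, ∫ x in Ω, inner ℝ (sobGrad (v n) x) (h x) =
        (∫ x in Ω, inner ℝ (sobGrad u x) (h x)) +
          ∫ x in Ω, inner ℝ (gradient (ψ n) x) (h x) := fun n => by
      rw [← integral_add (integrable_inner_sobGrad u hhi) (hψi n)]
      refine integral_congr_ae ?_
      filter_upwards [hgrad n] with x hx
      rw [hx, inner_add_left]
    change Tendsto (fun n => ∫ x in Ω, inner ℝ (sobGrad (v n) x) (h x)) atTop (𝓝 _)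
    simp only [heq]
    simpa using hlim.const_add (∫ x in Ω, inner ℝ (sobGrad u x) (h x))

/-- `exists_perturbation` bounds the energies from above by the relaxed energy plus `1 / (n + 1)`.
From below, an affine minorant at `u` combined with weak* convergence bounds their limit. -/
theorem exists_recovery_sequence (hN : 0 < N) {Ω : Set (RN N)} (hΩ : IsOpen Ω)
    (hb : Bornology.IsBounded Ω) {K : ℝ} {f : RN N → RN N → ℝ} (hf : IsAdmissibleLagrangian Ω K f)
    (u : W1Inf Ω) (hu : ‖sobGrad u‖ < K) :
    ∃ v : ℕ → W1Inf Ω, (∀ n, v n - u ∈ W01Inf Ω) ∧ (∀ n, ‖sobGrad (v n)‖ < K) ∧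
      Tendsto (fun n => ‖sobVal (v n) - sobVal u‖) atTop (𝓝 0) ∧
      (∀ n, Integrable (fun x => f x (sobGrad (v n) x)) (lebOn Ω)) ∧
      Tendsto (fun n => ∫ x in Ω, f x (sobGrad (v n) x)) atTop
        (𝓝 (∫ x in Ω, bipolar (Metric.ball 0 K) (f x) (sobGrad u x))) ∧
      Tendsto v atTop (@nhds _ (weakStarTopology Ω) u) := by
  have hK : 0 < K := (norm_nonneg _).trans_lt hu
  have hεpos : ∀ n : ℕ, (0 : ℝ) < 1 / ((n : ℝ) + 1) := fun n => by positivity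
  have hε0 := tendsto_one_div_add_atTop_nhds_zero_nat (𝕜 := ℝ)
  choose ψ hψ hψε hψK hψi using fun n : ℕ => exists_perturbation hN hΩ hb hf u hu (hεpos n)
  choose K' hK'K hK' using hψK
  choose w hw hwval hwgrad using fun n => (hψ n).exists_w1Inf hΩ hb
  have hval : ∀ n, ∀ᵐ x ∂(lebOn Ω), sobVal (u + w n) x = sobVal u x + ψ n x := fun n => by
    filter_upwards [Lp.coeFn_add (sobVal u) (sobVal (w n)), hwval n] with x h1 h2
    rw [← h2]
    exact h1
  have hgrad : ∀ n, ∀ᵐ x ∂(lebOn Ω), sobGrad (u + w n) x = sobGrad u x + gradient (ψ n) x :=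
    fun n => by
      filter_upwards [Lp.coeFn_add (sobGrad u) (sobGrad (w n)), hwgrad n] with x h1 h2
      rw [← h2]
      exact h1
  have hnorm : ∀ n, ‖sobGrad (u + w n)‖ < K := fun n => by
    -- An almost everywhere bound may be negative when `Ω` is null, hence the maximum with `0`.
    refine (Lp.norm_top_le_of_ae_bound (le_max_right (K' n) 0) ?_).trans_lt (max_lt (hK'K n) hK)
    filter_upwards [hgrad n, hK' n] with x h1 h2
    rw [h1]
    exact h2.trans (le_max_left _ _)
  have hmem : ∀ n, ∀ᵐ x ∂(lebOn Ω), sobGrad (u + w n) x ∈ Metric.ball (0 : RN N) K := fun n => by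
    filter_upwards [ae_norm_sobGrad_le (u + w n)] with x hx
    rw [mem_ball_zero_iff]
    exact hx.trans_lt (hnorm n)
  -- The gradient of `ψ n` is the difference of two fields of norm below `K` on `Ω` and vanishes
  -- outside.
  have hC : ∀ n, ∀ᵐ x, ‖gradient (ψ n) x‖ ≤ K + K := fun n => by
    have h1 := (ae_restrict_iff' hΩ.measurableSet).1 (hK' n)
    have h2 := (ae_restrict_iff' hΩ.measurableSet).1 (ae_norm_sobGrad_le u)
    filter_upwards [h1, h2] with x q1 q2
    by_cases hx : x ∈ Ω
    · have h3 := norm_sub_le (sobGrad u x + gradient (ψ n) x) (sobGrad u x)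
      rw [add_sub_cancel_left] at h3
      have := q1 hx
      have := q2 hx
      have := hK'K n
      linarith
    · rw [(hψ n).gradient_eq_zero hx, norm_zero]
      positivity
  have hweak : Tendsto (fun n => u + w n) atTop (@nhds _ (weakStarTopology Ω) u) :=
    tendsto_weakStar hΩ.measurableSet hψ hψε hε0 hC hval hgrad
  refine ⟨fun n => u + w n, fun n => ?_, hnorm, ?_, fun n =>
    hf.integrable_comp (Lp.aestronglyMeasurable _).aemeasurable (hmem n), ?_, hweak⟩
  · rw [add_sub_cancel_left]
    exact hw n
  · refine squeeze_zero (fun n => norm_nonneg _) (fun n => ?_) hε0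
    refine Lp.norm_top_le_of_ae_bound (hεpos n).le ?_
    filter_upwards [Lp.coeFn_sub (sobVal (u + w n)) (sobVal u), hval n] with x h1 h2
    rw [h1, Pi.sub_apply, h2, add_sub_cancel_left]
    exact hψε n x
  · have hup : ∀ n, ∫ x in Ω, f x (sobGrad (u + w n) x) ≤
        (∫ x in Ω, bipolar (Metric.ball 0 K) (f x) (sobGrad u x)) + 1 / ((n : ℝ) + 1) := fun n => by
      refine le_of_eq_of_le (integral_congr_ae ?_) (hψi n)
      filter_upwards [hgrad n] with x hx
      rw [hx]
    rw [Metric.tendsto_atTop']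
    intro η hη
    obtain ⟨h, hh⟩ := exists_affine_minorant hΩ hb hf u hu (show 0 < η / 2 by positivity)
    have hlim : Tendsto (fun n => ∫ x in Ω, inner ℝ (sobGrad (u + w n) x) (h x)) atTop
        (𝓝 (∫ x in Ω, inner ℝ (sobGrad u x) (h x))) := by
      rw [nhds_induced, tendsto_comap_iff] at hweak
      exact (tendsto_pi_nhds.1 ((continuous_snd.tendsto _).comp hweak)) h
    obtain ⟨n₁, hn₁⟩ := Metric.tendsto_atTop'.1 hlim (η / 2) (by positivity)
    obtain ⟨n₂, hn₂⟩ := Metric.tendsto_atTop'.1 hε0 η hη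
    refine ⟨max n₁ n₂, fun n hn => ?_⟩
    have h1 := hn₁ n ((le_max_left _ _).trans_lt hn)
    have h2 := hn₂ n ((le_max_right _ _).trans_lt hn)
    rw [Real.dist_eq, abs_lt] at h1 h2 ⊢
    have h3 := hh (u + w n) (hmem n)
    have h4 := hup n
    constructor <;> linarith [h1.1, h2.2]

theorem seqLSC_of_lowerSemicontinuous {X : Type*} (t : TopologicalSpace X) {G : X → EReal}
    (hG : @LowerSemicontinuous X EReal t _ G) : SeqLSC t G := fun s x hs =>
  (LowerSemicontinuous.le_liminf hG x).trans (liminf_le_liminf_of_le hs)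

theorem SeqLSC.le_of_tendsto {X : Type*} {t : TopologicalSpace X} {F G : X → EReal}
    (hG : SeqLSC t G) (hGF : ∀ y, G y ≤ F y) {s : ℕ → X} {x : X} {c : EReal}
    (hs : Tendsto s atTop (@nhds X t x)) (hF : Tendsto (fun n => F (s n)) atTop (𝓝 c)) :
    G x ≤ c :=
  (hG s x hs).trans ((liminf_le_liminf (Eventually.of_forall fun n => hGF (s n))).trans
    hF.liminf_eq.le)

theorem lowerSemicontinuous_affine {Ω : Set (RN N)} (h : Lp (RN N) 1 (lebOn Ω)) (c d : ℝ) :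
    @LowerSemicontinuous (W1Inf Ω) EReal (weakStarTopology Ω) _
      fun w => ((c + ((∫ x in Ω, inner ℝ (sobGrad w x) (h x)) - d) : ℝ) : EReal) := by
  let _ : TopologicalSpace (W1Inf Ω) := weakStarTopology Ω
  have h1 : Continuous fun w : W1Inf Ω =>
      ((fun g : Lp ℝ 1 (lebOn Ω) => ∫ x in Ω, sobVal w x * g x),
      (fun h : Lp (RN N) 1 (lebOn Ω) => ∫ x in Ω, inner ℝ (sobGrad w x) (h x))) :=
    continuous_induced_dom
  have h2 : Continuous fun w : W1Inf Ω => ∫ x in Ω, inner ℝ (sobGrad w x) (h x) :=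
    (continuous_apply h).comp (continuous_snd.comp h1)
  exact (continuous_coe_real_ereal.comp
    (continuous_const.add (h2.sub continuous_const))).lowerSemicontinuous

end Envelopes

/-! ### The relaxation theorem. -/

theorem theorem2p4 (N : ℕ) (hN : 0 < N) (Ω : Set (RN N)) (hΩ_open : IsOpen Ω)
    (hΩ_bdd : Bornology.IsBounded Ω) (hΩ_lip : IsLipschitzSet Ω) (K : ℕ) (hK : 0 < K)
    (f : RN N → RN N → ℝ) (hf : IsAdmissibleLagrangian Ω K f)
    (u : W1Inf Ω) (hu : ‖sobGrad u‖ < K) :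
    Integrable (fun x => bipolar (Metric.ball 0 K) (f x) (sobGrad u x)) (lebOn Ω) ∧
    (∃ v : ℕ → W1Inf Ω,
      (∀ n, v n - u ∈ W01Inf Ω) ∧
      (∀ n, ‖sobGrad (v n)‖ < K) ∧
      Tendsto (fun n => ‖sobVal (v n) - sobVal u‖) atTop (𝓝 0) ∧
      (∀ n, Integrable (fun x => f x (sobGrad (v n) x)) (lebOn Ω)) ∧
      Tendsto (fun n => ∫ x in Ω, f x (sobGrad (v n) x)) atTop
        (𝓝 (∫ x in Ω, bipolar (Metric.ball 0 K) (f x) (sobGrad u x)))) ∧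
    (∀ D : Set (W1Inf Ω), (∀ w, w - u ∈ W01Inf Ω → w ∈ D) →
      lscEnvelope (weakStarTopology Ω) (FInf Ω K f D) u =
        ((∫ x in Ω, bipolar (Metric.ball 0 K) (f x) (sobGrad u x) : ℝ) : EReal) ∧
      seqLscEnvelope (weakStarTopology Ω) (FInf Ω K f D) u =
        ((∫ x in Ω, bipolar (Metric.ball 0 K) (f x) (sobGrad u x) : ℝ) : EReal)) := by
  have hmem : ∀ w : W1Inf Ω, ‖sobGrad w‖ < K →
      ∀ᵐ x ∂(lebOn Ω), sobGrad w x ∈ Metric.ball (0 : RN N) K := fun w hw => by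
    filter_upwards [ae_norm_sobGrad_le w] with x hx
    rw [mem_ball_zero_iff]
    exact hx.trans_lt hw
  obtain ⟨v, hv0, hvK, hvu, hvi, hvlim, hvw⟩ :=
    exists_recovery_sequence hN hΩ_open hΩ_bdd hf u hu
  refine ⟨hf.integrable_bipolar hΩ_open.measurableSet (by exact_mod_cast hK)
    (Lp.aestronglyMeasurable (sobGrad u)).aemeasurable (hmem u hu),
    ⟨v, hv0, hvK, hvu, hvi, hvlim⟩, fun D hD => ?_⟩
  have hFlim : Tendsto (fun n => FInf Ω K f D (v n)) atTop
      (𝓝 ((∫ x in Ω, bipolar (Metric.ball 0 K) (f x) (sobGrad u x) : ℝ) : EReal)) := by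
    refine ((continuous_coe_real_ereal.tendsto _).comp hvlim).congr fun n => ?_
    rw [FInf, if_pos ⟨hD _ (hv0 n), hmem _ (hvK n)⟩]
    rfl
  -- The tolerance is taken to be the gap between the relaxed energy and `c`, so the affine minorant
  -- takes exactly the value `c` at `u`. Weak* semicontinuity of the relaxed functional itself is
  -- not needed.
  have hlow : ∀ c : ℝ, c < ∫ x in Ω, bipolar (Metric.ball 0 K) (f x) (sobGrad u x) →
      ∃ G : W1Inf Ω → EReal, (@LowerSemicontinuous _ EReal (weakStarTopology Ω) _ G) ∧
        (∀ w, G w ≤ FInf Ω K f D w) ∧ G u = c := by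
    intro c hc
    obtain ⟨h, hh⟩ := exists_affine_minorant hΩ_open hΩ_bdd hf u hu (sub_pos.2 hc)
    refine ⟨_, lowerSemicontinuous_affine h c (∫ x in Ω, inner ℝ (sobGrad u x) (h x)),
      fun w => ?_, by simp⟩
    rw [FInf]
    split_ifs with hw
    · have := hh w hw.2
      rw [sub_sub_cancel] at this
      exact EReal.coe_le_coe_iff.2 this
    · exact le_top
  constructor
  · refine le_antisymm (sSup_le ?_) (le_of_forall_lt fun c hc => ?_)
    · rintro _ ⟨G, hG, hGF, rfl⟩
      -- Any semicontinuous minorant is at most the limit of `F_∞` along the recovery sequence, so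
      -- sequential semicontinuity suffices and both envelopes are treated alike.
      exact (seqLSC_of_lowerSemicontinuous _ hG).le_of_tendsto hGF hvw hFlim
    · obtain ⟨q, hcq, hq⟩ := EReal.lt_iff_exists_real_btwn.1 hc
      obtain ⟨G, hG, hGF, hGu⟩ := hlow q (EReal.coe_lt_coe_iff.1 hq)
      exact hcq.trans_le (le_sSup ⟨G, hG, hGF, hGu⟩)
  · refine le_antisymm (sSup_le ?_) (le_of_forall_lt fun c hc => ?_)
    · rintro _ ⟨G, hG, hGF, rfl⟩
      exact hG.le_of_tendsto hGF hvw hFlim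
    · obtain ⟨q, hcq, hq⟩ := EReal.lt_iff_exists_real_btwn.1 hc
      obtain ⟨G, hG, hGF, hGu⟩ := hlow q (EReal.coe_lt_coe_iff.1 hq)
      exact hcq.trans_le (le_sSup ⟨G, seqLSC_of_lowerSemicontinuous _ hG, hGF, hGu⟩)
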